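/- Let $\phi\in\mathbb R$ and consider the AR(1) state-space model $$\mu_i=\phi\mu_{i-1}+U_i,\qquad Y_i=\mu_i+\varepsilon_i,\qquad i=1,2,\dots,$$ where $\mu_0,U_1,U_2,\dots,\varepsilon_1,\varepsilon_2,\dots$ are mutually independent, $\mu_0$ has mean zero and finite variance, the $U_i$ are identically distributed with mean zero and finite variance, and $\varepsilon_i\sim N(0,1)$. For every $n$ and $1\le i\le n$, let $\hat\mu^K_i$ be the (retrospective) Kalman estimator of $\mu_i$, that is, the best linear estimator (in mean square) of $\mu_i$ based on $Y_1,\dots,Y_n$, let $\tilde\mu^K_i$ be the best linear estimator of $\mu_i$ based on $Y_j$, $1\le j\le n$, $j\ne i$, and let $Z_i=Y_i-\tilde\mu^K_i$. Let $K(x)=2(e^x+e^{-x})^{-2}$, $\sigma_n=1/\log n$, $$\hat f(z)=\frac1n\sum_{j=1}^n\frac1{\sigma_n}K\Bigl(\frac{Z_j-z}{\sigma_n}\Bigr),\qquad \hat\delta(z)=z+\frac{\hat f'(z)}{\hat f(z)},$$ where $\hat f'$ is the derivative of $\hat f$, and define the improved estimator $\hat\mu^I_i=\tilde\mu^K_i+\hat\delta(Z_i)$.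 If the law of the $U_i$ is not a normal distribution (a point mass counts as a normal distribution with variance $0$), then there are a constant $c\in(0,1)$ and an $n_0$ such that for all $n\ge n_0$ $$E\|\hat{\boldsymbol\mu}^I-\boldsymbol\mu\|^2\le c\,E\|\hat{\boldsymbol\mu}^K-\boldsymbol\mu\|^2,$$ where $\|\cdot\|$ is the Euclidean norm on $\mathbb R^n$ and both expectations are finite. -/

import Mathlib

open MeasureTheory ProbabilityTheory Filter
open scoped NNReal

noncomputable section

namespace EBKalman

variable {Ω : Type*} [MeasurableSpace Ω]

/-! ### The AR(1) state-space model

Times `1, 2, 3, …` are indexed by `0, 1, 2, …`: `U i` is the innovation and `ε i` the observation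
error at time `i + 1`, and `μ₀` is the state at time `0`. -/

/-- The state: the first one is `φ μ₀ + U 0`, and then `μ (i + 1) = φ (μ i) + U (i + 1)`. -/
def state (φ : ℝ) (μ₀ : Ω → ℝ) (U : ℕ → Ω → ℝ) : ℕ → Ω → ℝ
  | 0 => fun ω => φ * μ₀ ω + U 0 ω
  | i + 1 => fun ω => φ * state φ μ₀ U i ω + U (i + 1) ω

/-- The observation `Y i = μ i + ε i`. -/
def obs (φ : ℝ) (μ₀ : Ω → ℝ) (U ε : ℕ → Ω → ℝ) (i : ℕ) : Ω → ℝ :=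
  fun ω => state φ μ₀ U i ω + ε i ω

/-- The vector of the first `n` states. -/
def stateVec (φ : ℝ) (μ₀ : Ω → ℝ) (U : ℕ → Ω → ℝ) (n : ℕ) : Fin n → Ω → ℝ :=
  fun i => state φ μ₀ U i

/-- The vector of the first `n` observations. -/
def obsVec (φ : ℝ) (μ₀ : Ω → ℝ) (U ε : ℕ → Ω → ℝ) (n : ℕ) : Fin n → Ω → ℝ :=
  fun i => obs φ μ₀ U ε i

/-! ### Best linear estimation -/

/-- `β` minimizes the mean squared error `E (X - ∑ j ∈ S, β j * Y j) ^ 2` among all families of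
coefficients. -/
def IsBestLinear {ι : Type*} (P : Measure Ω) (Y : ι → Ω → ℝ) (S : Finset ι) (X : Ω → ℝ)
    (β : ι → ℝ) : Prop :=
  ∀ γ : ι → ℝ, ∫ ω, (X ω - ∑ j ∈ S, β j * Y j ω) ^ 2 ∂P ≤
    ∫ ω, (X ω - ∑ j ∈ S, γ j * Y j ω) ^ 2 ∂P

/-- Optimal coefficients exist for square-integrable variables. -/
theorem exists_isBestLinear {ι : Type*} (P : Measure Ω) (Y : ι → Ω → ℝ) (S : Finset ι) (X : Ω → ℝ)
    (hY : ∀ j, MemLp (Y j) 2 P) (hX : MemLp X 2 P) : ∃ β, IsBestLinear P Y S X β := by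
  classical
  let L : (S → ℝ) →ₗ[ℝ] Lp ℝ 2 P := Fintype.linearCombination ℝ (fun j : S => (hY j).toLp (Y j))
  have key : ∀ γ : ι → ℝ, ∫ ω, (X ω - ∑ j ∈ S, γ j * Y j ω) ^ 2 ∂P =
      ‖hX.toLp X - L (fun j => γ j)‖ ^ 2 := by
    intro γ
    rw [← real_inner_self_eq_norm_sq, L2.inner_def]
    apply integral_congr_ae
    have hsum : (L (fun j => γ j) : Ω → ℝ) =ᵐ[P] fun ω => ∑ j ∈ S, γ j * Y j ω := by
      have h1 : L (fun j => γ j) = ∑ j ∈ S, γ j • (hY j).toLp (Y j) := by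
        rw [Fintype.linearCombination_apply, Finset.sum_coe_sort S
          (fun j => γ j • (hY j).toLp (Y j))]
      rw [h1]
      clear h1
      induction S using Finset.induction_on with
      | empty =>
        simp only [Finset.sum_empty]
        exact Lp.coeFn_zero ℝ 2 P
      | insert a T ha ih =>
        rw [Finset.sum_insert ha]
        filter_upwards [ih, Lp.coeFn_add (γ a • (hY a).toLp (Y a))
          (∑ j ∈ T, γ j • (hY j).toLp (Y j)), Lp.coeFn_smul (γ a) ((hY a).toLp (Y a)),
          (hY a).coeFn_toLp] with ω h1 h2 h3 h4
        rw [h2, Finset.sum_insert ha, Pi.add_apply, h1, h3, Pi.smul_apply, h4, smul_eq_mul]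
    filter_upwards [hsum, hX.coeFn_toLp, Lp.coeFn_sub (hX.toLp X) (L fun j => γ j)] with ω h1 h2 h3
    rw [h3]
    simp [h1, h2, pow_two]
  obtain ⟨v, hv, hmin⟩ := Submodule.exists_norm_eq_iInf_of_complete_subspace (LinearMap.range L)
    (LinearMap.range L).complete_of_finiteDimensional (hX.toLp X)
  obtain ⟨b, rfl⟩ := hv
  refine ⟨fun j => if h : j ∈ S then b ⟨j, h⟩ else 0, fun γ => ?_⟩
  rw [key, key]
  have hb : (fun j : S => (if h : (j : ι) ∈ S then b ⟨j, h⟩ else 0)) = b := by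
    funext j; simp
  rw [hb]
  refine pow_le_pow_left₀ (norm_nonneg _) ?_ 2
  rw [hmin]
  exact ciInf_le ⟨0, by rintro _ ⟨w, rfl⟩; exact norm_nonneg _⟩
    (⟨L fun j => γ j, LinearMap.mem_range_self _ _⟩ : LinearMap.range L)

/-- The best linear estimator of `X` based on the observations `Y j`, `j ∈ S`: the linear
combination whose coefficients are chosen among the minimizers, which exist by
`exists_isBestLinear` when all the variables are square-integrable. -/
def bestLinear {ι : Type*} (P : Measure Ω) (Y : ι → Ω → ℝ) (S : Finset ι) (X : Ω → ℝ) : Ω → ℝ :=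
  fun ω => ∑ j ∈ S, Classical.epsilon (IsBestLinear P Y S X) j * Y j ω

/-! ### Retrospective Kalman estimators of `μ i` from `n` observations -/

/-- The estimator `μ̃ᴷ i`: best linear in the observations other than the `i`-th one. -/
def kalmanLeaveOut (P : Measure Ω) {n : ℕ} (μ Y : Fin n → Ω → ℝ) (i : Fin n) : Ω → ℝ :=
  bestLinear P Y (Finset.univ.erase i) (μ i)

/-- The Kalman estimator `μ̂ᴷ i`: best linear in all the observations. -/
def kalman (P : Measure Ω) {n : ℕ} (μ Y : Fin n → Ω → ℝ) (i : Fin n) : Ω → ℝ :=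
  bestLinear P Y Finset.univ (μ i)

/-! ### The empirical Bayes improvement -/

/-- The logistic kernel, the derivative of the distribution function `1 / (1 + exp (-2 x))`. -/
def kernel (x : ℝ) : ℝ := 2 / (Real.exp x + Real.exp (-x)) ^ 2

/-- The kernel density estimate with bandwidth `σ` based on the points `z j`. -/
def densityEst (σ : ℝ) {n : ℕ} (z : Fin n → ℝ) (x : ℝ) : ℝ :=
  (1 / n : ℝ) * ∑ j, σ⁻¹ * kernel ((z j - x) / σ)

/-- The estimated decision function `δ̂ x = x + f̂' x / f̂ x`. -/
def deltaHat (σ : ℝ) {n : ℕ} (z : Fin n → ℝ) (x : ℝ) : ℝ :=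
  x + deriv (densityEst σ z) x / densityEst σ z x

/-- The improved estimator `μ̂ᴵ i = μ̃ᴷ i + δ̂ (Z i)`, where `Z i = Y i - μ̃ᴷ i` and the bandwidth
is `1 / log n`. -/
def improved (P : Measure Ω) {n : ℕ} (μ Y : Fin n → Ω → ℝ) (i : Fin n) : Ω → ℝ := fun ω =>
  kalmanLeaveOut P μ Y i ω +
    deltaHat (1 / Real.log n) (fun j => Y j ω - kalmanLeaveOut P μ Y j ω)
      (Y i ω - kalmanLeaveOut P μ Y i ω)

/-- The squared Euclidean norm `‖m - μ‖²` of the error of an estimator `m` of `μ`. -/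
def sqLoss {n : ℕ} (m μ : Fin n → Ω → ℝ) (ω : Ω) : ℝ := ∑ i, (m i ω - μ i ω) ^ 2

end EBKalman

end

/-! The residual splits as `Z i = (μ i - μ̃ᴷ i) + ε i`. Its first summand, the signal, involves only
the initial state, the innovations and the errors other than `ε i`, so it is independent of the
standard normal `ε i`. Since `μ̃ᴷ i + Z i = μ i + ε i`, the error of the improved estimator is
exactly `f̂' / f̂ (Z i) + ε i` (`improved_sub_state`). The problem becomes a normal means problem in
which the common law of the signals has to be learnt from the data.

The gap. Let `G` be the limiting law of the signal, `v` its variance and `f` the density of `G *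
N(0,1)`. Tweedie's formula says that `-f' / f (Z)` is the conditional mean of the noise. The risk of
the true score is therefore `1 - J`, where `J` is the second moment of `f' / f (Z)`, and it equals
`v / (1 + v)` minus the second moment of `f' / f (Z) + Z / (1 + v)`
(`integral_mixScore_add_noise_sq`). The subtracted term vanishes only if the score is linear, that
is, if `f` is a normal density. On the other side, adding `Y i` to a leave-one-out rule of risk `v`
cannot bring a linear rule below `v / (1 + v)` (`le_integral_sq_kalman_sub`). The Kalman risk per
coordinate is thus asymptotically at least `v / (1 + v)`.

Non-normality. The leave-one-out weights come from a row of the inverse of the tridiagonal posterior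
precision matrix. Far from both ends this row is geometrically close to `κ r ^ |j|`, so the signal
is close to a stationary two-sided moving average of innovations and errors
(`exists_stationary_weights`, `exists_bulk_coupling`). The innovation of lag zero has a nonzero
coefficient in it. If `Z` were normal in the limit, Cramér's theorem
(`map_eq_gaussianReal_of_indepFun_add`) would make that innovation normal.

Estimation. Moving averages truncated at lag `n ^ (1/16)` are independent once their windows are
disjoint, so the kernel estimates of `f` and `f'` have small variance (`lpNorm_empirical_sub_le`),
and a grid makes this uniform on a growing interval. The logistic kernel satisfies `|K'| ≤ 2 K`,
hence `|f̂' / f̂| ≤ 2 log n` for every sample: rare events and the coordinates near the two ends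
cost only powers of `log n` times a negative power of `n`. The estimate actually tracks the score of
the smoothed density, whose risk tends to that of the true score because its growth is linear
uniformly in the bandwidth (`tendsto_integral_smoothScore`). -/

set_option linter.unusedSectionVars false

/-! ### Cramér's decomposition theorem -/

/-- An entire function of at most quadratic growth has vanishing third derivative. -/
theorem iteratedDeriv_three_eq_zero_of_growth {g : ℂ → ℂ} (hg : Differentiable ℂ g) {A B : ℝ}
    (hA : 0 ≤ A) (h : ∀ z, ‖g z‖ ≤ A * ‖z‖ ^ 2 + B) (c : ℂ) : iteratedDeriv 3 g c = 0 := by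
  -- Cauchy's estimate on the circle of radius `R`: a quadratic bound against `R ^ 3`, which tends
  -- to zero with growing `R`.
  have hb : ∀ R : ℝ, 0 < R →
      ‖iteratedDeriv 3 g c‖ ≤ 6 * (A * (‖c‖ + R) ^ 2 + B) / R ^ 3 := by
    intro R hR
    have := Complex.norm_iteratedDeriv_le_of_forall_mem_sphere_norm_le (f := g) (c := c) (R := R)
      (C := A * (‖c‖ + R) ^ 2 + B) 3 hR hg.diffContOnCl (by
        intro z hz
        refine (h z).trans ?_
        have : ‖z‖ ≤ ‖c‖ + R := by
          have h1 : ‖z - c‖ = R := by simpa [dist_eq_norm] using hz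
          calc ‖z‖ = ‖c + (z - c)‖ := by ring_nf
            _ ≤ _ := by rw [← h1]; exact norm_add_le _ _
        gcongr)
    simpa [Nat.factorial] using this
  have hlim : Tendsto (fun R : ℝ => 6 * (A * (‖c‖ * R⁻¹ + 1) ^ 2 + B * R⁻¹ ^ 2) * R⁻¹) atTop
      (nhds (6 * (A * (‖c‖ * 0 + 1) ^ 2 + B * 0 ^ 2) * 0)) := by
    have := tendsto_inv_atTop_zero (𝕜 := ℝ)
    exact ((((((this.const_mul _).add_const _).pow 2).const_mul _).add
      ((this.pow 2).const_mul _)).const_mul _).mul this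
  rw [mul_zero] at hlim
  rw [← norm_le_zero_iff]
  refine ge_of_tendsto hlim ?_
  filter_upwards [eventually_gt_atTop 0] with R hR
  refine (hb R hR).trans (le_of_eq ?_)
  field_simp

/-- An entire function whose third derivative vanishes is a quadratic polynomial. -/
theorem eq_quadratic_of_iteratedDeriv_three {g : ℂ → ℂ} (hg : Differentiable ℂ g)
    (h : ∀ c, iteratedDeriv 3 g c = 0) (h0 : g 0 = 0) :
    ∃ a b : ℂ, ∀ z, g z = a * z + b * z ^ 2 := by
  have hcd : ContDiff ℂ 3 g := hg.contDiff
  have hd1 : Differentiable ℂ (deriv g) := by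
    simpa [iteratedDeriv_one] using hcd.differentiable_iteratedDeriv 1 (by norm_num)
  have hd2 : Differentiable ℂ (deriv (deriv g)) := by
    have := hcd.differentiable_iteratedDeriv 2 (by norm_num)
    simpa [iteratedDeriv_succ, iteratedDeriv_one] using this
  have h3 : ∀ c, deriv (deriv (deriv g)) c = 0 := by
    intro c; simpa [iteratedDeriv_succ, iteratedDeriv_one] using h c
  have e2 : ∀ z, deriv (deriv g) z = deriv (deriv g) 0 := fun z =>
    is_const_of_deriv_eq_zero hd2 h3 z 0
  set β := deriv (deriv g) 0
  have e1 : ∀ z, deriv g z = deriv g 0 + β * z := by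
    intro z
    have := is_const_of_deriv_eq_zero (f := fun z => deriv g z - β * z)
      (by fun_prop) (by
        intro x
        rw [deriv_fun_sub (hd1 x) (by fun_prop), e2 x]
        simp) z 0
    simp at this
    linear_combination this
  refine ⟨deriv g 0, β / 2, fun z => ?_⟩
  have := is_const_of_deriv_eq_zero (f := fun z => g z - (deriv g 0 * z + β / 2 * z ^ 2))
      (by fun_prop) (by
        intro x
        rw [deriv_fun_sub (hg x) (by fun_prop), e1 x, deriv_fun_add (by fun_prop) (by fun_prop)]
        simp
        ring) z 0
  simp [h0] at this
  linear_combination this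

/-- A zero-free entire function of order at most two is the exponential of a quadratic
polynomial. -/
theorem exists_eq_exp_quadratic {F : ℂ → ℂ} (hF : Differentiable ℂ F) (h0 : F 0 = 1)
    (hne : ∀ z, F z ≠ 0) {A : ℝ} (hA : 0 ≤ A) (hgr : ∀ z, ‖F z‖ ≤ Real.exp (A * ‖z‖ ^ 2)) :
    ∃ a b : ℂ, ∀ z, F z = Complex.exp (a * z + b * z ^ 2) := by
  have hF' : Differentiable ℂ (deriv F) := by
    have := (hF.contDiff (n := 2)).differentiable_iteratedDeriv 1 (by norm_num)
    simpa [iteratedDeriv_one] using this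
  -- The primitive `g` of the logarithmic derivative is an entire logarithm of `F`.
  obtain ⟨g, hg0, hg⟩ := (Differentiable.isExactOn_univ (f := fun z => deriv F z / F z)
    (hF'.div hF hne)).with_val_at 0 0
  replace hg := fun z => hg z (Set.mem_univ z)
  have hgd : Differentiable ℂ g := fun z => (hg z).differentiableAt
  have hFg : ∀ z, F z = Complex.exp (g z) := by
    intro z
    have := is_const_of_deriv_eq_zero (f := fun z => F z * Complex.exp (-g z))
      (by fun_prop) (by
        intro x
        have h1 := ((hF x).hasDerivAt.mul ((hg x).neg.cexp))
        have h2 := h1.deriv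
        have e : deriv (fun z => F z * Complex.exp (-g z)) x =
          deriv (F * fun z => Complex.exp (-g z)) x := rfl
        rw [e]
        refine h2.trans ?_
        have := hne x
        simp only [Pi.neg_apply]
        field_simp
        ring) z 0
    simp [h0, hg0] at this
    rw [Complex.exp_neg] at this
    field_simp at this
    exact this
  have hre : ∀ z, (g z).re ≤ A * ‖z‖ ^ 2 := by
    intro z
    have := hgr z
    rw [hFg, Complex.norm_exp] at this
    exact Real.exp_le_exp.1 this
  have hgrow : ∀ z, ‖g z‖ ≤ (8 * A) * ‖z‖ ^ 2 + 2 := by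
    intro z
    by_cases hz : z = 0
    · simp [hz, hg0]
    have hzp : 0 < ‖z‖ := norm_pos_iff.2 hz
    -- Growth of `F` bounds only the real part of `g`; Borel–Carathéodory on a disc of twice the
    -- radius bounds `g` itself. The summand 1 keeps the bound positive when `A = 0`.
    have := Complex.borelCaratheodory_zero (f := g) (z := z) (R := 2 * ‖z‖)
      (M := A * (2 * ‖z‖) ^ 2 + 1) (by positivity) hgd.differentiableOn (by
        intro w hw
        have hw' : ‖w‖ < 2 * ‖z‖ := by simpa using hw
        change (g w).re ≤ _
        refine (hre w).trans ?_
        have : A * ‖w‖ ^ 2 ≤ A * (2 * ‖z‖) ^ 2 := by gcongr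
        linarith) (by positivity) (by simp; linarith) hg0
    refine this.trans (le_of_eq ?_)
    have : 2 * ‖z‖ - ‖z‖ = ‖z‖ := by ring
    rw [this]
    field_simp
    ring
  obtain ⟨a, b, hab⟩ := eq_quadratic_of_iteratedDeriv_three hgd
    (iteratedDeriv_three_eq_zero_of_growth hgd (by positivity) hgrow) hg0
  exact ⟨a, b, fun z => by rw [hFg, hab]⟩

/-- **Cramér's theorem**: an independent centred summand of a normal variable is normal. -/
theorem map_eq_gaussianReal_of_indepFun_add {Ω : Type*} [MeasurableSpace Ω] {P : Measure Ω}
    [IsProbabilityMeasure P] {X W : Ω → ℝ} (hX : Measurable X) (hW : Measurable W)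
    (hWi : Integrable W P)
    (hX0 : ∫ ω, X ω ∂P = 0) (hW0 : ∫ ω, W ω ∂P = 0) (hind : IndepFun X W P)
    {v : ℝ≥0} (hG : P.map (fun ω => X ω + W ω) = gaussianReal 0 v) :
    ∃ v' : ℝ≥0, P.map X = gaussianReal 0 v' := by
  have hcm : ∀ z : ℂ, Measurable fun x : ℝ => Complex.exp (z * x) := by
    intro z; fun_prop
  -- the characteristic functions on the whole complex plane multiply
  have hmul : ∀ z : ℂ, complexMGF X P z * complexMGF W P z = Complex.exp (v * z ^ 2 / 2) := by
    intro z
    have h1 := complexMGF_gaussianReal hG z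
    simp only [Complex.ofReal_zero, mul_zero, zero_add] at h1
    rw [← h1]
    have h2 := hind.integral_fun_comp_mul_comp (f := fun x : ℝ => Complex.exp (z * x))
      (g := fun x : ℝ => Complex.exp (z * x)) hX.aemeasurable hW.aemeasurable
      (hcm z).aestronglyMeasurable (hcm z).aestronglyMeasurable
    simp only [complexMGF]
    rw [← h2]
    congr 1
    funext ω
    rw [← Complex.exp_add]
    push_cast
    ring_nf
  have hneX : ∀ z, complexMGF X P z ≠ 0 := fun z h => by
    have := hmul z
    rw [h, zero_mul] at this
    exact Complex.exp_ne_zero _ this.symm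
  have hmulr : ∀ t : ℝ, mgf X P t * mgf W P t = Real.exp (v * t ^ 2 / 2) := by
    intro t
    have := hmul t
    rw [complexMGF_ofReal, complexMGF_ofReal] at this
    exact_mod_cast this
  -- The integral of a non-integrable function is 0 by convention, and the product of the two
  -- generating functions is never 0. Finiteness of all exponential moments of both summands comes
  -- for free.
  have hposX : ∀ t : ℝ, 0 < mgf X P t := by
    intro t
    refine lt_of_le_of_ne mgf_nonneg (fun h => ?_)
    have := hmulr t
    rw [← h, zero_mul] at this
    exact (Real.exp_pos _).ne this
  have hposW : ∀ t : ℝ, 0 < mgf W P t := by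
    intro t
    refine lt_of_le_of_ne mgf_nonneg (fun h => ?_)
    have := hmulr t
    rw [← h, mul_zero] at this
    exact (Real.exp_pos _).ne this
  have hexpX : integrableExpSet X P = Set.univ := by
    ext t; simpa [integrableExpSet] using mgf_pos_iff.1 (hposX t)
  -- Since `W` is centred, `exp x ≥ 1 + x` bounds its generating function below by 1, so that of `X`
  -- is at most the normal one. This is the order-two growth needed below.
  have hW1 : ∀ t : ℝ, 1 ≤ mgf W P t := by
    intro t
    have hi : Integrable (fun ω => Real.exp (t * W ω)) P := mgf_pos_iff.1 (hposW t)
    calc (1 : ℝ) = ∫ ω, (1 + t * W ω) ∂P := by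
          rw [integral_add (by fun_prop) (by fun_prop), integral_const_mul, hW0]; simp
      _ ≤ mgf W P t := by
          refine integral_mono (by fun_prop) hi fun ω => ?_
          have := Real.add_one_le_exp (t * W ω)
          simp only
          linarith
  have hre : ∀ z : ℂ, z.re ∈ interior (integrableExpSet X P) := by
    intro z; rw [hexpX]; simp
  have hdiff : Differentiable ℂ (complexMGF X P) := fun z =>
    (hasDerivAt_complexMGF (hre z)).differentiableAt
  obtain ⟨a, b, hab⟩ := exists_eq_exp_quadratic hdiff (by simp [complexMGF]) hneX
    (A := v / 2) (by positivity) (by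
      intro z
      refine norm_complexMGF_le_mgf.trans ?_
      have h1 : mgf X P z.re ≤ Real.exp (v * z.re ^ 2 / 2) := by
        rw [← hmulr]
        exact le_mul_of_one_le_right (hposX _).le (hW1 _)
      refine h1.trans (Real.exp_le_exp.2 ?_)
      have : z.re ^ 2 ≤ ‖z‖ ^ 2 := by
        rw [← sq_abs]; gcongr; exact Complex.abs_re_le_norm z
      have hv : (0 : ℝ) ≤ v := v.2
      nlinarith)
  have hfun : complexMGF X P = fun z => Complex.exp (a * z + b * z ^ 2) := funext hab
  have hder : ∀ z, HasDerivAt (complexMGF X P)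
      ((a + 2 * b * z) * Complex.exp (a * z + b * z ^ 2)) z := by
    intro z
    rw [hfun]
    have h1 : HasDerivAt (fun z : ℂ => a * z + b * z ^ 2) (a + 2 * b * z) z := by
      have := ((hasDerivAt_id z).const_mul a).add ((hasDerivAt_pow 2 z).const_mul b)
      refine this.congr_deriv ?_
      simp; ring
    refine h1.cexp.congr_deriv ?_
    ring
  -- The coefficients of the quadratic are read off from the first two derivatives at 0, that is,
  -- from the first two moments of `X`.
  have ha : a = 0 := by
    have h1 := (hder 0).unique (hasDerivAt_complexMGF (hre 0))
    simp at h1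
    rw [h1]
    have : ∫ ω, (X ω : ℂ) ∂P = ((∫ ω, X ω ∂P : ℝ) : ℂ) := integral_ofReal
    rw [this, hX0]; simp
  have hb : 2 * b = ((∫ ω, X ω ^ 2 ∂P : ℝ) : ℂ) := by
    have h1 := iteratedDeriv_complexMGF (X := X) (μ := P) (hre 0) 2
    have h2 : deriv (complexMGF X P) = fun z => (a + 2 * b * z) * Complex.exp (a * z + b * z ^ 2) :=
      funext fun z => (hder z).deriv
    rw [iteratedDeriv_succ, iteratedDeriv_one, h2] at h1
    have h3 : HasDerivAt (fun z : ℂ => (a + 2 * b * z) * Complex.exp (a * z + b * z ^ 2))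
        (2 * b) 0 := by
      have e1 : HasDerivAt (fun z : ℂ => a + 2 * b * z) (2 * b) 0 := by
        simpa using ((hasDerivAt_id (0 : ℂ)).const_mul (2 * b)).const_add a
      have := e1.mul (hder 0)
      rw [hfun] at this
      refine this.congr_deriv ?_
      simp [ha]
    rw [h3.deriv] at h1
    rw [h1, ← integral_complex_ofReal]
    simp
  have hnn : 0 ≤ ∫ ω, X ω ^ 2 ∂P := integral_nonneg fun ω => sq_nonneg _
  refine ⟨(∫ ω, X ω ^ 2 ∂P).toNNReal, ?_⟩
  have : IsProbabilityMeasure (P.map X) := Measure.isProbabilityMeasure_map hX.aemeasurable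
  refine Measure.ext_of_charFun ?_
  funext t
  rw [charFun_gaussianReal, ← complexMGF_mul_I hX.aemeasurable, hab, ha]
  congr 1
  have hb' : b = ((∫ ω, X ω ^ 2 ∂P : ℝ) : ℂ) / 2 := by linear_combination hb / 2
  rw [hb']
  have hI : Complex.I ^ 2 = -1 := Complex.I_sq
  rw [Real.coe_toNNReal _ hnn, mul_pow, hI]
  simp
  ring

/-! ### The quadratic form of the autoregressive smoothing problem -/

/-- The innovations of a sequence under autoregression with parameter `φ`. -/
def innov (φ : ℝ) (x : ℕ → ℝ) : ℕ → ℝ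
  | 0 => x 0
  | k + 1 => x (k + 1) - φ * x k

/-- The innovation variances: `d₀` at the start and `τ` afterwards. -/
def innovVar (d₀ τ : ℝ) : ℕ → ℝ
  | 0 => d₀
  | _ + 1 => τ

theorem innovVar_pos {d₀ τ : ℝ} (hd : 0 < d₀) (hτ : 0 < τ) (k : ℕ) : 0 < innovVar d₀ τ k := by
  cases k <;> simpa [innovVar]

/-- The bilinear form of the posterior precision matrix of the first `n` states. -/
noncomputable def smoothForm (φ d₀ τ : ℝ) (n : ℕ) (x y : ℕ → ℝ) : ℝ :=
  ∑ k ∈ Finset.range n, (x k * y k + innov φ x k * innov φ y k / innovVar d₀ τ k)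

section

variable {φ d₀ τ : ℝ} {n : ℕ}

theorem innov_add (x y : ℕ → ℝ) (k : ℕ) :
    innov φ (fun j => x j + y j) k = innov φ x k + innov φ y k := by
  cases k <;> simp [innov] ; ring

theorem innov_sub (x y : ℕ → ℝ) (k : ℕ) :
    innov φ (fun j => x j - y j) k = innov φ x k - innov φ y k := by
  cases k <;> simp [innov] ; ring

theorem innov_smul (c : ℝ) (x : ℕ → ℝ) (k : ℕ) :
    innov φ (fun j => c * x j) k = c * innov φ x k := by
  cases k <;> simp [innov] ; ring

theorem innov_congr {x y : ℕ → ℝ} (h : ∀ k < n, x k = y k) {k : ℕ} (hk : k < n) :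
    innov φ x k = innov φ y k := by
  cases k with
  | zero => exact h 0 hk
  | succ k => simp only [innov]; rw [h _ hk, h k (by omega)]

theorem smoothForm_congr_left {x x' y : ℕ → ℝ} (h : ∀ k < n, x k = x' k) :
    smoothForm φ d₀ τ n x y = smoothForm φ d₀ τ n x' y := by
  refine Finset.sum_congr rfl fun k hk => ?_
  have hk := Finset.mem_range.1 hk
  rw [h k hk, innov_congr h hk]

theorem smoothForm_add_left (x x' y : ℕ → ℝ) :
    smoothForm φ d₀ τ n (fun j => x j + x' j) y =
      smoothForm φ d₀ τ n x y + smoothForm φ d₀ τ n x' y := by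
  simp only [smoothForm, ← Finset.sum_add_distrib]
  refine Finset.sum_congr rfl fun k _ => ?_
  rw [innov_add]; ring

theorem smoothForm_add_right (x y y' : ℕ → ℝ) :
    smoothForm φ d₀ τ n x (fun j => y j + y' j) =
      smoothForm φ d₀ τ n x y + smoothForm φ d₀ τ n x y' := by
  simp only [smoothForm, ← Finset.sum_add_distrib]
  refine Finset.sum_congr rfl fun k _ => ?_
  rw [innov_add]; ring

theorem smoothForm_sub_right (x y y' : ℕ → ℝ) :
    smoothForm φ d₀ τ n x (fun j => y j - y' j) =
      smoothForm φ d₀ τ n x y - smoothForm φ d₀ τ n x y' := by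
  simp only [smoothForm, ← Finset.sum_sub_distrib]
  refine Finset.sum_congr rfl fun k _ => ?_
  rw [innov_sub]; ring

theorem smoothForm_smul_left (c : ℝ) (x y : ℕ → ℝ) :
    smoothForm φ d₀ τ n (fun j => c * x j) y = c * smoothForm φ d₀ τ n x y := by
  simp only [smoothForm, Finset.mul_sum]
  refine Finset.sum_congr rfl fun k _ => ?_
  rw [innov_smul]; ring

theorem smoothForm_smul_right (c : ℝ) (x y : ℕ → ℝ) :
    smoothForm φ d₀ τ n x (fun j => c * y j) = c * smoothForm φ d₀ τ n x y := by
  simp only [smoothForm, Finset.mul_sum]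
  refine Finset.sum_congr rfl fun k _ => ?_
  rw [innov_smul]; ring

/-- Coercivity: the observations contribute the identity matrix to the precision and the innovations
a nonnegative form. It gives both invertibility and the stability estimate for approximate rows of
the inverse. -/
theorem sum_sq_le_smoothForm (hd : 0 < d₀) (hτ : 0 < τ) (x : ℕ → ℝ) :
    ∑ k ∈ Finset.range n, x k ^ 2 ≤ smoothForm φ d₀ τ n x x := by
  refine Finset.sum_le_sum fun k _ => ?_
  have := innovVar_pos hd hτ k
  have : 0 ≤ innov φ x k * innov φ x k / innovVar d₀ τ k :=
    div_nonneg (mul_self_nonneg _) this.le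
  nlinarith

/-- The posterior precision matrix is invertible. -/
theorem exists_smoothForm_eq (φ : ℝ) (hd : 0 < d₀) (hτ : 0 < τ) {i : ℕ} (hi : i < n) :
    ∃ g : ℕ → ℝ, ∀ x, smoothForm φ d₀ τ n x g = x i := by
  let ext : (Fin n → ℝ) → ℕ → ℝ := fun x k => if h : k < n then x ⟨k, h⟩ else 0
  have ext_add : ∀ x y, ext (x + y) = fun j => ext x j + ext y j := by
    intro x y; funext j; by_cases h : j < n <;> simp [ext, h]
  have ext_smul : ∀ (c : ℝ) x, ext (c • x) = fun j => c * ext x j := by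
    intro c x; funext j; by_cases h : j < n <;> simp [ext, h]
  let L : (Fin n → ℝ) →ₗ[ℝ] (Fin n → ℝ) →ₗ[ℝ] ℝ :=
    LinearMap.mk₂ ℝ (fun g x => smoothForm φ d₀ τ n (ext x) (ext g))
      (fun g g' x => by rw [ext_add, smoothForm_add_right])
      (fun c g x => by rw [ext_smul, smoothForm_smul_right]; rfl)
      (fun g x x' => by rw [ext_add, smoothForm_add_left])
      (fun c g x => by rw [ext_smul, smoothForm_smul_left]; rfl)
  -- Coercivity gives injectivity, and equality of dimensions gives surjectivity onto the dual. The
  -- preimage of the `i`-th coordinate functional is the `i`-th row of the inverse precision matrix.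
  have hinj : Function.Injective L := by
    rw [← LinearMap.ker_eq_bot, LinearMap.ker_eq_bot']
    intro g hg
    have h1 : smoothForm φ d₀ τ n (ext g) (ext g) = 0 := by
      have : L g g = 0 := by rw [hg]; rfl
      exact this
    have h2 := sum_sq_le_smoothForm (n := n) (φ := φ) hd hτ (ext g)
    rw [h1] at h2
    have h3 := (Finset.sum_eq_zero_iff_of_nonneg (fun k _ => sq_nonneg (ext g k))).1
      (le_antisymm h2 (Finset.sum_nonneg fun k _ => sq_nonneg _))
    funext j
    have := h3 j (Finset.mem_range.2 j.2)
    simpa [ext] using this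
  have hsurj : Function.Surjective L :=
    (LinearMap.injective_iff_surjective_of_finrank_eq_finrank
      (Subspace.dual_finrank_eq (K := ℝ) (V := Fin n → ℝ)).symm).1 hinj
  obtain ⟨g, hg⟩ := hsurj (LinearMap.proj (⟨i, hi⟩ : Fin n))
  refine ⟨ext g, fun x => ?_⟩
  have h1 : L g (fun k => x k) = x i := by rw [hg]; rfl
  rw [← h1]
  refine smoothForm_congr_left fun k hk => ?_
  simp [ext, hk]

/-- Summation by parts for the precision form. -/
theorem smoothForm_succ_eq (x : ℕ → ℝ) (S : ℤ → ℝ) (hτ : τ ≠ 0) (n : ℕ) :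
    smoothForm φ d₀ τ (n + 1) x (fun k => S k) =
      ∑ k ∈ Finset.range (n + 1), x k * (S k +
        ((1 + φ ^ 2) * S k - φ * S (k - 1) - φ * S (k + 1)) / τ) +
      x n * (φ * (S (n + 1) - φ * S n) / τ) + x 0 * (S 0 / d₀ - (S 0 - φ * S (-1)) / τ) := by
  -- Because `S` lives on `ℤ`, the interior equation makes sense at every index, including the ends;
  -- the two boundary terms correct the first and the last row.
  induction n with
  | zero =>
    simp [smoothForm, innov, innovVar]
    field_simp
    ring
  | succ n ih =>
    have : smoothForm φ d₀ τ (n + 1 + 1) x (fun k => S k) =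
      smoothForm φ d₀ τ (n + 1) x (fun k => S k) +
        (x (n + 1) * S (n + 1) + (x (n + 1) - φ * x n) * (S (n + 1) - φ * S n) / τ) := by
      rw [smoothForm, Finset.sum_range_succ]
      simp [smoothForm, innov, innovVar]
    rw [this, ih, Finset.sum_range_succ _ (n + 1)]
    push_cast
    have e : ((n : ℤ) + 1 - 1) = n := by ring
    rw [e]
    generalize (∑ k ∈ Finset.range (n + 1), x k * (S k +
      ((1 + φ ^ 2) * S k - φ * S (k - 1) - φ * S (k + 1)) / τ) : ℝ) = s
    field_simp
    ring

/-- The stationary smoother decays geometrically; its ratio solves a quadratic equation. -/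
theorem exists_smoother_root (φ : ℝ) (hτ : 0 < τ) :
    ∃ r : ℝ, |r| < 1 ∧ φ * r ^ 2 - (τ + 1 + φ ^ 2) * r + φ = 0 := by
  have hc : ContinuousOn (fun r : ℝ => φ * r ^ 2 - (τ + 1 + φ ^ 2) * r + φ) (Set.Icc (-1) 1) := by
    fun_prop
  have h1 := intermediate_value_Icc' (by norm_num : (-1 : ℝ) ≤ 1) hc
  -- The values at the endpoints are `-(τ + (φ - 1) ^ 2)` and `τ + (φ + 1) ^ 2`, nonzero and of
  -- opposite signs.
  have h2 : (0 : ℝ) ∈ Set.Icc (φ * 1 ^ 2 - (τ + 1 + φ ^ 2) * 1 + φ)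
      (φ * (-1) ^ 2 - (τ + 1 + φ ^ 2) * (-1) + φ) := by
    constructor <;> nlinarith [sq_nonneg (φ - 1), sq_nonneg (φ + 1)]
  obtain ⟨r, hr, hr0⟩ := h1 h2
  refine ⟨r, ?_, hr0⟩
  simp only at hr0
  refine abs_lt.2 ⟨lt_of_le_of_ne hr.1 ?_, lt_of_le_of_ne hr.2 ?_⟩
  · rintro rfl
    nlinarith [sq_nonneg (φ + 1)]
  · rintro rfl
    nlinarith [sq_nonneg (φ - 1)]

/-- The sequence `κ r ^ |j|` is the Green's function of the interior operator on all of `ℤ`: away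
from 0 the recurrence is the characteristic equation of `r`, and at 0 the factor `κ` normalises the
jump. -/
theorem stationary_smoother_eq {r κ : ℝ} (hτ : 0 < τ)
    (hr : φ * r ^ 2 - (τ + 1 + φ ^ 2) * r + φ = 0)
    (hκ : κ * (τ + 1 + φ ^ 2 - 2 * φ * r) = τ) (j : ℤ) :
    κ * r ^ j.natAbs + ((1 + φ ^ 2) * (κ * r ^ j.natAbs) - φ * (κ * r ^ (j - 1).natAbs)
      - φ * (κ * r ^ (j + 1).natAbs)) / τ = if j = 0 then 1 else 0 := by
  have key : ∀ m : ℕ, κ * r ^ (m + 1) + ((1 + φ ^ 2) * (κ * r ^ (m + 1)) - φ * (κ * r ^ m)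
      - φ * (κ * r ^ (m + 2))) / τ = 0 := by
    intro m
    field_simp
    linear_combination (-κ * r ^ m) * hr
  rcases lt_trichotomy j 0 with h | h | h
  · obtain ⟨m, rfl⟩ : ∃ m : ℕ, j = -(m + 1) := ⟨(-j - 1).toNat, by omega⟩
    have e1 : (-((m : ℤ) + 1)).natAbs = m + 1 := by omega
    have e2 : (-((m : ℤ) + 1) - 1).natAbs = m + 2 := by omega
    have e3 : (-((m : ℤ) + 1) + 1).natAbs = m := by omega
    rw [e1, e2, e3, if_neg (by omega)]
    rw [← key m]; ring
  · subst h
    simp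
    field_simp
    linear_combination hκ
  · obtain ⟨m, rfl⟩ : ∃ m : ℕ, j = m + 1 := ⟨(j - 1).toNat, by omega⟩
    have e1 : ((m : ℤ) + 1).natAbs = m + 1 := by omega
    have e2 : ((m : ℤ) + 1 - 1).natAbs = m := by omega
    have e3 : ((m : ℤ) + 1 + 1).natAbs = m + 2 := by omega
    rw [e1, e2, e3, if_neg (by omega), key m]

/-- Away from both ends, the smoother weights agree with the stationary ones up to a
geometrically small error. -/
theorem exists_abs_sub_stationary_le {r κ : ℝ} (hd : 0 < d₀) (hτ : 0 < τ)
    (hr : φ * r ^ 2 - (τ + 1 + φ ^ 2) * r + φ = 0)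
    (hκ : κ * (τ + 1 + φ ^ 2 - 2 * φ * r) = τ) :
    ∃ C : ℝ, 0 ≤ C ∧ ∀ n i : ℕ, i < n → ∀ g : ℕ → ℝ,
      (∀ x, smoothForm φ d₀ τ n x g = x i) → ∀ k < n,
      |g k - κ * r ^ ((k : ℤ) - i).natAbs| ≤ C * (|r| ^ i + |r| ^ (n - 1 - i)) := by
  -- The constants `b₀` and `b₁` are the boundary defects left when the stationary solution is
  -- restricted to a finite window; they appear multiplied by `r ^ i` and `r ^ (n - i)`.
  let b₀ := κ * (1 / d₀ - (1 - φ * r) / τ)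
  let b₁ := κ * (φ * (r - φ) / τ)
  refine ⟨|b₀| + |b₁|, by positivity, fun n i hi g hg k hk => ?_⟩
  obtain ⟨n, rfl⟩ : ∃ m, n = m + 1 := ⟨n - 1, by omega⟩
  let S : ℤ → ℝ := fun j => κ * r ^ (j - i).natAbs
  have hT : ∀ x : ℕ → ℝ, smoothForm φ d₀ τ (n + 1) x (fun k => S k) =
      x i + x n * (r ^ (n - i) * b₁) + x 0 * (r ^ i * b₀) := by
    intro x
    rw [smoothForm_succ_eq x S hτ.ne' n]
    have h1 : ∑ k ∈ Finset.range (n + 1), x k * (S k +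
        ((1 + φ ^ 2) * S k - φ * S (k - 1) - φ * S (k + 1)) / τ) = x i := by
      rw [Finset.sum_eq_single_of_mem i (Finset.mem_range.2 hi)]
      · have := stationary_smoother_eq hτ hr hκ ((i : ℤ) - i)
        simp only [S]
        rw [show (i : ℤ) - 1 - i = i - i - 1 by ring, show (i : ℤ) + 1 - i = i - i + 1 by ring,
          this]
        simp
      · intro k _ hki
        have := stationary_smoother_eq hτ hr hκ ((k : ℤ) - i)
        simp only [S]
        rw [show (k : ℤ) - 1 - i = k - i - 1 by ring, show (k : ℤ) + 1 - i = k - i + 1 by ring,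
          this, if_neg (by omega), mul_zero]
    rw [h1]
    have e1 : ((n : ℤ) + 1 - i).natAbs = n - i + 1 := by omega
    have e2 : ((n : ℤ) - i).natAbs = n - i := by omega
    have e3 : (-1 - (i : ℤ)).natAbs = i + 1 := by omega
    have e4 : (0 - (i : ℤ)).natAbs = i := by omega
    simp only [S, e1, e2, e3, e4, b₀, b₁]
    field_simp
    ring
  let e : ℕ → ℝ := fun k => g k - S k
  have he : smoothForm φ d₀ τ (n + 1) e e = -(e n * (r ^ (n - i) * b₁) + e 0 * (r ^ i * b₀)) := by
    change smoothForm φ d₀ τ (n + 1) e (fun k => g k - S k) = _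
    rw [smoothForm_sub_right, hg, hT]; ring
  have hsq := sum_sq_le_smoothForm (n := n + 1) (φ := φ) hd hτ e
  set Q := ∑ k ∈ Finset.range (n + 1), e k ^ 2 with hQ
  have hle : ∀ k < n + 1, |e k| ≤ √Q := fun k hk => by
    rw [← Real.sqrt_sq_eq_abs]
    refine Real.sqrt_le_sqrt ?_
    exact Finset.single_le_sum (f := fun k => e k ^ 2) (fun k _ => sq_nonneg _)
      (Finset.mem_range.2 hk)
  set b := |r| ^ (n - i) * |b₁| + |r| ^ i * |b₀| with hb
  -- Energy estimate: the form at the error `e` involves only its two end values, and coercivity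
  -- bounds the squared norm of `e` by that form.
  have hQb : Q ≤ √Q * b := by
    refine hsq.trans ?_
    rw [he]
    refine (neg_le_abs _).trans ((abs_add_le _ _).trans ?_)
    rw [abs_mul, abs_mul (r ^ _) b₁, abs_mul (e 0), abs_mul (r ^ _) b₀, abs_pow, abs_pow, hb,
      mul_add]
    gcongr
    · exact hle n (by omega)
    · exact hle 0 (by omega)
  have hQ0 : 0 ≤ Q := Finset.sum_nonneg fun k _ => sq_nonneg _
  have hb0 : 0 ≤ b := by positivity
  have hsb : √Q ≤ b := by
    rcases (Real.sqrt_nonneg Q).eq_or_lt with h | h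
    · rw [← h]; exact hb0
    · have : √Q * √Q ≤ √Q * b := by rw [Real.mul_self_sqrt hQ0]; exact hQb
      exact le_of_mul_le_mul_left this h
  refine (hle k hk).trans (hsb.trans ?_)
  rw [hb, show n + 1 - 1 - i = n - i by omega]
  have h1 : 0 ≤ |r| ^ (n - i) := by positivity
  have h2 : 0 ≤ |r| ^ i := by positivity
  nlinarith [abs_nonneg b₀, abs_nonneg b₁, mul_nonneg h1 (abs_nonneg b₀),
    mul_nonneg h2 (abs_nonneg b₁)]

/-- The weights of the smoother at time `i` on innovations (`α`) and observation errors (`β`)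
are, away from both ends, close to those of a stationary smoother. -/
theorem exists_stationary_weights (φ : ℝ) (hd : 0 < d₀) (hτ : 0 < τ) :
    ∃ (κ ρ C : ℝ) (α β : ℤ → ℝ), 0 < κ ∧ κ < 1 ∧ 0 < ρ ∧ ρ < 1 ∧ 0 ≤ C ∧ α 0 ≠ 0 ∧ β 0 = κ ∧
      (∀ j, |α j| ≤ C * ρ ^ j.natAbs) ∧ (∀ j, |β j| ≤ C * ρ ^ j.natAbs) ∧
      ∀ n i : ℕ, i < n → ∃ g : ℕ → ℝ, (∀ x, smoothForm φ d₀ τ n x g = x i) ∧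
        ∀ k < n, |innov φ g k / innovVar d₀ τ k - α ((k : ℤ) - i)| ≤
            C * (ρ ^ i + ρ ^ (n - 1 - i)) ∧
          |g k - β ((k : ℤ) - i)| ≤ C * (ρ ^ i + ρ ^ (n - 1 - i)) := by
  obtain ⟨r, hr1, hr⟩ := exists_smoother_root φ hτ
  -- Here `1 + φ ^ 2 - 2 φ r = (φ - r) ^ 2 + (1 - r ^ 2)` is positive, which yields `0 < κ < 1`.
  have hden : τ < τ + 1 + φ ^ 2 - 2 * φ * r := by
    have : r ^ 2 < 1 := by rw [← sq_abs]; nlinarith [abs_nonneg r]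
    nlinarith [sq_nonneg (φ - r)]
  set κ := τ / (τ + 1 + φ ^ 2 - 2 * φ * r) with hκdef
  have hκ : κ * (τ + 1 + φ ^ 2 - 2 * φ * r) = τ := by
    exact div_mul_cancel₀ _ (hτ.trans hden).ne'
  have hκ0 : 0 < κ := div_pos hτ (hτ.trans hden)
  have hκ1 : κ < 1 := (div_lt_one (hτ.trans hden)).2 hden
  obtain ⟨C, hC0, hC⟩ := exists_abs_sub_stationary_le (φ := φ) hd hτ hr hκ
  -- The lower bound `1 / 2` keeps `ρ` positive when `r = 0` and makes a shift of the lag by one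
  -- cost at most a factor 2.
  set ρ := max |r| (1 / 2) with hρdef
  have hrρ : |r| ≤ ρ := le_max_left _ _
  have hρ2 : 1 / 2 ≤ ρ := le_max_right _ _
  have hρ1 : ρ < 1 := max_lt hr1 (by norm_num)
  have hρ0 : 0 < ρ := by linarith
  set α : ℤ → ℝ := fun j => κ * (r ^ j.natAbs - φ * r ^ (j - 1).natAbs) / τ with hα
  set β : ℤ → ℝ := fun j => κ * r ^ j.natAbs with hβ
  have hpow : ∀ m : ℕ, |r ^ m| ≤ ρ ^ m := fun m => by rw [abs_pow]; gcongr
  have hpow1 : ∀ j : ℤ, |r ^ (j - 1).natAbs| ≤ 2 * ρ ^ j.natAbs := by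
    intro j
    refine (hpow _).trans ?_
    have h1 : ρ ^ ((j - 1).natAbs + 1) ≤ ρ ^ j.natAbs :=
      pow_le_pow_of_le_one hρ0.le hρ1.le (by omega)
    rw [pow_succ] at h1
    have : 0 ≤ ρ ^ (j - 1).natAbs := by positivity
    nlinarith
  have hβb : ∀ j, |β j| ≤ ρ ^ j.natAbs := by
    intro j
    simp only [hβ, abs_mul, abs_of_pos hκ0]
    calc κ * |r ^ j.natAbs| ≤ 1 * ρ ^ j.natAbs := by
          gcongr
          exact hpow _
      _ = _ := one_mul _
  have hαb : ∀ j, |α j| ≤ (1 + 2 * |φ|) / τ * ρ ^ j.natAbs := by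
    intro j
    simp only [hα, abs_mul, abs_div, abs_of_pos hκ0, abs_of_pos hτ]
    have h1 : |r ^ j.natAbs - φ * r ^ (j - 1).natAbs| ≤ (1 + 2 * |φ|) * ρ ^ j.natAbs := by
      calc _ ≤ |r ^ j.natAbs| + |φ * r ^ (j - 1).natAbs| := abs_sub _ _
        _ ≤ ρ ^ j.natAbs + |φ| * (2 * ρ ^ j.natAbs) := by
            rw [abs_mul]
            gcongr
            · exact hpow _
            · exact hpow1 _
        _ = _ := by ring
    calc κ * |r ^ j.natAbs - φ * r ^ (j - 1).natAbs| / τ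
        ≤ 1 * ((1 + 2 * |φ|) * ρ ^ j.natAbs) / τ := by gcongr
      _ = _ := by ring
  set D := max ((1 + 2 * |φ|) / τ + (C + 1) / d₀ + C * (1 + |φ|) / τ) (max 1 C) with hD
  have hD1 : (1 + 2 * |φ|) / τ + (C + 1) / d₀ + C * (1 + |φ|) / τ ≤ D := le_max_left _ _
  have hD2 : 1 ≤ D := (le_max_left _ _).trans (le_max_right _ _)
  have hD3 : C ≤ D := (le_max_right _ _).trans (le_max_right _ _)
  have p1 : 0 ≤ (1 + 2 * |φ|) / τ := by positivity
  have p2 : 0 ≤ (C + 1) / d₀ := by positivity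
  have p3 : 0 ≤ C * (1 + |φ|) / τ := by positivity
  refine ⟨κ, ρ, D, α, β, hκ0, hκ1, hρ0, hρ1, by linarith, ?_, by simp [hβ],
    fun j => (hαb j).trans (by gcongr; linarith), fun j => (hβb j).trans ?_,
    fun n i hi => ?_⟩
  · simp only [hα]
    -- If `φ r = 1`, then `φ` times the equation of `r` reads `-τ = 0`. The innovation at time `i`
    -- therefore does enter the residual at time `i`, as Cramér's theorem requires.
    have : 1 - φ * r ≠ 0 := fun h => by
      have h1 : φ * r = 1 := by linarith
      have : τ = 0 := by linear_combination (-φ) * hr + (φ * r - (τ + 1 + φ ^ 2) + 1) * h1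
      exact hτ.ne' this
    simp
    exact ⟨⟨hκ0.ne', this⟩, hτ.ne'⟩
  · have : 0 ≤ ρ ^ j.natAbs := by positivity
    nlinarith
  · obtain ⟨g, hg⟩ := exists_smoothForm_eq φ hd hτ hi
    set E := ρ ^ i + ρ ^ (n - 1 - i) with hE
    have hE0 : 0 ≤ E := by positivity
    have hCg : ∀ k < n, |g k - β ((k : ℤ) - i)| ≤ C * E := fun k hk => by
      refine (hC n i hi g hg k hk).trans ?_
      rw [hE]; gcongr
    refine ⟨g, hg, fun k hk => ⟨?_, (hCg k hk).trans (by gcongr)⟩⟩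
    cases k with
    | zero =>
      simp only [innov, innovVar]
      -- The first innovation has its own variance, so its weight is not compared with the
      -- stationary formula: both weights are small separately.
      have h1 : |β (((0 : ℕ) : ℤ) - i)| ≤ ρ ^ i := (hβb _).trans (le_of_eq (by simp))
      have h2 : |α (((0 : ℕ) : ℤ) - i)| ≤ (1 + 2 * |φ|) / τ * ρ ^ i :=
        (hαb _).trans (le_of_eq (by simp))
      have h3 : |g 0| ≤ C * E + ρ ^ i := by
        have := abs_add_le (g 0 - β (((0 : ℕ) : ℤ) - i)) (β (((0 : ℕ) : ℤ) - i))
        rw [sub_add_cancel] at this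
        linarith [hCg 0 hk]
      have hEi : ρ ^ i ≤ E := by rw [hE]; linarith [pow_pos hρ0 (n - 1 - i)]
      calc |g 0 / d₀ - α (((0 : ℕ) : ℤ) - i)| ≤ |g 0| / d₀ + |α (((0 : ℕ) : ℤ) - i)| := by
            refine (abs_sub _ _).trans ?_
            rw [abs_div, abs_of_pos hd]
        _ ≤ (C * E + E) / d₀ + (1 + 2 * |φ|) / τ * E := by
            gcongr
            · exact h3.trans (by linarith)
            · exact h2.trans (by gcongr)
        _ = ((C + 1) / d₀ + (1 + 2 * |φ|) / τ) * E := by ring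
        _ ≤ D * E := by gcongr; linarith
    | succ k =>
      simp only [innov, innovVar]
      have e1 : α (((k + 1 : ℕ) : ℤ) - i) =
          (β (((k + 1 : ℕ) : ℤ) - i) - φ * β ((k : ℤ) - i)) / τ := by
        simp only [hα, hβ]
        rw [show ((k + 1 : ℕ) : ℤ) - i - 1 = (k : ℤ) - i by push_cast; ring]
        ring
      have h1 := hCg (k + 1) hk
      have h2 := hCg k (by omega)
      rw [e1]
      calc _ = |(g (k + 1) - β (((k + 1 : ℕ) : ℤ) - i)) - φ * (g k - β ((k : ℤ) - i))| / τ := by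
            rw [← abs_of_pos hτ, ← abs_div, abs_of_pos hτ]; congr 1; ring
        _ ≤ (C * E + |φ| * (C * E)) / τ := by
            gcongr
            refine (abs_sub _ _).trans ?_
            rw [abs_mul]
            gcongr
        _ = C * (1 + |φ|) / τ * E := by ring
        _ ≤ D * E := by gcongr; linarith

end

/-! ### Square-integrable variables and their mixed second moments -/

section ip

variable {Ω : Type*} [MeasurableSpace Ω] {P : Measure Ω}

/-- The mixed second moment `E f g`. -/
noncomputable def ip (P : Measure Ω) (f g : Ω → ℝ) : ℝ := ∫ ω, f ω * g ω ∂P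

theorem ip_comm (f g : Ω → ℝ) : ip P f g = ip P g f := by
  simp only [ip, mul_comm]

theorem ip_self (f : Ω → ℝ) : ip P f f = ∫ ω, f ω ^ 2 ∂P := by
  simp only [ip, pow_two]

theorem ip_self_nonneg (f : Ω → ℝ) : 0 ≤ ip P f f := by
  rw [ip_self]; exact integral_nonneg fun ω => sq_nonneg _

theorem integrable_mul_of_memLp {f g : Ω → ℝ} (hf : MemLp f 2 P) (hg : MemLp g 2 P) :
    Integrable (fun ω => f ω * g ω) P := hf.integrable_mul hg

theorem ip_add_left {f f' g : Ω → ℝ} (hf : MemLp f 2 P) (hf' : MemLp f' 2 P) (hg : MemLp g 2 P) :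
    ip P (fun ω => f ω + f' ω) g = ip P f g + ip P f' g := by
  simp only [ip, add_mul]
  exact integral_add (integrable_mul_of_memLp hf hg) (integrable_mul_of_memLp hf' hg)

theorem ip_sub_left {f f' g : Ω → ℝ} (hf : MemLp f 2 P) (hf' : MemLp f' 2 P) (hg : MemLp g 2 P) :
    ip P (fun ω => f ω - f' ω) g = ip P f g - ip P f' g := by
  simp only [ip, sub_mul]
  exact integral_sub (integrable_mul_of_memLp hf hg) (integrable_mul_of_memLp hf' hg)

theorem ip_smul_left (c : ℝ) (f g : Ω → ℝ) : ip P (fun ω => c * f ω) g = c * ip P f g := by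
  simp only [ip, mul_assoc]
  exact integral_const_mul _ _

theorem memLp_sum_mul {ι : Type*} {f : ι → Ω → ℝ} (hf : ∀ k, MemLp (f k) 2 P) (S : Finset ι)
    (c : ι → ℝ) : MemLp (fun ω => ∑ k ∈ S, c k * f k ω) 2 P :=
  memLp_finsetSum S fun k _ => (hf k).const_mul (c k)

theorem ip_sum_left {ι : Type*} {f : ι → Ω → ℝ} (hf : ∀ k, MemLp (f k) 2 P) {g : Ω → ℝ}
    (hg : MemLp g 2 P) (S : Finset ι) (c : ι → ℝ) :
    ip P (fun ω => ∑ k ∈ S, c k * f k ω) g = ∑ k ∈ S, c k * ip P (f k) g := by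
  simp only [ip, Finset.sum_mul]
  rw [integral_finsetSum]
  · refine Finset.sum_congr rfl fun k _ => ?_
    simp only [mul_assoc]
    exact integral_const_mul _ _
  · intro k _
    exact integrable_mul_of_memLp ((hf k).const_mul (c k)) hg

theorem ip_add_self {f g : Ω → ℝ} (hf : MemLp f 2 P) (hg : MemLp g 2 P) :
    ip P (fun ω => f ω + g ω) (fun ω => f ω + g ω) = ip P f f + 2 * ip P f g + ip P g g := by
  have hfg : MemLp (fun ω => f ω + g ω) 2 P := hf.add hg
  rw [ip_add_left hf hg hfg, ip_comm f, ip_comm g, ip_add_left hf hg hf,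
    ip_add_left hf hg hg, ip_comm g f]
  ring

/-- The first-order condition at a minimum: for `A > 0` the parabola takes the value `-B ^ 2 / A` at
`t = B / A`. -/
theorem eq_zero_of_forall_quadratic_nonneg {A B : ℝ} (h : ∀ t : ℝ, 0 ≤ t ^ 2 * A - 2 * t * B) :
    B = 0 := by
  by_contra hB
  rcases le_or_gt A 0 with hA | hA
  · have := h B
    have hB2 : 0 < B ^ 2 := by positivity
    nlinarith
  · have := h (B / A)
    have e : (B / A) ^ 2 * A - 2 * (B / A) * B = -(B ^ 2 / A) := by field_simp; ring
    rw [e] at this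
    have : 0 < B ^ 2 / A := by positivity
    linarith

open EBKalman in
/-- The normal equations: the residual of the best linear estimator is orthogonal to the
observations. -/
theorem IsBestLinear_ip_eq_zero {ι : Type*} {Y : ι → Ω → ℝ} {S : Finset ι} {X : Ω → ℝ} {β : ι → ℝ}
    (hY : ∀ j, MemLp (Y j) 2 P) (hX : MemLp X 2 P) (h : IsBestLinear P Y S X β) {j : ι}
    (hj : j ∈ S) : ip P (fun ω => X ω - ∑ k ∈ S, β k * Y k ω) (Y j) = 0 := by
  classical
  set R := fun ω => X ω - ∑ k ∈ S, β k * Y k ω with hR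
  have hRm : MemLp R 2 P := hX.sub (memLp_sum_mul hY S β)
  refine eq_zero_of_forall_quadratic_nonneg (A := ip P (Y j) (Y j)) fun t => ?_
  have h1 := h (fun k => β k + if k = j then t else 0)
  have h2 : ∀ ω, X ω - ∑ k ∈ S, (β k + if k = j then t else 0) * Y k ω = R ω + -t * Y j ω := by
    intro ω
    simp only [add_mul, Finset.sum_add_distrib, ite_mul, zero_mul, Finset.sum_ite_eq', hj, if_true,
      hR]
    ring
  simp only [h2] at h1
  have h3 := ip_add_self hRm ((hY j).const_mul (-t))
  rw [ip_self, ip_self] at h3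
  rw [h3, ip_smul_left (-t) (Y j), ip_comm R, ip_smul_left, ip_comm (Y j) R, ip_comm (Y j) _,
    ip_smul_left] at h1
  change ∫ ω, R ω ^ 2 ∂P ≤ _ at h1
  nlinarith

end ip

/-! ### The autoregressive state-space model -/

/-- The assumptions on initial state, innovations and observation errors. -/
structure ARNoise {Ω : Type*} [MeasurableSpace Ω] (P : Measure Ω) (μ₀ : Ω → ℝ)
    (U ε : ℕ → Ω → ℝ) : Prop where
  meas_init : Measurable μ₀
  meas_U : ∀ i, Measurable (U i)
  meas_ε : ∀ i, Measurable (ε i)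
  indep : iIndepFun (Sum.elim (fun _ : Unit => μ₀) (Sum.elim U ε)) P
  memLp_init : MemLp μ₀ 2 P
  mean_init : ∫ ω, μ₀ ω ∂P = 0
  ident_U : ∀ i, IdentDistrib (U i) (U 0) P P
  memLp_U0 : MemLp (U 0) 2 P
  mean_U0 : ∫ ω, U 0 ω ∂P = 0
  law_ε : ∀ i, P.map (ε i) = gaussianReal 0 1

namespace ARNoise

open EBKalman

variable {Ω : Type*} [MeasurableSpace Ω] {P : Measure Ω} [IsProbabilityMeasure P]
  {φ : ℝ} {μ₀ : Ω → ℝ} {U ε : ℕ → Ω → ℝ}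

theorem memLp_U (h : ARNoise P μ₀ U ε) (i : ℕ) : MemLp (U i) 2 P :=
  (h.ident_U i).memLp_iff.2 h.memLp_U0

theorem mean_U (h : ARNoise P μ₀ U ε) (i : ℕ) : ∫ ω, U i ω ∂P = 0 := by
  rw [(h.ident_U i).integral_eq, h.mean_U0]

theorem memLp_ε (h : ARNoise P μ₀ U ε) (i : ℕ) : MemLp (ε i) 2 P := by
  have h1 : MemLp id 2 (P.map (ε i)) := by rw [h.law_ε]; exact memLp_id_gaussianReal 2
  exact (memLp_map_measure_iff aestronglyMeasurable_id (h.meas_ε i).aemeasurable).1 h1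

theorem mean_ε (h : ARNoise P μ₀ U ε) (i : ℕ) : ∫ ω, ε i ω ∂P = 0 := by
  have h1 : ∫ x, x ∂(P.map (ε i)) = ∫ ω, ε i ω ∂P :=
    integral_map (h.meas_ε i).aemeasurable aestronglyMeasurable_id
  rw [← h1, h.law_ε]
  exact integral_id_gaussianReal

theorem integral_ε_sq (h : ARNoise P μ₀ U ε) (i : ℕ) : ∫ ω, ε i ω ^ 2 ∂P = 1 := by
  have h1 : ∫ x, x ^ 2 ∂(P.map (ε i)) = ∫ ω, ε i ω ^ 2 ∂P :=
    integral_map (h.meas_ε i).aemeasurable (by fun_prop)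
  rw [← h1, h.law_ε]
  have h2 := variance_id_gaussianReal (μ := 0) (v := 1)
  rw [variance_of_integral_eq_zero aemeasurable_id (by simp)] at h2
  simpa using h2

theorem memLp_noise (h : ARNoise P μ₀ U ε) (a : Unit ⊕ (ℕ ⊕ ℕ)) :
    MemLp (Sum.elim (fun _ : Unit => μ₀) (Sum.elim U ε) a) 2 P := by
  rcases a with _ | i | i
  exacts [h.memLp_init, h.memLp_U i, h.memLp_ε i]

theorem ip_noise (h : ARNoise P μ₀ U ε) {a b : Unit ⊕ (ℕ ⊕ ℕ)} (hab : a ≠ b) :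
    ip P (Sum.elim (fun _ : Unit => μ₀) (Sum.elim U ε) a)
      (Sum.elim (fun _ : Unit => μ₀) (Sum.elim U ε) b) = 0 := by
  have h1 := (h.indep.indepFun hab).integral_mul_eq_mul_integral
    (h.memLp_noise a).aestronglyMeasurable (h.memLp_noise b).aestronglyMeasurable
  have h2 : ∫ ω, Sum.elim (fun _ : Unit => μ₀) (Sum.elim U ε) a ω ∂P = 0 := by
    rcases a with _ | i | i
    exacts [h.mean_init, h.mean_U i, h.mean_ε i]
  rw [h2, zero_mul] at h1
  exact h1

theorem ip_U_U (h : ARNoise P μ₀ U ε) {k l : ℕ} (hkl : k ≠ l) : ip P (U k) (U l) = 0 :=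
  h.ip_noise (a := .inr (.inl k)) (b := .inr (.inl l)) (by simpa using hkl)

theorem ip_U_ε (h : ARNoise P μ₀ U ε) (k l : ℕ) : ip P (U k) (ε l) = 0 :=
  h.ip_noise (a := .inr (.inl k)) (b := .inr (.inr l)) (by simp)

theorem ip_ε_ε (h : ARNoise P μ₀ U ε) (k l : ℕ) : ip P (ε k) (ε l) = if k = l then 1 else 0 := by
  split_ifs with hkl
  · subst hkl; rw [ip_self, h.integral_ε_sq]
  · exact h.ip_noise (a := .inr (.inr k)) (b := .inr (.inr l)) (by simpa using hkl)

theorem ip_init_U (h : ARNoise P μ₀ U ε) (k : ℕ) : ip P μ₀ (U k) = 0 :=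
  h.ip_noise (a := .inl ()) (b := .inr (.inl k)) (by simp)

theorem ip_init_ε (h : ARNoise P μ₀ U ε) (k : ℕ) : ip P μ₀ (ε k) = 0 :=
  h.ip_noise (a := .inl ()) (b := .inr (.inr k)) (by simp)

theorem innov_state_succ (k : ℕ) (ω : Ω) :
    innov φ (fun j => state φ μ₀ U j ω) (k + 1) = U (k + 1) ω := by
  simp [innov, state]

theorem innov_state_zero (ω : Ω) :
    innov φ (fun j => state φ μ₀ U j ω) 0 = φ * μ₀ ω + U 0 ω := rfl

theorem memLp_innov (h : ARNoise P μ₀ U ε) (φ : ℝ) (k : ℕ) :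
    MemLp (fun ω => innov φ (fun j => state φ μ₀ U j ω) k) 2 P := by
  cases k with
  | zero => exact (h.memLp_init.const_mul φ).add (h.memLp_U 0)
  | succ k => simp only [innov_state_succ]; exact h.memLp_U (k + 1)

theorem memLp_state (h : ARNoise P μ₀ U ε) (φ : ℝ) (k : ℕ) : MemLp (state φ μ₀ U k) 2 P := by
  induction k with
  | zero => exact (h.memLp_init.const_mul φ).add (h.memLp_U 0)
  | succ k ih => exact (ih.const_mul φ).add (h.memLp_U (k + 1))

theorem memLp_obs (h : ARNoise P μ₀ U ε) (φ : ℝ) (k : ℕ) : MemLp (obs φ μ₀ U ε k) 2 P :=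
  (h.memLp_state φ k).add (h.memLp_ε k)

theorem measurable_state (h : ARNoise P μ₀ U ε) (φ : ℝ) (k : ℕ) : Measurable (state φ μ₀ U k) := by
  induction k with
  | zero => exact (h.meas_init.const_mul φ).add (h.meas_U 0)
  | succ k ih => exact (ih.const_mul φ).add (h.meas_U (k + 1))

theorem measurable_obs (h : ARNoise P μ₀ U ε) (φ : ℝ) (k : ℕ) : Measurable (obs φ μ₀ U ε k) :=
  (h.measurable_state φ k).add (h.meas_ε k)

theorem ip_state_ε (h : ARNoise P μ₀ U ε) (φ : ℝ) (k l : ℕ) :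
    ip P (state φ μ₀ U k) (ε l) = 0 := by
  induction k with
  | zero =>
    have := ip_add_left (h.memLp_init.const_mul φ) (h.memLp_U 0) (h.memLp_ε l)
    rw [ip_smul_left, h.ip_init_ε, h.ip_U_ε] at this
    simpa [state] using this
  | succ k ih =>
    have := ip_add_left ((h.memLp_state φ k).const_mul φ) (h.memLp_U (k + 1)) (h.memLp_ε l)
    rw [ip_smul_left, ih, h.ip_U_ε] at this
    simpa [state] using this

theorem ip_innov_ε (h : ARNoise P μ₀ U ε) (φ : ℝ) (k l : ℕ) :
    ip P (fun ω => innov φ (fun j => state φ μ₀ U j ω) k) (ε l) = 0 := by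
  cases k with
  | zero => exact h.ip_state_ε φ 0 l
  | succ k => simp only [innov_state_succ]; exact h.ip_U_ε (k + 1) l

/-- Innovations diagonalise the covariance of the states. The first one is the whole first state `φ
μ₀ + U 0`, which explains the separate initial variance. -/
theorem ip_innov_innov (h : ARNoise P μ₀ U ε) (φ : ℝ) (k l : ℕ) :
    ip P (fun ω => innov φ (fun j => state φ μ₀ U j ω) k)
      (fun ω => innov φ (fun j => state φ μ₀ U j ω) l) =
    if k = l then innovVar (∫ ω, (φ * μ₀ ω + U 0 ω) ^ 2 ∂P) (∫ ω, U 0 ω ^ 2 ∂P) k else 0 := by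
  have h0 : ∀ l, ip P (fun ω => φ * μ₀ ω + U 0 ω) (U (l + 1)) = 0 := by
    intro l
    rw [ip_add_left (h.memLp_init.const_mul φ) (h.memLp_U 0) (h.memLp_U _), ip_smul_left,
      h.ip_init_U, h.ip_U_U (by simp)]
    simp
  rcases k with _ | k <;> rcases l with _ | l
  · simp only [innov_state_zero, if_true, innovVar]
    rw [ip_self]
  · simp only [innov_state_zero, innov_state_succ]
    rw [if_neg (by simp)]
    exact h0 l
  · simp only [innov_state_zero, innov_state_succ]
    rw [if_neg (by simp), ip_comm]
    exact h0 k
  · simp only [innov_state_succ]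
    split_ifs with hkl
    · obtain rfl : k = l := by simpa using hkl
      rw [ip_self]
      exact ((h.ident_U (k + 1)).comp (u := fun x : ℝ => x ^ 2) (by fun_prop)).integral_eq
    · exact h.ip_U_U hkl

/-- With variance zero the innovation would be a point mass, which the non-normality hypothesis
excludes through `v = 0`. -/
theorem variance_U_pos (h : ARNoise P μ₀ U ε)
    (hU : ∀ (m : ℝ) (v : ℝ≥0), P.map (U 0) ≠ gaussianReal m v) : 0 < ∫ ω, U 0 ω ^ 2 ∂P := by
  refine lt_of_le_of_ne (integral_nonneg fun ω => sq_nonneg _) fun h0 => ?_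
  have h1 := (integral_eq_zero_iff_of_nonneg (fun ω => sq_nonneg (U 0 ω))
    h.memLp_U0.integrable_sq).1 h0.symm
  refine hU 0 0 ?_
  have h2 : U 0 =ᵐ[P] fun _ => 0 := by
    filter_upwards [h1] with ω hω
    simpa using hω
  rw [Measure.map_congr h2, Measure.map_const, gaussianReal_zero_var]
  simp

theorem variance_first_pos (h : ARNoise P μ₀ U ε) (φ : ℝ) (hτ : 0 < ∫ ω, U 0 ω ^ 2 ∂P) :
    0 < ∫ ω, (φ * μ₀ ω + U 0 ω) ^ 2 ∂P := by
  have h1 := ip_smul_left (P := P) φ μ₀ (U 0)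
  rw [h.ip_init_U, mul_zero] at h1
  rw [← ip_self, ip_add_self (h.memLp_init.const_mul φ) (h.memLp_U 0), h1, ip_self (U 0)]
  have := ip_self_nonneg (P := P) fun ω => φ * μ₀ ω
  linarith

/-- A combination of observations with the weights of the precision form is biorthogonal to the
observations. -/
theorem ip_weights_obs (h : ARNoise P μ₀ U ε) {φ : ℝ} (hτ : 0 < ∫ ω, U 0 ω ^ 2 ∂P) {n i : ℕ}
    {g : ℕ → ℝ} {j : ℕ} (hj : j < n) :
    ip P (fun ω => (∑ k ∈ Finset.range n, (innov φ g k / innovVar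
        (∫ ω, (φ * μ₀ ω + U 0 ω) ^ 2 ∂P) (∫ ω, U 0 ω ^ 2 ∂P) k) *
        innov φ (fun j => state φ μ₀ U j ω) k) +
      (ε i ω - ∑ k ∈ Finset.range n, g k * ε k ω)) (obs φ μ₀ U ε j) = if i = j then 1 else 0 := by
  set d := innovVar (∫ ω, (φ * μ₀ ω + U 0 ω) ^ 2 ∂P) (∫ ω, U 0 ω ^ 2 ∂P) with hd
  have hdp : ∀ k, 0 < d k := innovVar_pos (h.variance_first_pos φ hτ) hτ
  set S := fun ω => ∑ k ∈ Finset.range n, (innov φ g k / d k) *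
    innov φ (fun j => state φ μ₀ U j ω) k with hS
  set T := fun ω => ε i ω - ∑ k ∈ Finset.range n, g k * ε k ω with hT
  have hSm : MemLp S 2 P := memLp_sum_mul (h.memLp_innov φ) _ _
  have hTm : MemLp T 2 P := (h.memLp_ε i).sub (memLp_sum_mul h.memLp_ε _ _)
  have hSu : ∀ l < n, ip P S (fun ω => innov φ (fun j => state φ μ₀ U j ω) l) = innov φ g l := by
    intro l hl
    rw [ip_sum_left (f := fun k ω => innov φ (fun j => state φ μ₀ U j ω) k) (h.memLp_innov φ)
      (h.memLp_innov φ l)]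
    simp only [h.ip_innov_innov, mul_ite, mul_zero]
    rw [Finset.sum_ite_eq' , if_pos (Finset.mem_range.2 hl)]
    exact div_mul_cancel₀ _ (hdp l).ne'
  -- Pairing `S` with the innovations returns the innovations of `g`; undoing the autoregression
  -- returns `g`. The value `g j` then cancels against the one produced by the errors in `T`.
  have hSμ : ∀ l < n, ip P S (state φ μ₀ U l) = g l := by
    intro l
    induction l with
    | zero => intro hl; exact hSu 0 hl
    | succ l ih =>
      intro hl
      have h1 := hSu (l + 1) hl
      have h2 : state φ μ₀ U (l + 1) = fun ω => φ * state φ μ₀ U l ω + U (l + 1) ω := rfl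
      simp only [innov_state_succ] at h1
      rw [h2, ip_comm, ip_add_left ((h.memLp_state φ l).const_mul φ) (h.memLp_U _) hSm,
        ip_smul_left, ip_comm _ S, ip_comm _ S, ih (by omega)]
      change _ + ip P S (fun ω => U (l + 1) ω) = _
      rw [h1]
      simp [innov]
  have hSε : ip P S (ε j) = 0 := by
    rw [ip_sum_left (f := fun k ω => innov φ (fun j => state φ μ₀ U j ω) k) (h.memLp_innov φ)
      (h.memLp_ε j)]
    exact Finset.sum_eq_zero fun k _ => by rw [h.ip_innov_ε, mul_zero]
  have hTμ : ip P T (state φ μ₀ U j) = 0 := by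
    rw [ip_sub_left (h.memLp_ε i) (memLp_sum_mul h.memLp_ε _ _) (h.memLp_state φ j),
      ip_sum_left h.memLp_ε (h.memLp_state φ j), ip_comm, h.ip_state_ε]
    simp only [zero_sub, neg_eq_zero]
    exact Finset.sum_eq_zero fun k _ => by rw [ip_comm, h.ip_state_ε, mul_zero]
  have hTε : ip P T (ε j) = (if i = j then 1 else 0) - g j := by
    rw [ip_sub_left (h.memLp_ε i) (memLp_sum_mul h.memLp_ε _ _) (h.memLp_ε j),
      ip_sum_left h.memLp_ε (h.memLp_ε j)]
    simp only [h.ip_ε_ε, mul_ite, mul_zero, mul_one]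
    rw [Finset.sum_ite_eq', if_pos (Finset.mem_range.2 hj)]
  have hobs : obs φ μ₀ U ε j = fun ω => state φ μ₀ U j ω + ε j ω := rfl
  rw [ip_add_left hSm hTm (h.memLp_obs φ j), hobs, ip_comm S, ip_comm T,
    ip_add_left (h.memLp_state φ j) (h.memLp_ε j) hSm,
    ip_add_left (h.memLp_state φ j) (h.memLp_ε j) hTm, ip_comm _ S, ip_comm _ S, ip_comm _ T,
    ip_comm _ T, hSμ j hj, hSε, hTμ, hTε]
  ring

/-- Observation errors make the observations uniformly linearly independent. -/
theorem sum_sq_le_ip_obs (h : ARNoise P μ₀ U ε) (φ : ℝ) {n : ℕ} (δ : Fin n → ℝ) :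
    ∑ j, δ j ^ 2 ≤ ip P (fun ω => ∑ j, δ j * obsVec φ μ₀ U ε n j ω)
      (fun ω => ∑ j, δ j * obsVec φ μ₀ U ε n j ω) := by
  have hA : MemLp (fun ω => ∑ j : Fin n, δ j * state φ μ₀ U j ω) 2 P :=
    memLp_sum_mul (fun j : Fin n => h.memLp_state φ j) _ _
  have hB : MemLp (fun ω => ∑ j : Fin n, δ j * ε j ω) 2 P :=
    memLp_sum_mul (fun j : Fin n => h.memLp_ε j) _ _
  have e : (fun ω => ∑ j, δ j * obsVec φ μ₀ U ε n j ω) =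
      fun ω => (∑ j : Fin n, δ j * state φ μ₀ U j ω) + ∑ j : Fin n, δ j * ε j ω := by
    funext ω
    rw [← Finset.sum_add_distrib]
    exact Finset.sum_congr rfl fun j _ => by simp only [obsVec, obs]; ring
  rw [e, ip_add_self hA hB]
  have h1 : ip P (fun ω => ∑ j : Fin n, δ j * state φ μ₀ U j ω)
      (fun ω => ∑ j : Fin n, δ j * ε j ω) = 0 := by
    rw [ip_sum_left (f := fun j : Fin n => state φ μ₀ U j) (fun j => h.memLp_state φ j) hB]
    refine Finset.sum_eq_zero fun j _ => ?_
    rw [ip_comm, ip_sum_left (f := fun j : Fin n => ε j) (fun j => h.memLp_ε j)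
      (h.memLp_state φ j)]
    rw [Finset.sum_eq_zero fun k _ => by rw [ip_comm, h.ip_state_ε, mul_zero], mul_zero]
  have h2 : ip P (fun ω => ∑ j : Fin n, δ j * ε j ω)
      (fun ω => ∑ j : Fin n, δ j * ε j ω) = ∑ j, δ j ^ 2 := by
    rw [ip_sum_left (f := fun j : Fin n => ε j) (fun j => h.memLp_ε j) hB]
    refine Finset.sum_congr rfl fun j _ => ?_
    rw [ip_comm, ip_sum_left (f := fun j : Fin n => ε j) (fun j => h.memLp_ε j)
      (h.memLp_ε j)]
    simp only [h.ip_ε_ε, Fin.val_inj, mul_ite, mul_one, mul_zero, Finset.sum_ite_eq',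
      Finset.mem_univ, if_true]
    ring
  rw [h1, h2]
  have := ip_self_nonneg (P := P) fun ω => ∑ j : Fin n, δ j * state φ μ₀ U j ω
  linarith

/-- The coefficients of the leave-one-out estimator. -/
theorem exists_leaveOut_coeff (h : ARNoise P μ₀ U ε) (φ : ℝ) {n : ℕ} (i : Fin n) :
    ∃ β : Fin n → ℝ, IsBestLinear P (obsVec φ μ₀ U ε n) (Finset.univ.erase i)
        (stateVec φ μ₀ U n i) β ∧
      ∀ ω, kalmanLeaveOut P (stateVec φ μ₀ U n) (obsVec φ μ₀ U ε n) i ω =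
        ∑ j ∈ Finset.univ.erase i, β j * obsVec φ μ₀ U ε n j ω :=
  ⟨_, Classical.epsilon_spec (exists_isBestLinear P _ _ _ (fun j : Fin n => h.memLp_obs φ j)
    (h.memLp_state φ i)), fun _ => rfl⟩

/-- The residual of the leave-one-out estimator, explicitly. -/
theorem leaveOut_residual_eq (h : ARNoise P μ₀ U ε) {φ : ℝ} (hτ : 0 < ∫ ω, U 0 ω ^ 2 ∂P) {n : ℕ}
    (i : Fin n) {g : ℕ → ℝ}
    (hg : ∀ x, smoothForm φ (∫ ω, (φ * μ₀ ω + U 0 ω) ^ 2 ∂P) (∫ ω, U 0 ω ^ 2 ∂P) n x g = x i)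
    (hgi : g i ≠ 1) (ω : Ω) :
    obs φ μ₀ U ε i ω - kalmanLeaveOut P (stateVec φ μ₀ U n) (obsVec φ μ₀ U ε n) i ω =
      ((∑ k ∈ Finset.range n, (innov φ g k / innovVar
        (∫ ω, (φ * μ₀ ω + U 0 ω) ^ 2 ∂P) (∫ ω, U 0 ω ^ 2 ∂P) k) *
        innov φ (fun j => state φ μ₀ U j ω) k) +
      (ε i ω - ∑ k ∈ Finset.range n, g k * ε k ω)) / (1 - g i) := by
  classical
  set W := fun ω => (∑ k ∈ Finset.range n, (innov φ g k / innovVar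
        (∫ ω, (φ * μ₀ ω + U 0 ω) ^ 2 ∂P) (∫ ω, U 0 ω ^ 2 ∂P) k) *
        innov φ (fun j => state φ μ₀ U j ω) k) +
      (ε i ω - ∑ k ∈ Finset.range n, g k * ε k ω) with hW
  set Y := obsVec φ μ₀ U ε n with hY
  have hYm : ∀ j, MemLp (Y j) 2 P := fun j => h.memLp_obs φ j
  have hgi' : 1 - g i ≠ 0 := sub_ne_zero.2 (Ne.symm hgi)
  -- `W` is the combination of the observations
  have hWY : ∀ ω, W ω = Y i ω - ∑ k : Fin n, g k * Y k ω := by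
    intro ω
    have h1 := hg (fun j => state φ μ₀ U j ω)
    rw [smoothForm, Finset.sum_add_distrib] at h1
    simp only [hW, hY, obsVec, obs]
    rw [← h1, Finset.sum_range (fun k => g k * ε k ω),
      Finset.sum_range (fun k => state φ μ₀ U k ω * g k)]
    simp only [mul_add, Finset.sum_add_distrib]
    have h2 : ∀ k, innov φ (fun j => state φ μ₀ U j ω) k * innov φ g k / innovVar
        (∫ ω, (φ * μ₀ ω + U 0 ω) ^ 2 ∂P) (∫ ω, U 0 ω ^ 2 ∂P) k = innov φ g k / innovVar
        (∫ ω, (φ * μ₀ ω + U 0 ω) ^ 2 ∂P) (∫ ω, U 0 ω ^ 2 ∂P) k *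
        innov φ (fun j => state φ μ₀ U j ω) k := fun k => by ring
    simp only [h2, mul_comm (g _) (state _ _ _ _ _)]
    ring
  have hWm : MemLp W 2 P := by
    have : W = fun ω => Y i ω - ∑ k : Fin n, g k * Y k ω := funext hWY
    rw [this]
    exact (hYm i).sub (memLp_sum_mul hYm _ _)
  obtain ⟨β, hβ, hβeq⟩ := h.exists_leaveOut_coeff φ i
  set R := fun ω => stateVec φ μ₀ U n i ω - ∑ k ∈ Finset.univ.erase i, β k * Y k ω with hR
  have hRm : MemLp R 2 P := (h.memLp_state φ i).sub (memLp_sum_mul hYm _ _)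
  -- Solving the full-data weights for the `i`-th observation proposes the leave-one-out
  -- coefficients `g j / (1 - g i)`. The difference `D` from the optimal rule lies in the span of
  -- the other observations and is orthogonal to each of them.
  let δ : Fin n → ℝ := fun j => if j = i then 0 else g j / (1 - g i) - β j
  set D := fun ω => ∑ j, δ j * Y j ω with hD
  have hDm : MemLp D 2 P := memLp_sum_mul hYm _ _
  have hDeq : ∀ ω, D ω = (R ω + ε i ω) + -(1 - g i)⁻¹ * W ω := by
    intro ω
    rw [hWY]
    simp only [hD, hR]
    rw [← Finset.add_sum_erase _ _ (Finset.mem_univ i),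
      ← Finset.add_sum_erase _ (fun k : Fin n => g k * Y k ω) (Finset.mem_univ i)]
    have h1 : ∑ x ∈ Finset.univ.erase i, δ x * Y x ω =
        (1 - g i)⁻¹ * ∑ x ∈ Finset.univ.erase i, g x * Y x ω -
          ∑ x ∈ Finset.univ.erase i, β x * Y x ω := by
      rw [Finset.mul_sum, ← Finset.sum_sub_distrib]
      refine Finset.sum_congr rfl fun j hj => ?_
      simp only [δ, if_neg (Finset.ne_of_mem_erase hj)]
      ring
    rw [h1]
    have h2 : Y i ω = stateVec φ μ₀ U n i ω + ε i ω := rfl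
    simp only [δ, if_true]
    rw [h2]
    field_simp
    ring
  have hDY : ∀ j, j ≠ i → ip P D (Y j) = 0 := by
    intro j hj
    have e : D = fun ω => (R ω + ε i ω) + -(1 - g i)⁻¹ * W ω := funext hDeq
    have hRε : MemLp (fun ω => R ω + ε i ω) 2 P := hRm.add (h.memLp_ε i)
    rw [e, ip_add_left hRε (hWm.const_mul _) (hYm j), ip_smul_left,
      ip_add_left hRm (h.memLp_ε i) (hYm j)]
    have h1 : ip P R (Y j) = 0 :=
      IsBestLinear_ip_eq_zero hYm (h.memLp_state φ i) hβ (by simpa using hj)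
    have h2 : ip P W (Y j) = 0 := by
      have := h.ip_weights_obs (φ := φ) hτ (n := n) (i := i) (g := g) j.2
      rw [if_neg (by simpa [Fin.val_inj] using hj.symm)] at this
      exact this
    have h3 : ip P (ε i) (Y j) = 0 := by
      have e2 : Y j = fun ω => state φ μ₀ U j ω + ε j ω := rfl
      rw [e2, ip_comm, ip_add_left (h.memLp_state φ j) (h.memLp_ε j) (h.memLp_ε i), h.ip_state_ε,
        h.ip_ε_ε, if_neg (by simpa [Fin.val_inj] using hj), add_zero]
    rw [h1, h2, h3]; ring
  have hDD : ip P D D = 0 := by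
    have e : ip P D D = ∑ j, δ j * ip P (Y j) D := ip_sum_left hYm hDm _ _
    rw [e]
    refine Finset.sum_eq_zero fun j _ => ?_
    by_cases hj : j = i
    · simp [δ, hj]
    · rw [ip_comm, hDY j hj, mul_zero]
  -- A vanishing second moment gives `D = 0` only almost surely; linear independence of the
  -- observations makes the coefficients vanish, so the formula holds at every `ω`.
  have hδ : ∀ j, δ j = 0 := by
    have h1 := h.sum_sq_le_ip_obs φ δ
    have h2 : ∑ j, δ j ^ 2 ≤ 0 := by rw [← hDD]; exact h1
    intro j
    have h3 := (Finset.sum_eq_zero_iff_of_nonneg (fun k _ => sq_nonneg (δ k))).1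
      (le_antisymm h2 (Finset.sum_nonneg fun k _ => sq_nonneg _)) j (Finset.mem_univ j)
    simpa using h3
  have hD0 : D ω = 0 := by simp [hD, hδ]
  rw [hDeq] at hD0
  rw [hβeq]
  change state φ μ₀ U i ω + ε i ω - _ = _
  simp only [hR, stateVec] at hD0
  change _ = W ω / (1 - g i)
  rw [div_eq_inv_mul]
  linarith

theorem memLp_leaveOut (h : ARNoise P μ₀ U ε) (φ : ℝ) {n : ℕ} (i : Fin n) :
    MemLp (kalmanLeaveOut P (stateVec φ μ₀ U n) (obsVec φ μ₀ U ε n) i) 2 P := by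
  unfold kalmanLeaveOut bestLinear
  exact memLp_sum_mul (f := obsVec φ μ₀ U ε n) (fun j : Fin n => h.memLp_obs φ j) _ _

theorem memLp_kalman (h : ARNoise P μ₀ U ε) (φ : ℝ) {n : ℕ} (i : Fin n) :
    MemLp (kalman P (stateVec φ μ₀ U n) (obsVec φ μ₀ U ε n) i) 2 P := by
  unfold kalman bestLinear
  exact memLp_sum_mul (f := obsVec φ μ₀ U ε n) (fun j : Fin n => h.memLp_obs φ j) _ _

theorem measurable_leaveOut (h : ARNoise P μ₀ U ε) (φ : ℝ) {n : ℕ} (i : Fin n) :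
    Measurable (kalmanLeaveOut P (stateVec φ μ₀ U n) (obsVec φ μ₀ U ε n) i) := by
  unfold kalmanLeaveOut bestLinear
  exact Finset.measurable_fun_sum _ fun (j : Fin n) _ => (h.measurable_obs φ j).const_mul _

/-- The risk of the Kalman estimator in terms of the leave-one-out risk. -/
theorem le_integral_sq_kalman_sub (h : ARNoise P μ₀ U ε) (φ : ℝ) {n : ℕ} (i : Fin n) {v : ℝ}
    (hv : v = ∫ ω, (state φ μ₀ U i ω -
      kalmanLeaveOut P (stateVec φ μ₀ U n) (obsVec φ μ₀ U ε n) i ω) ^ 2 ∂P) :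
    v / (1 + v) ≤ ∫ ω, (kalman P (stateVec φ μ₀ U n) (obsVec φ μ₀ U ε n) i ω -
      stateVec φ μ₀ U n i ω) ^ 2 ∂P := by
  classical
  set Y := obsVec φ μ₀ U ε n with hY
  have hYm : ∀ j, MemLp (Y j) 2 P := fun j => h.memLp_obs φ j
  obtain ⟨β, hβ, hβeq⟩ := h.exists_leaveOut_coeff φ i
  have hv0 : 0 ≤ v := by rw [hv]; exact integral_nonneg fun ω => sq_nonneg _
  obtain ⟨γ, hγ⟩ : ∃ γ : Fin n → ℝ, ∀ ω, kalman P (stateVec φ μ₀ U n) Y i ω =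
      ∑ j, γ j * Y j ω := ⟨_, fun _ => rfl⟩
  -- The weight of the `i`-th observation is split off. The rest `A` of the error is orthogonal to
  -- `ε i`, so the risk is that of `A` plus `b ^ 2`.
  set b := γ i
  set A := fun ω => (1 - b) * state φ μ₀ U i ω + -1 * ∑ j ∈ Finset.univ.erase i, γ j * Y j ω
    with hA
  have hAm : MemLp A 2 P :=
    ((h.memLp_state φ i).const_mul _).add ((memLp_sum_mul hYm _ _).const_mul _)
  have hAε : ip P A (ε i) = 0 := by
    rw [hA, ip_add_left ((h.memLp_state φ i).const_mul _) ((memLp_sum_mul hYm _ _).const_mul _)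
      (h.memLp_ε i), ip_smul_left, ip_smul_left, h.ip_state_ε, ip_sum_left hYm (h.memLp_ε i)]
    rw [Finset.sum_eq_zero]
    · ring
    · intro j hj
      have e2 : Y j = fun ω => state φ μ₀ U j ω + ε j ω := rfl
      have hji := Finset.ne_of_mem_erase hj
      rw [e2, ip_add_left (h.memLp_state φ j) (h.memLp_ε j) (h.memLp_ε i), h.ip_state_ε,
        h.ip_ε_ε, if_neg (by simpa [Fin.val_inj] using hji)]
      ring
  have hrisk : ∫ ω, (kalman P (stateVec φ μ₀ U n) Y i ω - stateVec φ μ₀ U n i ω) ^ 2 ∂P =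
      ip P A A + b ^ 2 := by
    have e : ∀ ω, (kalman P (stateVec φ μ₀ U n) Y i ω - stateVec φ μ₀ U n i ω) ^ 2 =
        (A ω + -b * ε i ω) * (A ω + -b * ε i ω) := by
      intro ω
      rw [hγ, ← Finset.add_sum_erase _ _ (Finset.mem_univ i)]
      have e2 : Y i ω = state φ μ₀ U i ω + ε i ω := rfl
      have e3 : stateVec φ μ₀ U n i ω = state φ μ₀ U i ω := rfl
      rw [e2, e3, hA]
      ring
    simp only [e]
    have := ip_add_self hAm ((h.memLp_ε i).const_mul (-b))
    rw [ip_comm A (fun ω => -b * ε i ω), ip_smul_left (-b) (ε i) A, ip_comm (ε i) A, hAε,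
      ip_smul_left (-b) (ε i), ip_comm (ε i), ip_smul_left, h.ip_ε_ε, if_pos rfl] at this
    rw [ip] at this
    rw [this]
    ring
  -- Divided by `1 - b`, the remaining coefficients form a competitor of the leave-one-out rule.
  have hAA : (1 - b) ^ 2 * v ≤ ip P A A := by
    by_cases hb : b = 1
    · rw [hb]; simpa using ip_self_nonneg A
    have hb' : 1 - b ≠ 0 := sub_ne_zero.2 (Ne.symm hb)
    have h1 := hβ (fun j => γ j / (1 - b))
    have e1 : v = ∫ ω, (stateVec φ μ₀ U n i ω -
        ∑ j ∈ Finset.univ.erase i, β j * Y j ω) ^ 2 ∂P := by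
      rw [hv]; simp only [hβeq, hY]; rfl
    rw [← e1] at h1
    have e2 : ∀ ω, (1 - b) ^ 2 * (stateVec φ μ₀ U n i ω -
        ∑ j ∈ Finset.univ.erase i, γ j / (1 - b) * Y j ω) ^ 2 = A ω ^ 2 := by
      intro ω
      have e3 : ∑ j ∈ Finset.univ.erase i, γ j / (1 - b) * Y j ω =
          (∑ j ∈ Finset.univ.erase i, γ j * Y j ω) / (1 - b) := by
        rw [Finset.sum_div]
        exact Finset.sum_congr rfl fun j _ => by ring
      have e4 : stateVec φ μ₀ U n i ω = state φ μ₀ U i ω := rfl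
      rw [e3, ← mul_pow, e4, hA]
      congr 1
      field_simp
      ring
    rw [ip_self]
    simp only [← e2]
    rw [integral_const_mul]
    gcongr
  rw [hrisk]
  -- The lower bound is a quadratic in `b`, minimal at `b = v / (1 + v)`.
  have h2 : (1 - b) ^ 2 * v + b ^ 2 - v / (1 + v) = ((1 + v) * b - v) ^ 2 / (1 + v) := by
    field_simp
    ring
  have h3 : 0 ≤ ((1 + v) * b - v) ^ 2 / (1 + v) := by positivity
  linarith

end ARNoise

/-! ### Limits in mean square, and what they preserve of laws and independence -/

section Limits

variable {Ω : Type*} [MeasurableSpace Ω] {P : Measure Ω}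

theorem lpNorm_two_sq {f : Ω → ℝ} (hf : MemLp f 2 P) : lpNorm f 2 P ^ 2 = ∫ ω, f ω ^ 2 ∂P := by
  rw [lpNorm_eq_integral_norm_rpow_toReal (by norm_num) (by norm_num) hf.1]
  have h0 : 0 ≤ ∫ ω, ‖f ω‖ ^ (2 : ENNReal).toReal ∂P := integral_nonneg fun ω => by positivity
  rw [← Real.rpow_natCast, ← Real.rpow_mul h0]
  simp

theorem lpNorm_fun_sum_le {ι : Type*} (S : Finset ι)
    {f : ι → Ω → ℝ} (hf : ∀ k ∈ S, MemLp (f k) 2 P) :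
    lpNorm (fun ω => ∑ k ∈ S, f k ω) 2 P ≤ ∑ k ∈ S, lpNorm (f k) 2 P := by
  classical
  induction S using Finset.induction_on with
  | empty => simp
  | insert a S ha ih =>
    have h1 : ∀ k ∈ S, MemLp (f k) 2 P := fun k hk => hf k (Finset.mem_insert_of_mem hk)
    simp only [Finset.sum_insert ha]
    have h2 : MemLp (fun ω => ∑ k ∈ S, f k ω) 2 P := memLp_finsetSum S h1
    refine (lpNorm_add_le (hf a (Finset.mem_insert_self a S)) (by norm_num)
      (g := fun ω => ∑ k ∈ S, f k ω)).trans ?_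
    gcongr
    exact ih h1

theorem lpNorm_const_mul_eq (c : ℝ) (f : Ω → ℝ) :
    lpNorm (fun ω => c * f ω) 2 P = |c| * lpNorm f 2 P := by
  rw [← Real.norm_eq_abs]
  exact lpNorm_const_smul c f P

/-- A sequence whose increments decay geometrically in mean square converges in mean square and
almost surely. -/
theorem exists_limit_of_geometric [IsProbabilityMeasure P] {X : ℕ → Ω → ℝ}
    (hX : ∀ m, MemLp (X m) 2 P) {C ρ : ℝ} (hρ0 : 0 ≤ ρ) (hρ1 : ρ < 1)
    (h : ∀ m, lpNorm (fun ω => X (m + 1) ω - X m ω) 2 P ≤ C * ρ ^ m) :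
    ∃ Y : Ω → ℝ, Measurable Y ∧ MemLp Y 2 P ∧
      (∀ m, lpNorm (fun ω => X m ω - Y ω) 2 P ≤ C * ρ ^ m / (1 - ρ)) ∧
      ∀ᵐ ω ∂P, Tendsto (fun m => X m ω) atTop (nhds (Y ω)) := by
  have hdist : ∀ (f g : Ω → ℝ) (hf : MemLp f 2 P) (hg : MemLp g 2 P),
      dist (hf.toLp f) (hg.toLp g) = lpNorm (fun ω => f ω - g ω) 2 P := by
    intro f g hf hg
    rw [dist_eq_norm, ← MemLp.toLp_sub, Lp.norm_toLp, toReal_eLpNorm (hf.sub hg).1]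
    rfl
  have hu : ∀ m, dist ((hX m).toLp (X m)) ((hX (m + 1)).toLp (X (m + 1))) ≤ C * ρ ^ m := by
    intro m
    rw [dist_comm, hdist]
    exact h m
  obtain ⟨L, hL⟩ := cauchySeq_tendsto_of_complete (cauchySeq_of_le_geometric ρ C hρ1 hu)
  have hLm : MemLp L 2 P := Lp.memLp L
  have hb : ∀ m, lpNorm (fun ω => X m ω - L ω) 2 P ≤ C * ρ ^ m / (1 - ρ) := by
    intro m
    have := dist_le_of_le_geometric_of_tendsto ρ C hρ1 hu hL m
    rw [← hdist (X m) L (hX m) hLm, Lp.toLp_coeFn]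
    exact this
  have hm : StronglyMeasurable L := Lp.stronglyMeasurable L
  refine ⟨L, hm.measurable, hLm, hb, ?_⟩
  -- almost sure convergence, since the squared errors are summable
  have hint : ∀ m, ∫⁻ ω, ENNReal.ofReal ((X m ω - L ω) ^ 2) ∂P ≤
      ENNReal.ofReal ((C / (1 - ρ)) ^ 2 * (ρ ^ 2) ^ m) := by
    intro m
    have h2 : MemLp (fun ω => X m ω - L ω) 2 P := (hX m).sub hLm
    rw [← ofReal_integral_eq_lintegral_ofReal h2.integrable_sq (ae_of_all _ fun ω => sq_nonneg _),
      ← lpNorm_two_sq h2]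
    refine ENNReal.ofReal_le_ofReal ?_
    calc lpNorm (fun ω => X m ω - L ω) 2 P ^ 2 ≤ (C * ρ ^ m / (1 - ρ)) ^ 2 := by
          gcongr
          · exact lpNorm_nonneg
          · exact hb m
      _ = _ := by ring
  have hsum : ∫⁻ ω, ∑' m, ENNReal.ofReal ((X m ω - L ω) ^ 2) ∂P ≠ ⊤ := by
    rw [lintegral_tsum]
    · refine ne_top_of_le_ne_top ?_ (ENNReal.tsum_le_tsum hint)
      rw [← ENNReal.ofReal_tsum_of_nonneg]
      · exact ENNReal.ofReal_ne_top
      · intro m; positivity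
      · exact (summable_geometric_of_lt_one (by positivity) (by nlinarith)).mul_left _
    · intro m
      exact (((hX m).1.aemeasurable.sub hm.measurable.aemeasurable).pow_const 2).ennreal_ofReal
  have hae := ae_lt_top' (AEMeasurable.tsum fun m =>
    (((hX m).1.aemeasurable.sub hm.measurable.aemeasurable).pow_const 2).ennreal_ofReal) hsum
  filter_upwards [hae] with ω hω
  have h1 := ENNReal.tendsto_atTop_zero_of_tsum_ne_top hω.ne
  have h2 := (ENNReal.tendsto_toReal ENNReal.zero_ne_top).comp h1
  have h3 : Tendsto (fun m => (X m ω - L ω) ^ 2) atTop (nhds 0) := by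
    refine h2.congr fun m => ?_
    exact ENNReal.toReal_ofReal (sq_nonneg _)
  have h4 : Tendsto (fun m => |X m ω - L ω|) atTop (nhds 0) := by
    have := (Real.continuous_sqrt.tendsto 0).comp h3
    simpa [Function.comp_def, Real.sqrt_sq_eq_abs] using this
  exact tendsto_iff_norm_sub_tendsto_zero.2 h4

/-- Independence can be tested on products of bounded continuous functions, and these pass to the
limit by dominated convergence. -/
theorem indepFun_of_tendsto [IsProbabilityMeasure P] {X : ℕ → Ω → ℝ} {Y W : Ω → ℝ}
    (hX : ∀ m, AEMeasurable (X m) P) (hY : AEMeasurable Y P) (hW : AEMeasurable W P)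
    (hlim : ∀ᵐ ω ∂P, Tendsto (fun m => X m ω) atTop (nhds (Y ω)))
    (hind : ∀ m, IndepFun (X m) W P) : IndepFun Y W P := by
  refine indepFun_of_bcf hY hW fun f g => ?_
  have hb : ∀ (f : BoundedContinuousFunction ℝ ℝ) {V : Ω → ℝ}, AEMeasurable V P →
      AEStronglyMeasurable (fun ω => f (V ω)) P := fun f V hV =>
    (f.continuous.measurable.comp_aemeasurable hV).aestronglyMeasurable
  have h1 : Tendsto (fun m => ∫ ω, f (X m ω) * g (W ω) ∂P) atTop
      (nhds (∫ ω, f (Y ω) * g (W ω) ∂P)) := by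
    refine tendsto_integral_of_dominated_convergence (fun _ => ‖f‖ * ‖g‖)
      (fun m => (hb f (hX m)).mul (hb g hW)) (integrable_const _) (fun m => ae_of_all _ fun ω => ?_)
      ?_
    · rw [norm_mul]
      exact mul_le_mul (f.norm_coe_le_norm _) (g.norm_coe_le_norm _) (norm_nonneg _) (norm_nonneg _)
    · filter_upwards [hlim] with ω hω
      exact ((f.continuous.tendsto _).comp hω).mul_const _
  have h2 : Tendsto (fun m => (∫ ω, f (X m ω) ∂P) * ∫ ω, g (W ω) ∂P) atTop
      (nhds ((∫ ω, f (Y ω) ∂P) * ∫ ω, g (W ω) ∂P)) := by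
    refine Tendsto.mul_const _ ?_
    refine tendsto_integral_of_dominated_convergence (fun _ => ‖f‖)
      (fun m => hb f (hX m)) (integrable_const _) (fun m => ae_of_all _ fun ω => ?_) ?_
    · exact f.norm_coe_le_norm _
    · filter_upwards [hlim] with ω hω
      exact (f.continuous.tendsto _).comp hω
  refine tendsto_nhds_unique (h1.congr fun m => ?_) h2
  exact (hind m).integral_fun_comp_mul_comp (hX m) hW f.continuous.aestronglyMeasurable
    g.continuous.aestronglyMeasurable

theorem map_eq_of_tendsto [IsProbabilityMeasure P] {X X' : ℕ → Ω → ℝ} {Y Y' : Ω → ℝ}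
    (hX : ∀ m, AEMeasurable (X m) P) (hX' : ∀ m, AEMeasurable (X' m) P)
    (hY : AEMeasurable Y P) (hY' : AEMeasurable Y' P)
    (hlim : ∀ᵐ ω ∂P, Tendsto (fun m => X m ω) atTop (nhds (Y ω)))
    (hlim' : ∀ᵐ ω ∂P, Tendsto (fun m => X' m ω) atTop (nhds (Y' ω)))
    (h : ∀ m, P.map (X m) = P.map (X' m)) : P.map Y = P.map Y' := by
  have := Measure.isProbabilityMeasure_map hY
  have := Measure.isProbabilityMeasure_map hY'
  refine ext_of_forall_integral_eq_of_IsFiniteMeasure fun f => ?_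
  have key : ∀ {X : ℕ → Ω → ℝ} {Y : Ω → ℝ}, (∀ m, AEMeasurable (X m) P) →
      (∀ᵐ ω ∂P, Tendsto (fun m => X m ω) atTop (nhds (Y ω))) →
      Tendsto (fun m => ∫ ω, f (X m ω) ∂P) atTop (nhds (∫ ω, f (Y ω) ∂P)) := by
    intro X Y hX hlim
    refine tendsto_integral_of_dominated_convergence (fun _ => ‖f‖)
      (fun m => (f.continuous.measurable.comp_aemeasurable (hX m)).aestronglyMeasurable)
      (integrable_const _) (fun m => ae_of_all _ fun ω => ?_) ?_
    · exact f.norm_coe_le_norm _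
    · filter_upwards [hlim] with ω hω
      exact (f.continuous.tendsto _).comp hω
  rw [integral_map hY f.continuous.aestronglyMeasurable,
    integral_map hY' f.continuous.aestronglyMeasurable]
  refine tendsto_nhds_unique ((key hX hlim).congr fun m => ?_) (key hX' hlim')
  rw [← integral_map (hX m) f.continuous.aestronglyMeasurable,
    ← integral_map (hX' m) f.continuous.aestronglyMeasurable, h m]

/-- Variables that are measurable with respect to disjoint parts of an independent family are
independent. -/
theorem indepFun_of_measurable_iSup {ι : Type*} {ζ : ι → Ω → ℝ} (hζ : ∀ a, Measurable (ζ a))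
    (hind : iIndepFun ζ P) {S T : Set ι} (hST : Disjoint S T) {X Y : Ω → ℝ}
    (hX : Measurable[⨆ a ∈ S, MeasurableSpace.comap (ζ a) inferInstance] X)
    (hY : Measurable[⨆ a ∈ T, MeasurableSpace.comap (ζ a) inferInstance] Y) :
    IndepFun X Y P := by
  have h1 := indep_iSup_of_disjoint (fun a => (hζ a).comap_le) hind.iIndep hST
  rw [IndepFun_iff_Indep]
  exact indep_of_indep_of_le_left (indep_of_indep_of_le_right h1 hY.comap_le) hX.comap_le

theorem measurable_iSup_comap {ι : Type*} {ζ : ι → Ω → ℝ} {S : Set ι} {a : ι} (ha : a ∈ S) :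
    Measurable[⨆ a ∈ S, MeasurableSpace.comap (ζ a) inferInstance] (ζ a) :=
  (comap_measurable (ζ a)).mono (le_iSup₂_of_le a ha le_rfl) le_rfl

end Limits

theorem abs_integral_le_lpNorm {Ω : Type*} [MeasurableSpace Ω] {P : Measure Ω}
    [IsProbabilityMeasure P] {f : Ω → ℝ} (hf : MemLp f 2 P) : |∫ ω, f ω ∂P| ≤ lpNorm f 2 P := by
  refine abs_le_of_sq_le_sq ?_ lpNorm_nonneg
  rw [lpNorm_two_sq hf]
  have h1 := variance_nonneg f P
  rw [variance_eq_sub hf] at h1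
  have h2 : ∫ ω, (f ^ 2) ω ∂P = ∫ ω, f ω ^ 2 ∂P := rfl
  linarith

/-! ### Moving averages of the noise -/

section MovingAverage

variable {Ω : Type*}

/-- The part of a two-sided moving average of the noise with lags at most `m`; the noise variable
of lag `k` is the one with index `e k`. -/
noncomputable def movingAvg (a b : ℤ → ℝ) (U ε : ℕ → Ω → ℝ) (e : ℤ → ℕ) (m : ℕ) (ω : Ω) : ℝ :=
  ∑ k ∈ Finset.Icc (-m : ℤ) m, (a k * U (e k) ω + b k * ε (e k) ω)

theorem movingAvg_succ (a b : ℤ → ℝ) (U ε : ℕ → Ω → ℝ) (e : ℤ → ℕ) (m : ℕ) (ω : Ω) :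
    movingAvg a b U ε e (m + 1) ω = movingAvg a b U ε e m ω +
      (a (m + 1) * U (e (m + 1)) ω + b (m + 1) * ε (e (m + 1)) ω +
      (a (-(m + 1)) * U (e (-(m + 1))) ω + b (-(m + 1)) * ε (e (-(m + 1))) ω)) := by
  have h : Finset.Icc (-((m + 1 : ℕ) : ℤ)) ((m + 1 : ℕ) : ℤ) =
      insert (-((m : ℤ) + 1)) (insert ((m : ℤ) + 1) (Finset.Icc (-m : ℤ) m)) := by
    ext k
    simp only [Finset.mem_Icc, Finset.mem_insert]
    omega
  rw [movingAvg, h, Finset.sum_insert, Finset.sum_insert, movingAvg]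
  · ring
  · simp
  · simp; omega

theorem movingAvg_congr {a b : ℤ → ℝ} {U ε : ℕ → Ω → ℝ} {e e' : ℤ → ℕ} {m : ℕ}
    (h : ∀ k : ℤ, -m ≤ k → k ≤ m → e k = e' k) (ω : Ω) :
    movingAvg a b U ε e m ω = movingAvg a b U ε e' m ω :=
  Finset.sum_congr rfl fun k hk => by
    have := Finset.mem_Icc.1 hk
    rw [h k this.1 this.2]

end MovingAverage

namespace ARNoise

variable {Ω : Type*} [MeasurableSpace Ω] {P : Measure Ω} [IsProbabilityMeasure P]
  {μ₀ : Ω → ℝ} {U ε : ℕ → Ω → ℝ} {a b : ℤ → ℝ}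

theorem lpNorm_U (h : ARNoise P μ₀ U ε) (i : ℕ) : lpNorm (U i) 2 P = lpNorm (U 0) 2 P := by
  rw [← sq_eq_sq₀ lpNorm_nonneg lpNorm_nonneg, lpNorm_two_sq (h.memLp_U i),
    lpNorm_two_sq (h.memLp_U 0)]
  exact ((h.ident_U i).comp (u := fun x : ℝ => x ^ 2) (by fun_prop)).integral_eq

theorem lpNorm_ε (h : ARNoise P μ₀ U ε) (i : ℕ) : lpNorm (ε i) 2 P = 1 := by
  have := lpNorm_two_sq (h.memLp_ε i)
  rw [h.integral_ε_sq] at this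
  exact (pow_eq_one_iff_of_nonneg lpNorm_nonneg two_ne_zero).1 this

theorem iIndepFun_noise (h : ARNoise P μ₀ U ε) : iIndepFun (Sum.elim U ε) P :=
  iIndepFun.precomp (g := (Sum.inr : ℕ ⊕ ℕ → Unit ⊕ (ℕ ⊕ ℕ))) Sum.inr_injective h.indep

theorem measurable_noise (h : ARNoise P μ₀ U ε) (s : ℕ ⊕ ℕ) : Measurable (Sum.elim U ε s) := by
  rcases s with i | i
  exacts [h.meas_U i, h.meas_ε i]

theorem memLp_movingAvg (h : ARNoise P μ₀ U ε) (a b : ℤ → ℝ) (e : ℤ → ℕ) (m : ℕ) :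
    MemLp (movingAvg a b U ε e m) 2 P :=
  memLp_finsetSum _ fun k _ => ((h.memLp_U (e k)).const_mul (a k)).add
    ((h.memLp_ε (e k)).const_mul (b k))

theorem measurable_movingAvg (h : ARNoise P μ₀ U ε) (a b : ℤ → ℝ) (e : ℤ → ℕ) (m : ℕ) :
    Measurable (movingAvg a b U ε e m) :=
  Finset.measurable_fun_sum _ fun k _ => ((h.meas_U (e k)).const_mul (a k)).add
    ((h.meas_ε (e k)).const_mul (b k))

theorem integral_movingAvg (h : ARNoise P μ₀ U ε) (a b : ℤ → ℝ) (e : ℤ → ℕ) (m : ℕ) :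
    ∫ ω, movingAvg a b U ε e m ω ∂P = 0 := by
  have hU : ∀ i, Integrable (U i) P := fun i => (h.memLp_U i).integrable (by norm_num)
  have hε : ∀ i, Integrable (ε i) P := fun i => (h.memLp_ε i).integrable (by norm_num)
  simp only [movingAvg]
  rw [integral_finsetSum]
  · refine Finset.sum_eq_zero fun k _ => ?_
    rw [integral_add ((hU _).const_mul _) ((hε _).const_mul _), integral_const_mul,
      integral_const_mul, h.mean_U, h.mean_ε]
    ring
  · intro k _
    exact ((hU _).const_mul _).add ((hε _).const_mul _)

theorem lpNorm_movingAvg_succ_sub (h : ARNoise P μ₀ U ε) {C ρ : ℝ} (hC : 0 ≤ C) (hρ0 : 0 < ρ)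
    (hρ1 : ρ < 1) (ha : ∀ j, |a j| ≤ C * ρ ^ j.natAbs) (hb : ∀ j, |b j| ≤ C * ρ ^ j.natAbs)
    (e : ℤ → ℕ) (m : ℕ) :
    lpNorm (fun ω => movingAvg a b U ε e (m + 1) ω - movingAvg a b U ε e m ω) 2 P ≤
      2 * C * (lpNorm (U 0) 2 P + 1) * ρ ^ m := by
  have hpw : ∀ j : ℤ, j.natAbs = m + 1 → C * ρ ^ j.natAbs ≤ C * ρ ^ m := fun j hj => by
    rw [hj]; gcongr C * ?_; exact pow_le_pow_of_le_one hρ0.le hρ1.le (by omega)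
  have hterm : ∀ j : ℤ, j.natAbs = m + 1 →
      lpNorm (fun ω => a j * U (e j) ω + b j * ε (e j) ω) 2 P ≤
        C * (lpNorm (U 0) 2 P + 1) * ρ ^ m := by
    intro j hj
    refine (lpNorm_add_le ((h.memLp_U (e j)).const_mul (a j)) (by norm_num)
      (g := fun ω => b j * ε (e j) ω)).trans ?_
    rw [lpNorm_const_mul_eq, lpNorm_const_mul_eq, h.lpNorm_U, h.lpNorm_ε]
    have h1 := (ha j).trans (hpw j hj)
    have h2 := (hb j).trans (hpw j hj)
    calc |a j| * lpNorm (U 0) 2 P + |b j| * 1 ≤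
        C * ρ ^ m * lpNorm (U 0) 2 P + C * ρ ^ m * 1 := by
          gcongr
          exact lpNorm_nonneg
      _ = _ := by ring
  have e1 : (fun ω => movingAvg a b U ε e (m + 1) ω - movingAvg a b U ε e m ω) =
      fun ω => (a (m + 1) * U (e (m + 1)) ω + b (m + 1) * ε (e (m + 1)) ω) +
      (a (-(m + 1)) * U (e (-(m + 1))) ω + b (-(m + 1)) * ε (e (-(m + 1))) ω) := by
    funext ω
    rw [movingAvg_succ]
    ring
  rw [e1]
  refine (lpNorm_add_le (((h.memLp_U _).const_mul _).add ((h.memLp_ε _).const_mul _)) (by norm_num)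
    (g := fun ω => a (-(m + 1)) * U (e (-(m + 1))) ω + b (-(m + 1)) * ε (e (-(m + 1))) ω)).trans ?_
  have h1 := hterm (m + 1) (by omega)
  have h2 := hterm (-(m + 1)) (by omega)
  calc _ ≤ _ := add_le_add h1 h2
    _ = _ := by ring

/-- The law of a moving average does not depend on the indexing of the noise. -/
theorem map_movingAvg_eq (h : ARNoise P μ₀ U ε) (a b : ℤ → ℝ) {e e' : ℤ → ℕ}
    (he : Function.Injective e) (he' : Function.Injective e') (m : ℕ) :
    P.map (movingAvg a b U ε e m) = P.map (movingAvg a b U ε e' m) := by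
  let Φ : (ℤ ⊕ ℤ → ℝ) → ℝ := fun x =>
    ∑ k ∈ Finset.Icc (-m : ℤ) m, (a k * x (.inl k) + b k * x (.inr k))
  have hΦ : Measurable Φ := by fun_prop
  let N : (ℤ → ℕ) → ℤ ⊕ ℤ → Ω → ℝ := fun e s => Sum.elim U ε (Sum.map e e s)
  have hNm : ∀ e s, Measurable (N e s) := fun e s => h.measurable_noise _
  have hlaw : ∀ e s, P.map (N e s) = P.map (Sum.elim (fun _ => U 0) (fun _ => ε 0) s) := by
    intro e s
    rcases s with k | k
    · exact (h.ident_U (e k)).map_eq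
    · change P.map (ε (e k)) = P.map (ε 0)
      rw [h.law_ε, h.law_ε]
  -- Injectivity keeps the relabelled noise independent, so its joint law is the product of the
  -- marginals whatever the labels.
  have hjoint : ∀ e, Function.Injective e → P.map (fun ω s => N e s ω) =
      Measure.infinitePi fun s => P.map (Sum.elim (fun _ : ℤ => U 0) (fun _ : ℤ => ε 0) s) := by
    intro e he
    have h1 : iIndepFun (N e) P := iIndepFun.precomp (he.sumMap he) h.iIndepFun_noise
    have := h1.map_fun_eq_infinitePi_map (hNm e)
    rw [this]
    congr 1
    funext s
    exact hlaw e s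
  have key : ∀ e, Function.Injective e → P.map (movingAvg a b U ε e m) =
      (Measure.infinitePi fun s =>
        P.map (Sum.elim (fun _ : ℤ => U 0) (fun _ : ℤ => ε 0) s)).map Φ := by
    intro e he
    rw [← hjoint e he, Measure.map_map hΦ (measurable_pi_iff.2 (hNm e))]
    rfl
  rw [key e he, key e' he']

theorem measurable_iSup_U {S : Set (ℕ ⊕ ℕ)} {i : ℕ} (hi : .inl i ∈ S) :
    Measurable[⨆ s ∈ S, MeasurableSpace.comap (Sum.elim U ε s) inferInstance] (U i) :=
  measurable_iSup_comap (ζ := Sum.elim U ε) hi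

theorem measurable_iSup_ε {S : Set (ℕ ⊕ ℕ)} {i : ℕ} (hi : .inr i ∈ S) :
    Measurable[⨆ s ∈ S, MeasurableSpace.comap (Sum.elim U ε s) inferInstance] (ε i) :=
  measurable_iSup_comap (ζ := Sum.elim U ε) hi

/-- Lags with zero coefficient are exempt, so that an average lacking the error or the innovation of
lag 0 is seen to be independent of it. -/
theorem measurable_iSup_movingAvg {S : Set (ℕ ⊕ ℕ)} {e : ℤ → ℕ} {m : ℕ}
    (ha : ∀ k : ℤ, -m ≤ k → k ≤ m → a k = 0 ∨ .inl (e k) ∈ S)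
    (hb : ∀ k : ℤ, -m ≤ k → k ≤ m → b k = 0 ∨ .inr (e k) ∈ S) :
    Measurable[⨆ s ∈ S, MeasurableSpace.comap (Sum.elim U ε s) inferInstance]
      (movingAvg a b U ε e m) := by
  refine @Finset.measurable_fun_sum _ _ _ _ _ _ (_) _ _ fun k hk => ?_
  have hk := Finset.mem_Icc.1 hk
  refine @Measurable.add _ _ _ _ _ (_) _ _ ?_ ?_
  · rcases ha k hk.1 hk.2 with h0 | h0
    · simp only [h0, zero_mul]
      exact @measurable_const _ _ _ (_) _
    · exact @Measurable.const_mul _ _ _ _ _ (_) _ (measurable_iSup_U h0) _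
  · rcases hb k hk.1 hk.2 with h0 | h0
    · simp only [h0, zero_mul]
      exact @measurable_const _ _ _ (_) _
    · exact @Measurable.const_mul _ _ _ _ _ (_) _ (measurable_iSup_ε h0) _

theorem indepFun_movingAvg_ε (h : ARNoise P μ₀ U ε) (hb0 : b 0 = 0) {e : ℤ → ℕ}
    (he : Function.Injective e) (m : ℕ) : IndepFun (movingAvg a b U ε e m) (ε (e 0)) P := by
  refine indepFun_of_measurable_iSup h.measurable_noise h.iIndepFun_noise
    (S := {s | s ≠ .inr (e 0)}) (T := {.inr (e 0)}) ?_ (measurable_iSup_movingAvg ?_ ?_)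
    (measurable_iSup_ε (by simp))
  · rw [Set.disjoint_singleton_right]; simp
  · intro k _ _; right; simp
  · intro k _ _
    by_cases hk : k = 0
    · left; rw [hk, hb0]
    · right; simpa using fun h0 => hk (he h0)

theorem indepFun_U_movingAvg_add (h : ARNoise P μ₀ U ε) {e : ℤ → ℕ}
    (he : Function.Injective e) (m : ℕ) (ha0 : a 0 = 0) :
    IndepFun (fun ω => movingAvg a b U ε e m ω + ε (e 0) ω) (U (e 0)) P := by
  refine indepFun_of_measurable_iSup h.measurable_noise h.iIndepFun_noise
    (S := {s | s ≠ .inl (e 0)}) (T := {.inl (e 0)}) ?_ ?_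
    (measurable_iSup_U (by simp))
  · rw [Set.disjoint_singleton_right]; simp
  · refine @Measurable.add _ _ _ _ _ (_) _ _ (measurable_iSup_movingAvg ?_ ?_)
      (measurable_iSup_ε (by simp))
    · intro k _ _
      by_cases hk : k = 0
      · left; rw [hk, ha0]
      · right; simpa using fun h0 => hk (he h0)
    · intro k _ _; right; simp

/-- Moving averages plus observation error over disjoint windows are independent. -/
theorem indepFun_window (h : ARNoise P μ₀ U ε) (a b : ℤ → ℝ) {m i j : ℕ} (hmi : m ≤ i)
    (hij : i + 2 * m < j) :
    IndepFun (fun ω => movingAvg a b U ε (fun k => ((i : ℤ) + k).toNat) m ω + ε i ω)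
      (fun ω => movingAvg a b U ε (fun k => ((j : ℤ) + k).toNat) m ω + ε j ω) P := by
  let S : ℕ → Set (ℕ ⊕ ℕ) := fun i =>
    {s | i ≤ Sum.elim id id s + m ∧ Sum.elim id id s ≤ i + m}
  have hm : ∀ i, m ≤ i → Measurable[⨆ s ∈ S i, MeasurableSpace.comap (Sum.elim U ε s)
      inferInstance]
      (fun ω => movingAvg a b U ε (fun k => ((i : ℤ) + k).toNat) m ω + ε i ω) := by
    intro i hi
    refine @Measurable.add _ _ _ _ _ (_) _ _ (measurable_iSup_movingAvg ?_ ?_)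
      (measurable_iSup_ε (by simp [S]))
    · intro k h1 h2; right; simp [S]; omega
    · intro k h1 h2; right; simp [S]; omega
  refine indepFun_of_measurable_iSup h.measurable_noise h.iIndepFun_noise
    (S := S i) (T := S j) ?_ (hm i hmi) (hm j (by omega))
  rw [Set.disjoint_left]
  intro s h1 h2
  simp only [S, Set.mem_ofPred_eq] at h1 h2
  omega

/-- The stationary two-sided moving average: its law, and copies of it built on the noise. -/
theorem exists_stationary_law (h : ARNoise P μ₀ U ε) {C ρ : ℝ} (hC : 0 ≤ C) (hρ0 : 0 < ρ)
    (hρ1 : ρ < 1) (ha : ∀ j, |a j| ≤ C * ρ ^ j.natAbs) (hb : ∀ j, |b j| ≤ C * ρ ^ j.natAbs)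
    (hb0 : b 0 = 0) (ha0 : a 0 ≠ 0)
    (hU : ∀ (m : ℝ) (v : ℝ≥0), P.map (U 0) ≠ gaussianReal m v) :
    ∃ G : Measure ℝ, ∃ D : ℝ, 0 ≤ D ∧ ∀ e : ℤ → ℕ, Function.Injective e →
      ∃ X : Ω → ℝ, Measurable X ∧ MemLp X 2 P ∧ P.map X = G ∧ IndepFun X (ε (e 0)) P ∧
        (∀ m, lpNorm (fun ω => movingAvg a b U ε e m ω - X ω) 2 P ≤ D * ρ ^ m) ∧
        ∀ v : ℝ≥0, P.map (fun ω => X ω + ε (e 0) ω) ≠ gaussianReal 0 v := by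
  have key : ∀ e : ℤ → ℕ, ∃ X : Ω → ℝ, Measurable X ∧ MemLp X 2 P ∧
      (∀ m, lpNorm (fun ω => movingAvg a b U ε e m ω - X ω) 2 P ≤
        2 * C * (lpNorm (U 0) 2 P + 1) * ρ ^ m / (1 - ρ)) ∧
      ∀ᵐ ω ∂P, Tendsto (fun m => movingAvg a b U ε e m ω) atTop (nhds (X ω)) := fun e =>
    exists_limit_of_geometric (h.memLp_movingAvg a b e) hρ0.le hρ1
      (h.lpNorm_movingAvg_succ_sub hC hρ0 hρ1 ha hb e)
  choose X hXm hX2 hXlim hXae using key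
  -- A two-sided average needs noise indexed by `ℤ`, while the noise is indexed by `ℕ`. Any
  -- injection serves; this one is the reference that defines `G`.
  have hinj0 : Function.Injective (Equiv.intEquivNat : ℤ → ℕ) := Equiv.injective _
  have hnn : (0 : ℝ) ≤ lpNorm (U 0) 2 P := lpNorm_nonneg
  have hρ' : 0 < 1 - ρ := by linarith
  refine ⟨P.map (X Equiv.intEquivNat), 2 * C * (lpNorm (U 0) 2 P + 1) / (1 - ρ), by positivity,
    fun e he => ⟨X e, hXm e, hX2 e, ?_, ?_, fun m => (hXlim e m).trans (le_of_eq (by ring)), ?_⟩⟩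
  · exact map_eq_of_tendsto (fun m => (h.measurable_movingAvg a b e m).aemeasurable)
      (fun m => (h.measurable_movingAvg a b _ m).aemeasurable) (hXm e).aemeasurable
      (hXm _).aemeasurable (hXae e) (hXae _) fun m => h.map_movingAvg_eq a b he hinj0 m
  · exact indepFun_of_tendsto (fun m => (h.measurable_movingAvg a b e m).aemeasurable)
      (hXm e).aemeasurable (h.meas_ε _).aemeasurable (hXae e)
      fun m => h.indepFun_movingAvg_ε hb0 he m
  · intro v hv
    have hmeanX : ∫ ω, X e ω ∂P = 0 := by
      have h1 : ∀ m, |∫ ω, X e ω ∂P| ≤ 2 * C * (lpNorm (U 0) 2 P + 1) * ρ ^ m / (1 - ρ) := by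
        intro m
        refine le_trans ?_ (hXlim e m)
        have h2 := abs_integral_le_lpNorm ((h.memLp_movingAvg a b e m).sub (hX2 e))
        have h3 : ∫ ω, (movingAvg a b U ε e m - X e) ω ∂P = -∫ ω, X e ω ∂P := by
          simp only [Pi.sub_apply]
          rw [integral_sub ((h.memLp_movingAvg a b e m).integrable (by norm_num))
            ((hX2 e).integrable (by norm_num)), h.integral_movingAvg, zero_sub]
        rw [h3, abs_neg] at h2
        exact h2
      have h2 : Tendsto (fun m : ℕ => 2 * C * (lpNorm (U 0) 2 P + 1) * ρ ^ m / (1 - ρ)) atTop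
          (nhds (2 * C * (lpNorm (U 0) 2 P + 1) * 0 / (1 - ρ))) :=
        ((tendsto_pow_atTop_nhds_zero_of_lt_one hρ0.le hρ1).const_mul _).div_const _
      have h3 := ge_of_tendsto' h2 h1
      rw [mul_zero, zero_div] at h3
      exact abs_eq_zero.1 (le_antisymm h3 (abs_nonneg _))
    -- split off the innovation of lag zero
    let W : Ω → ℝ := fun ω => X e ω - a 0 * U (e 0) ω + ε (e 0) ω
    have hWm : Measurable W := ((hXm e).sub ((h.meas_U _).const_mul _)).add (h.meas_ε _)
    have hW2 : MemLp W 2 P := ((hX2 e).sub ((h.memLp_U _).const_mul _)).add (h.memLp_ε _)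
    have hsplit : ∀ m ω, movingAvg (Function.update a 0 0) b U ε e m ω + ε (e 0) ω =
        movingAvg a b U ε e m ω - a 0 * U (e 0) ω + ε (e 0) ω := by
      intro m ω
      have h0 : (0 : ℤ) ∈ Finset.Icc (-m : ℤ) m := by simp
      simp only [movingAvg]
      rw [← Finset.add_sum_erase _ _ h0, ← Finset.add_sum_erase (Finset.Icc (-m : ℤ) m)
        (fun k => a k * U (e k) ω + b k * ε (e k) ω) h0]
      have h1 : ∑ k ∈ (Finset.Icc (-m : ℤ) m).erase 0,
          (Function.update a 0 0 k * U (e k) ω + b k * ε (e k) ω) =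
          ∑ k ∈ (Finset.Icc (-m : ℤ) m).erase 0, (a k * U (e k) ω + b k * ε (e k) ω) :=
        Finset.sum_congr rfl fun k hk => by
          rw [Function.update_of_ne (Finset.ne_of_mem_erase hk)]
      rw [h1]
      simp
      ring
    have hWU : IndepFun W (U (e 0)) P := by
      refine indepFun_of_tendsto
        (X := fun m ω => movingAvg (Function.update a 0 0) b U ε e m ω + ε (e 0) ω)
        (fun m => ((h.measurable_movingAvg _ b e m).add (h.meas_ε _)).aemeasurable)
        hWm.aemeasurable (h.meas_U _).aemeasurable ?_
        fun m => h.indepFun_U_movingAvg_add he m (by simp)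
      filter_upwards [hXae e] with ω hω
      simp only [hsplit]
      exact (hω.sub_const _).add_const _
    have hUW : IndepFun (fun ω => a 0 * U (e 0) ω) W P :=
      (hWU.symm).comp (measurable_const_mul (a 0)) measurable_id
    have hUi : Integrable (U (e 0)) P := (h.memLp_U _).integrable (by norm_num)
    have hW0 : ∫ ω, W ω ∂P = 0 := by
      simp only [W]
      have hi : Integrable (fun ω => X e ω - a 0 * U (e 0) ω) P :=
        ((hX2 e).integrable (by norm_num)).sub (hUi.const_mul _)
      rw [integral_add hi ((h.memLp_ε _).integrable (by norm_num)),
        integral_sub ((hX2 e).integrable (by norm_num)) (hUi.const_mul _), integral_const_mul,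
        h.mean_U, h.mean_ε, hmeanX]
      ring
    -- Cramér's theorem makes the summand `a 0 * U (e 0)` normal, and `a 0 ≠ 0` transfers this to
    -- the innovation itself.
    obtain ⟨v', hv'⟩ := map_eq_gaussianReal_of_indepFun_add (P := P)
      (X := fun ω => a 0 * U (e 0) ω) (W := W) ((h.meas_U _).const_mul _) hWm
      (hW2.integrable (by norm_num))
      (by rw [integral_const_mul, h.mean_U, mul_zero]) hW0 hUW (v := v) (by
        rw [← hv]
        congr 1
        funext ω
        simp only [W]
        ring)
    have h1 := gaussianReal_map_const_mul (μ := 0) (v := v') (a 0)⁻¹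
    rw [← hv', Measure.map_map (by fun_prop) ((h.meas_U _).const_mul _)] at h1
    have h2 : ((fun x => (a 0)⁻¹ * x) ∘ fun ω => a 0 * U (e 0) ω) = U (e 0) := by
      funext ω
      simp [ha0]
    rw [h2, (h.ident_U (e 0)).map_eq] at h1
    exact hU _ _ h1

end ARNoise

/-! ### Coupling the leave-one-out residuals with a stationary moving average -/

theorem abs_div_sub_div_le {x α g κ δ C w : ℝ} (hx : |x - α| ≤ δ) (hg : |g - κ| ≤ δ)
    (hα : |α| ≤ C) (hw : 0 < w) (hwg : w ≤ 1 - g) (hwκ : w ≤ 1 - κ) :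
    |x / (1 - g) - α / (1 - κ)| ≤ δ / w + C * δ / w ^ 2 := by
  have h1 : 0 < 1 - g := hw.trans_le hwg
  have h2 : 0 < 1 - κ := hw.trans_le hwκ
  have hδ : 0 ≤ δ := (abs_nonneg _).trans hx
  have hC : 0 ≤ C := (abs_nonneg _).trans hα
  have e : x / (1 - g) - α / (1 - κ) = (x - α) / (1 - g) + α * (g - κ) / ((1 - g) * (1 - κ)) := by
    field_simp
    ring
  rw [e]
  refine (abs_add_le _ _).trans ?_
  rw [abs_div, abs_div, abs_mul, abs_mul, abs_of_pos h1, abs_of_pos h2, pow_two]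
  gcongr

/-- An injective indexing that agrees with `k ↦ i + k` for `|k| ≤ m`. -/
theorem exists_injective_extension {m i : ℕ} (hmi : m ≤ i) : ∃ e : ℤ → ℕ, Function.Injective e ∧
    ∀ k : ℤ, -m ≤ k → k ≤ m → e k = ((i : ℤ) + k).toNat := by
  -- Lags outside the window are sent beyond `i + m`, to distinct places according to modulus and
  -- sign.
  refine ⟨fun k => if -m ≤ k ∧ k ≤ m then ((i : ℤ) + k).toNat else
    i + m + 1 + (2 * k.natAbs + if k < 0 then 1 else 0), ?_, fun k h1 h2 => by simp [h1, h2]⟩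
  intro k l hkl
  simp only at hkl
  split_ifs at hkl <;> omega

namespace ARNoise

open EBKalman

variable {Ω : Type*} [MeasurableSpace Ω] {P : Measure Ω} [IsProbabilityMeasure P]
  {μ₀ : Ω → ℝ} {U ε : ℕ → Ω → ℝ}

/-- The strict inequality `m < i` keeps the window away from index 0, where the innovation is `φ μ₀
+ U 0` and not `U 0`. -/
theorem movingAvg_eq_sum_range {a b : ℤ → ℝ} {n m i : ℕ} (hi : m < i) (hn : i + m < n) (φ : ℝ)
    (ω : Ω) :
    movingAvg a b U ε (fun k => ((i : ℤ) + k).toNat) m ω = ∑ k ∈ Finset.range n,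
      ((if ((k : ℤ) - i).natAbs ≤ m then a ((k : ℤ) - i) else 0) *
          innov φ (fun j => state φ μ₀ U j ω) k +
        (if ((k : ℤ) - i).natAbs ≤ m then b ((k : ℤ) - i) else 0) * ε k ω) := by
  have h1 : ∀ k ∈ Finset.range n,
      ((if ((k : ℤ) - i).natAbs ≤ m then a ((k : ℤ) - i) else 0) *
          innov φ (fun j => state φ μ₀ U j ω) k +
        (if ((k : ℤ) - i).natAbs ≤ m then b ((k : ℤ) - i) else 0) * ε k ω) =
      if ((k : ℤ) - i).natAbs ≤ m then a ((k : ℤ) - i) * U k ω + b ((k : ℤ) - i) * ε k ω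
        else 0 := by
    intro k _
    split_ifs with hk
    · obtain ⟨l, rfl⟩ : ∃ l, k = l + 1 := ⟨k - 1, by omega⟩
      rw [innov_state_succ]
    · ring
  rw [Finset.sum_congr rfl h1, ← Finset.sum_filter, movingAvg]
  refine Finset.sum_bij' (fun k _ => ((i : ℤ) + k).toNat) (fun k _ => (k : ℤ) - i) ?_ ?_ ?_ ?_ ?_
  · intro k hk
    have := Finset.mem_Icc.1 hk
    simp only [Finset.mem_filter, Finset.mem_range]
    omega
  · intro k hk
    have := (Finset.mem_filter.1 hk).2
    simp only [Finset.mem_Icc]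
    omega
  · intro k hk
    have := Finset.mem_Icc.1 hk
    omega
  · intro k hk
    omega
  · intro k hk
    have := Finset.mem_Icc.1 hk
    have e : (((i : ℤ) + k).toNat : ℤ) - i = k := by omega
    rw [e]

/-- Away from both ends, the leave-one-out residuals are, in mean square, geometrically close to
copies of a stationary variable and to moving averages over finite windows. -/
theorem exists_bulk_coupling (h : ARNoise P μ₀ U ε) (φ : ℝ)
    (hU : ∀ (m : ℝ) (v : ℝ≥0), P.map (U 0) ≠ gaussianReal m v) :
    ∃ (G : Measure ℝ) (a b : ℤ → ℝ) (D ρ : ℝ) (m₀ : ℕ), 0 ≤ D ∧ 0 < ρ ∧ ρ < 1 ∧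
      ∀ (n : ℕ) (i : Fin n) (m : ℕ), m₀ ≤ m → m < i → i + m < n →
        ∃ X : Ω → ℝ, Measurable X ∧ MemLp X 2 P ∧ P.map X = G ∧ IndepFun X (ε i) P ∧
          (∀ v : ℝ≥0, P.map (fun ω => X ω + ε i ω) ≠ gaussianReal 0 v) ∧
          lpNorm (fun ω => obs φ μ₀ U ε i ω -
            kalmanLeaveOut P (stateVec φ μ₀ U n) (obsVec φ μ₀ U ε n) i ω - (X ω + ε i ω)) 2 P ≤
              D * n * ρ ^ m ∧
          lpNorm (fun ω => movingAvg a b U ε (fun k => ((i : ℤ) + k).toNat) m ω + ε i ω -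
            (X ω + ε i ω)) 2 P ≤ D * ρ ^ m := by
  have hτ := h.variance_U_pos hU
  have hd := h.variance_first_pos φ hτ
  obtain ⟨κ, ρ, C, α, β, hκ0, hκ1, hρ0, hρ1, hC, hα0, hβ0, hα, hβ, hg⟩ :=
    exists_stationary_weights φ hd hτ
  have hκ' : 0 < 1 - κ := by linarith
  set a : ℤ → ℝ := fun j => α j / (1 - κ) with hadef
  -- After division by `1 - g i` the residual contains `ε i` with coefficient exactly 1. It is kept
  -- apart as the noise, so the signal has no error of lag 0.
  set b : ℤ → ℝ := fun j => if j = 0 then 0 else -β j / (1 - κ) with hbdef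
  have ha : ∀ j, |a j| ≤ C / (1 - κ) * ρ ^ j.natAbs := by
    intro j
    simp only [hadef]
    rw [abs_div, abs_of_pos hκ', div_mul_eq_mul_div]
    gcongr
    exact hα j
  have hb : ∀ j, |b j| ≤ C / (1 - κ) * ρ ^ j.natAbs := by
    intro j
    simp only [hbdef]
    split_ifs
    · rw [abs_zero]; positivity
    · rw [abs_div, abs_neg, abs_of_pos hκ', div_mul_eq_mul_div]
      gcongr
      exact hβ j
  obtain ⟨G, D, hD, hG⟩ := h.exists_stationary_law (a := a) (b := b) (by positivity) hρ0 hρ1 ha hb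
    (by simp [hbdef]) (div_ne_zero hα0 hκ'.ne') hU
  -- For windows of length at least `m₀` the diagonal weight `g i` is within `w` of `κ`, hence `1 -
  -- g i ≥ w` and division by it is harmless.
  set w := (1 - κ) / 2 with hw
  have hw0 : 0 < w := by positivity
  obtain ⟨m₀, hm₀⟩ : ∃ m₀ : ℕ, 2 * C * ρ ^ m₀ ≤ w := by
    have h1 : Tendsto (fun m : ℕ => 2 * C * ρ ^ m) atTop (nhds (2 * C * 0)) :=
      (tendsto_pow_atTop_nhds_zero_of_lt_one hρ0.le hρ1).const_mul _
    rw [mul_zero] at h1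
    exact (h1.eventually_le_const hw0).exists
  set N := lpNorm (fun ω => innov φ (fun j => state φ μ₀ U j ω) 0) 2 P + lpNorm (U 0) 2 P + 1
    with hN
  set K := 2 * C / w + C * (2 * C) / w ^ 2 + C / (1 - κ) with hK
  have hK0 : 0 ≤ K := by positivity
  have hnn1 : (0 : ℝ) ≤ lpNorm (U 0) 2 P := lpNorm_nonneg
  have hnn2 : (0 : ℝ) ≤ lpNorm (fun ω => innov φ (fun j => state φ μ₀ U j ω) 0) 2 P :=
    lpNorm_nonneg
  have hN0 : 0 ≤ N := by positivity
  refine ⟨G, a, b, 2 * K * N + D, ρ, m₀, by positivity, hρ0, hρ1, fun n i m hm hmi hin => ?_⟩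
  obtain ⟨e, he, hee⟩ := exists_injective_extension hmi.le
  have hei : e 0 = i := by rw [hee 0 (by simp) (by simp)]; simp
  obtain ⟨X, hXm, hX2, hXG, hXε, hXlim, hXG'⟩ := hG e he
  rw [hei] at hXε hXG'
  have hwin : ∀ ω, movingAvg a b U ε e m ω =
      movingAvg a b U ε (fun k => ((i : ℤ) + k).toNat) m ω := fun ω => movingAvg_congr hee ω
  have hwinX : lpNorm (fun ω => movingAvg a b U ε (fun k => ((i : ℤ) + k).toNat) m ω + ε i ω -
      (X ω + ε i ω)) 2 P ≤ D * ρ ^ m := by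
    refine le_trans (le_of_eq ?_) (hXlim m)
    congr 1
    funext ω
    rw [hwin]
    ring
  have hρm : 0 < ρ ^ m := pow_pos hρ0 m
  have hn1 : (1 : ℝ) ≤ n := by
    have : 1 ≤ n := by omega
    exact_mod_cast this
  refine ⟨X, hXm, hX2, hXG, hXε, hXG', ?_, hwinX.trans ?_⟩
  swap
  · gcongr
    nlinarith [mul_nonneg hK0 hN0]
  obtain ⟨g, hgs, hgb⟩ := hg n i i.2
  set δ := 2 * C * ρ ^ m with hδ
  have hE : C * (ρ ^ (i : ℕ) + ρ ^ (n - 1 - i)) ≤ δ := by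
    have h1 : ρ ^ (i : ℕ) ≤ ρ ^ m := pow_le_pow_of_le_one hρ0.le hρ1.le hmi.le
    have h2 : ρ ^ (n - 1 - i) ≤ ρ ^ m := pow_le_pow_of_le_one hρ0.le hρ1.le (by omega)
    calc _ ≤ C * (ρ ^ m + ρ ^ m) := by gcongr
      _ = δ := by rw [hδ]; ring
  have hgi : |g i - κ| ≤ δ := by
    have := ((hgb i i.2).2).trans hE
    rwa [sub_self, hβ0] at this
  have hδw : δ ≤ w := by
    refine le_trans ?_ hm₀
    rw [hδ]
    gcongr 2 * C * ?_
    exact pow_le_pow_of_le_one hρ0.le hρ1.le hm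
  have hwg : w ≤ 1 - g i := by
    have := (abs_le.1 hgi).2
    rw [hw] at hδw ⊢
    linarith
  have hwκ : w ≤ 1 - κ := by rw [hw]; linarith
  have hgne : g i ≠ 1 := fun h1 => by rw [h1] at hwg; linarith
  have h1g : 0 < 1 - g i := hw0.trans_le hwg
  have hCj : ∀ j : ℤ, C * ρ ^ j.natAbs ≤ C := fun j =>
    mul_le_of_le_one_right hC (pow_le_one₀ hρ0.le hρ1.le)
  have hδK : δ / w + C * δ / w ^ 2 = (2 * C / w + C * (2 * C) / w ^ 2) * ρ ^ m := by
    rw [hδ]; ring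
  -- coefficients of the residual
  set d := innovVar (∫ ω, (φ * μ₀ ω + U 0 ω) ^ 2 ∂P) (∫ ω, U 0 ω ^ 2 ∂P)
  let A : ℕ → ℝ := fun k => innov φ g k / d k / (1 - g i)
  let B : ℕ → ℝ := fun k => if k = i then 0 else -g k / (1 - g i)
  let a' : ℕ → ℝ := fun k => if ((k : ℤ) - i).natAbs ≤ m then a ((k : ℤ) - i) else 0
  let b' : ℕ → ℝ := fun k => if ((k : ℤ) - i).natAbs ≤ m then b ((k : ℤ) - i) else 0
  have hfar : ∀ j : ℤ, ¬ j.natAbs ≤ m → C / (1 - κ) * ρ ^ j.natAbs ≤ C / (1 - κ) * ρ ^ m := by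
    intro j hj
    gcongr C / (1 - κ) * ?_
    exact pow_le_pow_of_le_one hρ0.le hρ1.le (by omega)
  have hC1 : 0 ≤ C / (1 - κ) * ρ ^ m := by positivity
  have hA : ∀ k < n, |A k - a' k| ≤ K * ρ ^ m := by
    intro k hk
    have h1 := abs_div_sub_div_le (((hgb k hk).1).trans hE) hgi ((hα _).trans (hCj _)) hw0 hwg hwκ
    rw [hδK] at h1
    simp only [A, a']
    split_ifs with hkm
    · refine h1.trans ?_
      rw [hK]; linarith
    · have h2 := (ha ((k : ℤ) - i)).trans (hfar _ hkm)
      rw [sub_zero]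
      have h3 := abs_add_le (innov φ g k / d k / (1 - g i) - a ((k : ℤ) - i)) (a ((k : ℤ) - i))
      rw [sub_add_cancel] at h3
      rw [hK, add_mul]
      exact h3.trans (add_le_add h1 h2)
  have hB : ∀ k < n, |B k - b' k| ≤ K * ρ ^ m := by
    intro k hk
    by_cases hki : k = i
    · have : B k - b' k = 0 := by simp [B, b', hki, hbdef]
      rw [this, abs_zero]
      positivity
    have h1 := abs_div_sub_div_le (((hgb k hk).2).trans hE) hgi ((hβ _).trans (hCj _)) hw0 hwg hwκ
    rw [hδK] at h1
    have hkz : ((k : ℤ) - i) ≠ 0 := by omega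
    have e1 : ∀ j : ℤ, j ≠ 0 → b j = -(β j / (1 - κ)) := fun j hj => by
      simp only [hbdef, if_neg hj]; ring
    have e2 : B k = -(g k / (1 - g i)) := by simp only [B, if_neg hki]; ring
    simp only [b', e2]
    split_ifs with hkm
    · rw [e1 _ hkz, ← neg_sub', abs_neg]
      refine h1.trans ?_
      rw [hK]; linarith
    · have h2 := (hb ((k : ℤ) - i)).trans (hfar _ hkm)
      rw [e1 _ hkz, abs_neg] at h2
      rw [sub_zero, abs_neg]
      have h3 := abs_add_le (g k / (1 - g i) - β ((k : ℤ) - i) / (1 - κ))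
        (β ((k : ℤ) - i) / (1 - κ))
      rw [sub_add_cancel] at h3
      rw [hK, add_mul]
      exact h3.trans (add_le_add h1 h2)
  have hu : ∀ k, lpNorm (fun ω => innov φ (fun j => state φ μ₀ U j ω) k) 2 P ≤ N := by
    intro k
    cases k with
    | zero => rw [hN]; linarith
    | succ k =>
      simp only [innov_state_succ]
      change lpNorm (U (k + 1)) 2 P ≤ N
      rw [h.lpNorm_U, hN]; linarith
  have hterm2 : ∀ k, MemLp (fun ω => (A k - a' k) * innov φ (fun j => state φ μ₀ U j ω) k +
      (B k - b' k) * ε k ω) 2 P := fun k =>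
    ((h.memLp_innov φ k).const_mul _).add ((h.memLp_ε k).const_mul _)
  have hdiff : lpNorm (fun ω => obs φ μ₀ U ε i ω -
      kalmanLeaveOut P (stateVec φ μ₀ U n) (obsVec φ μ₀ U ε n) i ω -
      (movingAvg a b U ε (fun k => ((i : ℤ) + k).toNat) m ω + ε i ω)) 2 P ≤
      2 * K * N * n * ρ ^ m := by
    have e1 : (fun ω => obs φ μ₀ U ε i ω -
        kalmanLeaveOut P (stateVec φ μ₀ U n) (obsVec φ μ₀ U ε n) i ω -
        (movingAvg a b U ε (fun k => ((i : ℤ) + k).toNat) m ω + ε i ω)) =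
        fun ω => ∑ k ∈ Finset.range n, ((A k - a' k) * innov φ (fun j => state φ μ₀ U j ω) k +
          (B k - b' k) * ε k ω) := by
      funext ω
      rw [h.leaveOut_residual_eq hτ i hgs hgne, movingAvg_eq_sum_range (μ₀ := μ₀) hmi hin φ]
      have e2 : ∑ k ∈ Finset.range n, B k * ε k ω =
          (ε i ω - ∑ k ∈ Finset.range n, g k * ε k ω) / (1 - g i) - ε i ω := by
        have hir : (i : ℕ) ∈ Finset.range n := Finset.mem_range.2 i.2
        rw [← Finset.add_sum_erase _ _ hir, ← Finset.add_sum_erase _ (fun k => g k * ε k ω) hir]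
        have e3 : ∑ k ∈ (Finset.range n).erase i, B k * ε k ω =
            -(∑ k ∈ (Finset.range n).erase i, g k * ε k ω) / (1 - g i) := by
          rw [← Finset.sum_neg_distrib, Finset.sum_div]
          refine Finset.sum_congr rfl fun k hk => ?_
          simp only [B, if_neg (Finset.ne_of_mem_erase hk)]
          ring
        rw [e3]
        simp only [B, if_true]
        field_simp
        ring
      have e4 : ∑ k ∈ Finset.range n, A k * innov φ (fun j => state φ μ₀ U j ω) k =
          (∑ k ∈ Finset.range n, innov φ g k / d k * innov φ (fun j => state φ μ₀ U j ω) k) /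
            (1 - g i) := by
        rw [Finset.sum_div]
        refine Finset.sum_congr rfl fun k hk => ?_
        simp only [A]
        ring
      simp only [sub_mul, Finset.sum_add_distrib, Finset.sum_sub_distrib]
      rw [e2, e4, add_div]
      simp only [a', b']
      ring
    rw [e1]
    -- The triangle inequality over all `n` coefficients costs a factor `n`, which the geometric
    -- factor `ρ ^ m` absorbs later.
    refine (lpNorm_fun_sum_le _ fun k _ => hterm2 k).trans ?_
    have hk : ∀ k ∈ Finset.range n, lpNorm (fun ω => (A k - a' k) *
        innov φ (fun j => state φ μ₀ U j ω) k + (B k - b' k) * ε k ω) 2 P ≤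
        2 * K * N * ρ ^ m := by
      intro k hk
      have hk := Finset.mem_range.1 hk
      refine (lpNorm_add_le ((h.memLp_innov φ k).const_mul _) (by norm_num)
        (g := fun ω => (B k - b' k) * ε k ω)).trans ?_
      rw [lpNorm_const_mul_eq, lpNorm_const_mul_eq, h.lpNorm_ε]
      have hN1 : 1 ≤ N := by rw [hN]; linarith
      calc _ ≤ K * ρ ^ m * N + K * ρ ^ m * N := by
            gcongr
            · exact lpNorm_nonneg
            · exact hA k hk
            · exact hu k
            · exact hB k hk
        _ = _ := by ring
    refine (Finset.sum_le_sum hk).trans (le_of_eq ?_)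
    rw [Finset.sum_const, Finset.card_range, nsmul_eq_mul]
    ring
  have hZ2 : MemLp (fun ω => obs φ μ₀ U ε i ω -
      kalmanLeaveOut P (stateVec φ μ₀ U n) (obsVec φ μ₀ U ε n) i ω) 2 P :=
    (h.memLp_obs φ i).sub (h.memLp_leaveOut φ i)
  have hM2 : MemLp (fun ω => movingAvg a b U ε (fun k => ((i : ℤ) + k).toNat) m ω + ε i ω) 2 P :=
    (h.memLp_movingAvg a b _ m).add (h.memLp_ε i)
  have hsum := lpNorm_add_le (hZ2.sub hM2) (by norm_num)
    (g := fun ω => movingAvg a b U ε (fun k => ((i : ℤ) + k).toNat) m ω + ε i ω -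
      (X ω + ε i ω))
  have e5 : ((fun ω => obs φ μ₀ U ε i ω -
      kalmanLeaveOut P (stateVec φ μ₀ U n) (obsVec φ μ₀ U ε n) i ω) -
      (fun ω => movingAvg a b U ε (fun k => ((i : ℤ) + k).toNat) m ω + ε i ω)) +
      (fun ω => movingAvg a b U ε (fun k => ((i : ℤ) + k).toNat) m ω + ε i ω - (X ω + ε i ω)) =
      fun ω => obs φ μ₀ U ε i ω -
        kalmanLeaveOut P (stateVec φ μ₀ U n) (obsVec φ μ₀ U ε n) i ω - (X ω + ε i ω) := by
    funext ω
    simp only [Pi.add_apply, Pi.sub_apply]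
    ring
  rw [e5] at hsum
  refine hsum.trans ((add_le_add hdiff hwinX).trans ?_)
  have : D * ρ ^ m ≤ D * ρ ^ m * n := le_mul_of_one_le_right (by positivity) hn1
  calc _ ≤ 2 * K * N * n * ρ ^ m + D * ρ ^ m * n := by gcongr
    _ = _ := by ring

end ARNoise

/-! ### The logistic kernel and its rescalings -/

namespace EBKalman

theorem kernel_eq (x : ℝ) : kernel x = 1 / (2 * Real.cosh x ^ 2) := by
  rw [kernel, Real.cosh_eq]
  have := Real.exp_pos x
  have := Real.exp_pos (-x)
  field_simp

/-- The derivative of the kernel. -/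
noncomputable def kernelDeriv (x : ℝ) : ℝ := -Real.sinh x / Real.cosh x ^ 3

theorem kernel_pos (x : ℝ) : 0 < kernel x := by
  rw [kernel_eq]
  have := Real.cosh_pos x
  positivity

theorem kernel_le_half (x : ℝ) : kernel x ≤ 1 / 2 := by
  rw [kernel_eq]
  have := Real.one_le_cosh x
  rw [div_le_div_iff₀ (by positivity) (by norm_num)]
  nlinarith

theorem kernel_neg (x : ℝ) : kernel (-x) = kernel x := by
  rw [kernel_eq, kernel_eq, Real.cosh_neg]

theorem kernel_le_kernel {x y : ℝ} (h : |y| ≤ |x|) : kernel x ≤ kernel y := by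
  rw [kernel_eq, kernel_eq]
  have h1 := Real.cosh_le_cosh.2 h
  have h2 := Real.cosh_pos y
  gcongr

theorem abs_sinh_le_cosh (x : ℝ) : |Real.sinh x| ≤ Real.cosh x := by
  refine abs_le_of_sq_le_sq ?_ (Real.cosh_pos x).le
  rw [Real.cosh_sq]
  linarith

theorem hasDerivAt_kernel (x : ℝ) : HasDerivAt kernel (kernelDeriv x) x := by
  have h1 : kernel = fun x => 1 / (2 * Real.cosh x ^ 2) := funext kernel_eq
  have h2 := Real.cosh_pos x
  rw [h1]
  have h3 := (((Real.hasDerivAt_cosh x).pow 2).const_mul 2).fun_inv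
    (by simp only [Pi.pow_apply]; positivity)
  simp only [one_div]
  refine h3.congr_deriv ?_
  rw [kernelDeriv]
  simp only [Pi.pow_apply]
  field_simp
  ring

/-- The logarithmic derivative of the kernel is `-2 tanh`. This domination of the derivative by the
kernel is the property of the logistic kernel on which all bounds for the estimated score rest. -/
theorem abs_kernelDeriv_le (x : ℝ) : |kernelDeriv x| ≤ 2 * kernel x := by
  rw [kernelDeriv, kernel_eq, abs_div, abs_neg]
  have h2 := Real.cosh_pos x
  rw [abs_of_pos (pow_pos h2 3)]
  have h3 := abs_sinh_le_cosh x
  calc _ ≤ Real.cosh x / Real.cosh x ^ 3 := by gcongr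
    _ = _ := by field_simp

/-- The second derivative of the kernel. -/
noncomputable def kernelDeriv2 (x : ℝ) : ℝ :=
  -1 / Real.cosh x ^ 2 + 3 * Real.sinh x ^ 2 / Real.cosh x ^ 4

theorem hasDerivAt_kernelDeriv (x : ℝ) : HasDerivAt kernelDeriv (kernelDeriv2 x) x := by
  have h2 := Real.cosh_pos x
  have h3 := (Real.hasDerivAt_sinh x).neg.div ((Real.hasDerivAt_cosh x).pow 3)
    (by simp only [Pi.pow_apply]; positivity)
  refine h3.congr_deriv ?_
  rw [kernelDeriv2]
  simp only [Pi.pow_apply, Pi.neg_apply]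
  field_simp
  ring

theorem abs_kernelDeriv2_le (x : ℝ) : |kernelDeriv2 x| ≤ 4 * kernel x := by
  have h2 := Real.cosh_pos x
  have h3 : Real.sinh x ^ 2 = Real.cosh x ^ 2 - 1 := by rw [Real.cosh_sq]; ring
  have h4 := Real.one_le_cosh x
  have e : kernelDeriv2 x = (2 * Real.cosh x ^ 2 - 3) / Real.cosh x ^ 4 := by
    rw [kernelDeriv2, h3]
    field_simp
    ring
  have e2 : 4 * kernel x = 2 * Real.cosh x ^ 2 / Real.cosh x ^ 4 := by
    rw [kernel_eq]
    field_simp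
    ring
  rw [e, e2, abs_div, abs_of_pos (pow_pos h2 4)]
  gcongr
  rw [abs_le]
  constructor <;> nlinarith

theorem continuous_kernel : Continuous kernel :=
  continuous_iff_continuousAt.2 fun x => (hasDerivAt_kernel x).continuousAt

theorem integrable_kernel : Integrable kernel := by
  refine integrable_inv_one_add_sq.mono' continuous_kernel.aestronglyMeasurable
    (ae_of_all _ fun x => ?_)
  rw [Real.norm_eq_abs, abs_of_pos (kernel_pos x), kernel_eq, ← one_div]
  have h1 : x ^ 2 ≤ Real.sinh x ^ 2 := by
    rw [sq_le_sq, Real.abs_sinh]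
    exact Real.self_le_sinh_iff.2 (abs_nonneg x)
  have : 1 + x ^ 2 ≤ 2 * Real.cosh x ^ 2 := by
    rw [Real.cosh_sq]
    nlinarith [sq_nonneg x]
  gcongr

/-- The kernel with bandwidth `σ`. -/
noncomputable def scaledKernel (σ y : ℝ) : ℝ := σ⁻¹ * kernel (y / σ)

/-- The derivative of the kernel with bandwidth `σ`. -/
noncomputable def scaledKernelDeriv (σ y : ℝ) : ℝ := σ⁻¹ * (σ⁻¹ * kernelDeriv (y / σ))

/-- The second derivative of the kernel with bandwidth `σ`. -/
noncomputable def scaledKernelDeriv2 (σ y : ℝ) : ℝ := σ⁻¹ * (σ⁻¹ * (σ⁻¹ * kernelDeriv2 (y / σ)))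

section

variable {σ : ℝ}

theorem hasDerivAt_scaledKernel (σ y : ℝ) :
    HasDerivAt (scaledKernel σ) (scaledKernelDeriv σ y) y := by
  have h := ((hasDerivAt_kernel (y / σ)).comp y ((hasDerivAt_id y).div_const σ)).const_mul σ⁻¹
  refine h.congr_deriv ?_
  rw [scaledKernelDeriv]; ring

theorem hasDerivAt_scaledKernelDeriv (σ y : ℝ) :
    HasDerivAt (scaledKernelDeriv σ) (scaledKernelDeriv2 σ y) y := by
  have h := (((hasDerivAt_kernelDeriv (y / σ)).comp y
    ((hasDerivAt_id y).div_const σ)).const_mul σ⁻¹).const_mul σ⁻¹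
  refine h.congr_deriv ?_
  rw [scaledKernelDeriv2]; ring

theorem continuous_scaledKernel (σ : ℝ) : Continuous (scaledKernel σ) :=
  continuous_iff_continuousAt.2 fun x => (hasDerivAt_scaledKernel σ x).continuousAt

theorem continuous_scaledKernelDeriv (σ : ℝ) : Continuous (scaledKernelDeriv σ) :=
  continuous_iff_continuousAt.2 fun x => (hasDerivAt_scaledKernelDeriv σ x).continuousAt

theorem scaledKernel_pos (hσ : 0 < σ) (y : ℝ) : 0 < scaledKernel σ y :=
  mul_pos (inv_pos.2 hσ) (kernel_pos _)

theorem scaledKernel_le (hσ : 0 < σ) (y : ℝ) : scaledKernel σ y ≤ σ⁻¹ := by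
  have := kernel_le_half (y / σ)
  exact mul_le_of_le_one_right (inv_pos.2 hσ).le (by linarith)

theorem abs_scaledKernelDeriv_le (hσ : 0 < σ) (y : ℝ) :
    |scaledKernelDeriv σ y| ≤ 2 * σ⁻¹ * scaledKernel σ y := by
  have h := abs_kernelDeriv_le (y / σ)
  have hi := inv_pos.2 hσ
  rw [scaledKernelDeriv, scaledKernel, abs_mul, abs_mul, abs_of_pos hi]
  calc _ ≤ σ⁻¹ * (σ⁻¹ * (2 * kernel (y / σ))) := by gcongr
    _ = _ := by ring

theorem abs_scaledKernelDeriv2_le (hσ : 0 < σ) (y : ℝ) :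
    |scaledKernelDeriv2 σ y| ≤ 4 * σ⁻¹ ^ 2 * scaledKernel σ y := by
  have h := abs_kernelDeriv2_le (y / σ)
  have hi := inv_pos.2 hσ
  rw [scaledKernelDeriv2, scaledKernel, abs_mul, abs_mul, abs_mul, abs_of_pos hi]
  calc _ ≤ σ⁻¹ * (σ⁻¹ * (σ⁻¹ * (4 * kernel (y / σ)))) := by gcongr
    _ = _ := by ring

theorem abs_scaledKernelDeriv_le' (hσ : 0 < σ) (y : ℝ) :
    |scaledKernelDeriv σ y| ≤ 2 * σ⁻¹ ^ 2 := by
  refine (abs_scaledKernelDeriv_le hσ y).trans ?_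
  have := scaledKernel_le hσ y
  have hi := inv_pos.2 hσ
  nlinarith

theorem abs_scaledKernelDeriv2_le' (hσ : 0 < σ) (y : ℝ) :
    |scaledKernelDeriv2 σ y| ≤ 4 * σ⁻¹ ^ 3 := by
  refine (abs_scaledKernelDeriv2_le hσ y).trans ?_
  have := scaledKernel_le hσ y
  have hi := inv_pos.2 hσ
  calc 4 * σ⁻¹ ^ 2 * scaledKernel σ y ≤ 4 * σ⁻¹ ^ 2 * σ⁻¹ := by gcongr
    _ = _ := by ring

theorem abs_sub_le_of_hasDerivAt {f f' : ℝ → ℝ} {L : ℝ} (h : ∀ x, HasDerivAt f (f' x) x)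
    (hL : ∀ x, |f' x| ≤ L) (x y : ℝ) : |f x - f y| ≤ L * |x - y| := by
  have := Convex.norm_image_sub_le_of_norm_hasDerivWithin_le (f := f) (f' := f') (s := Set.univ)
    (fun x _ => (h x).hasDerivWithinAt) (fun x _ => hL x) convex_univ (Set.mem_univ y)
    (Set.mem_univ x)
  simpa using this

theorem abs_scaledKernel_sub_le (hσ : 0 < σ) (x y : ℝ) :
    |scaledKernel σ x - scaledKernel σ y| ≤ 2 * σ⁻¹ ^ 2 * |x - y| :=
  abs_sub_le_of_hasDerivAt (hasDerivAt_scaledKernel σ) (abs_scaledKernelDeriv_le' hσ) x y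

theorem abs_scaledKernelDeriv_sub_le (hσ : 0 < σ) (x y : ℝ) :
    |scaledKernelDeriv σ x - scaledKernelDeriv σ y| ≤ 4 * σ⁻¹ ^ 3 * |x - y| :=
  abs_sub_le_of_hasDerivAt (hasDerivAt_scaledKernelDeriv σ) (abs_scaledKernelDeriv2_le' hσ) x y

theorem scaledKernel_le_scaledKernel (hσ : 0 < σ) {x y : ℝ} (h : |y| ≤ |x|) :
    scaledKernel σ x ≤ scaledKernel σ y := by
  have hi := inv_pos.2 hσ
  rw [scaledKernel, scaledKernel]
  gcongr
  refine kernel_le_kernel ?_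
  rw [abs_div, abs_div]
  gcongr

/-- Integrals against the scaled kernel, rescaled. -/
theorem integral_mul_scaledKernel (hσ : 0 < σ) (g : ℝ → ℝ) (z : ℝ) :
    ∫ y, g y * scaledKernel σ (y - z) = ∫ w, kernel w * g (z + σ * w) := by
  have h1 : ∫ y, g y * scaledKernel σ (y - z) = ∫ y, g (z + y) * scaledKernel σ y := by
    rw [← integral_add_right_eq_self (fun y => g y * scaledKernel σ (y - z)) z]
    congr 1
    funext y
    rw [add_sub_cancel_right, add_comm]
  have h2 := Measure.integral_comp_mul_left (fun y => g (z + y) * scaledKernel σ y) σ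
  rw [abs_of_pos (inv_pos.2 hσ), smul_eq_mul] at h2
  have h3 : ∫ y, g (z + y) * scaledKernel σ y =
      σ * ∫ x, g (z + σ * x) * scaledKernel σ (σ * x) := by
    rw [h2]; field_simp
  rw [h1, h3, ← integral_const_mul]
  congr 1
  funext w
  rw [scaledKernel, mul_div_cancel_left₀ _ hσ.ne']
  field_simp

theorem integrable_scaledKernel (hσ : 0 < σ) (z : ℝ) :
    Integrable fun y => scaledKernel σ (y - z) := by
  have h1 : Integrable (scaledKernel σ) :=
    (integrable_kernel.comp_div hσ.ne').const_mul σ⁻¹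
  exact h1.comp_sub_right z

theorem integrable_scaledKernelDeriv (hσ : 0 < σ) (z : ℝ) :
    Integrable fun y => scaledKernelDeriv σ (y - z) := by
  refine ((integrable_scaledKernel hσ z).const_mul (2 * σ⁻¹)).mono'
    ((continuous_scaledKernelDeriv σ).comp (by fun_prop)).aestronglyMeasurable
    (ae_of_all _ fun y => abs_scaledKernelDeriv_le hσ _)

end

/-! ### The estimated score -/

section Score

variable {σ : ℝ} {n : ℕ}

theorem densityEst_eq (σ : ℝ) (z : Fin n → ℝ) (x : ℝ) :
    densityEst σ z x = (n : ℝ)⁻¹ * ∑ j, scaledKernel σ (z j - x) := by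
  simp [densityEst, scaledKernel]

/-- The derivative of the density estimate. -/
noncomputable def densityEstDeriv (σ : ℝ) (z : Fin n → ℝ) (x : ℝ) : ℝ :=
  (n : ℝ)⁻¹ * ∑ j, -scaledKernelDeriv σ (z j - x)

theorem hasDerivAt_densityEst (σ : ℝ) (z : Fin n → ℝ) (x : ℝ) :
    HasDerivAt (densityEst σ z) (densityEstDeriv σ z x) x := by
  have e : densityEst σ z = fun x => (n : ℝ)⁻¹ * ∑ j, scaledKernel σ (z j - x) :=
    funext (densityEst_eq σ z)
  rw [e]
  refine HasDerivAt.const_mul _ (HasDerivAt.fun_sum fun j _ => ?_)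
  have := (hasDerivAt_scaledKernel σ (z j - x)).comp x ((hasDerivAt_id x).const_sub (z j))
  refine this.congr_deriv ?_
  ring

theorem hasDerivAt_densityEstDeriv (σ : ℝ) (z : Fin n → ℝ) (x : ℝ) :
    HasDerivAt (densityEstDeriv σ z) ((n : ℝ)⁻¹ * ∑ j, scaledKernelDeriv2 σ (z j - x)) x := by
  refine HasDerivAt.const_mul _ (HasDerivAt.fun_sum fun j _ => ?_)
  have := ((hasDerivAt_scaledKernelDeriv σ (z j - x)).comp x
    ((hasDerivAt_id x).const_sub (z j))).neg
  refine this.congr_deriv ?_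
  ring

/-- The estimated score `f̂' / f̂`. -/
noncomputable def scoreEst (σ : ℝ) (z : Fin n → ℝ) (x : ℝ) : ℝ :=
  densityEstDeriv σ z x / densityEst σ z x

theorem deltaHat_eq (σ : ℝ) (z : Fin n → ℝ) (x : ℝ) : deltaHat σ z x = x + scoreEst σ z x := by
  rw [deltaHat, scoreEst, (hasDerivAt_densityEst σ z x).deriv]

theorem densityEst_nonneg (hσ : 0 < σ) (z : Fin n → ℝ) (x : ℝ) : 0 ≤ densityEst σ z x := by
  rw [densityEst_eq]
  exact mul_nonneg (by positivity) (Finset.sum_nonneg fun j _ => (scaledKernel_pos hσ _).le)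

theorem densityEst_pos (hσ : 0 < σ) (hn : 0 < n) (z : Fin n → ℝ) (x : ℝ) :
    0 < densityEst σ z x := by
  rw [densityEst_eq]
  have : Nonempty (Fin n) := ⟨⟨0, hn⟩⟩
  have h1 : 0 < ∑ j, scaledKernel σ (z j - x) :=
    Finset.sum_pos (fun j _ => scaledKernel_pos hσ _) Finset.univ_nonempty
  positivity

theorem abs_densityEstDeriv_le (hσ : 0 < σ) (z : Fin n → ℝ) (x : ℝ) :
    |densityEstDeriv σ z x| ≤ 2 * σ⁻¹ * densityEst σ z x := by
  rw [densityEstDeriv, densityEst_eq, abs_mul, abs_of_nonneg (by positivity : (0 : ℝ) ≤ (n : ℝ)⁻¹)]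
  have h1 : |∑ j, -scaledKernelDeriv σ (z j - x)| ≤ 2 * σ⁻¹ * ∑ j, scaledKernel σ (z j - x) := by
    rw [Finset.mul_sum]
    refine (Finset.abs_sum_le_sum_abs _ _).trans (Finset.sum_le_sum fun j _ => ?_)
    rw [abs_neg]
    exact abs_scaledKernelDeriv_le hσ _
  calc _ ≤ (n : ℝ)⁻¹ * (2 * σ⁻¹ * ∑ j, scaledKernel σ (z j - x)) := by gcongr
    _ = _ := by ring

/-- The domination of `K'` by `K` survives averaging, so the bound is deterministic and no
truncation of the ratio is needed. -/
theorem abs_scoreEst_le (hσ : 0 < σ) (z : Fin n → ℝ) (x : ℝ) : |scoreEst σ z x| ≤ 2 * σ⁻¹ := by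
  rw [scoreEst, abs_div, abs_of_nonneg (densityEst_nonneg hσ z x)]
  exact div_le_of_le_mul₀ (densityEst_nonneg hσ z x) (by positivity)
    (abs_densityEstDeriv_le hσ z x)

/-- The derivative of the score is `f'' / f - (f' / f) ^ 2`, and each term is at most `4 σ⁻¹ ^ 2`.
This allows the argument `Z i` to be replaced by its coupled copy with the sample kept fixed. -/
theorem abs_scoreEst_sub_le (hσ : 0 < σ) (hn : 0 < n) (z : Fin n → ℝ) (x y : ℝ) :
    |scoreEst σ z x - scoreEst σ z y| ≤ 8 * σ⁻¹ ^ 2 * |x - y| := by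
  have hd := fun x => (hasDerivAt_densityEstDeriv σ z x).div (hasDerivAt_densityEst σ z x)
    (densityEst_pos hσ hn z x).ne'
  refine abs_sub_le_of_hasDerivAt (f := scoreEst σ z) hd (fun x => ?_) x y
  set f := densityEst σ z x
  set f1 := densityEstDeriv σ z x
  set f2 := (n : ℝ)⁻¹ * ∑ j, scaledKernelDeriv2 σ (z j - x) with hf2
  have hf : 0 < f := densityEst_pos hσ hn z x
  have h1 : |f1| ≤ 2 * σ⁻¹ * f := abs_densityEstDeriv_le hσ z x
  have h2 : |f2| ≤ 4 * σ⁻¹ ^ 2 * f := by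
    rw [hf2, abs_mul, abs_of_nonneg (by positivity : (0 : ℝ) ≤ (n : ℝ)⁻¹)]
    have h1 : |∑ j, scaledKernelDeriv2 σ (z j - x)| ≤
        4 * σ⁻¹ ^ 2 * ∑ j, scaledKernel σ (z j - x) := by
      rw [Finset.mul_sum]
      refine (Finset.abs_sum_le_sum_abs _ _).trans (Finset.sum_le_sum fun j _ => ?_)
      exact abs_scaledKernelDeriv2_le hσ _
    have e : f = (n : ℝ)⁻¹ * ∑ j, scaledKernel σ (z j - x) := densityEst_eq σ z x
    calc _ ≤ (n : ℝ)⁻¹ * (4 * σ⁻¹ ^ 2 * ∑ j, scaledKernel σ (z j - x)) := by gcongr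
      _ = _ := by rw [e]; ring
  rw [abs_div, abs_of_pos (pow_pos hf 2), div_le_iff₀ (pow_pos hf 2)]
  have h3 : |f1| * |f1| ≤ (2 * σ⁻¹ * f) * (2 * σ⁻¹ * f) :=
    mul_le_mul h1 h1 (abs_nonneg _) ((abs_nonneg _).trans h1)
  calc |f2 * f - f1 * f1| ≤ |f2| * |f| + |f1| * |f1| := by
        rw [← abs_mul, ← abs_mul]; exact abs_sub _ _
    _ ≤ 4 * σ⁻¹ ^ 2 * f * f + (2 * σ⁻¹ * f) * (2 * σ⁻¹ * f) := by
        rw [abs_of_pos hf]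
        gcongr
    _ = 8 * σ⁻¹ ^ 2 * f ^ 2 := by ring

end Score

end EBKalman

/-! ### The standard normal density -/

namespace EBKalman

theorem gaussianPDFReal_std (t : ℝ) :
    gaussianPDFReal 0 1 t = (√(2 * Real.pi))⁻¹ * Real.exp (-t ^ 2 / 2) := by
  simp [gaussianPDFReal]

theorem inv_sqrt_two_pi_pos : 0 < (√(2 * Real.pi))⁻¹ := by
  have := Real.pi_pos
  positivity

theorem inv_sqrt_two_pi_le_one : (√(2 * Real.pi))⁻¹ ≤ 1 := by
  refine inv_le_one_of_one_le₀ ?_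
  rw [Real.one_le_sqrt]
  linarith [Real.pi_gt_three]

theorem hasDerivAt_gaussianPDFReal_std (t : ℝ) :
    HasDerivAt (gaussianPDFReal 0 1) (-t * gaussianPDFReal 0 1 t) t := by
  have e : gaussianPDFReal 0 1 = fun t => (√(2 * Real.pi))⁻¹ * Real.exp (-t ^ 2 / 2) :=
    funext gaussianPDFReal_std
  have h1 : HasDerivAt (fun t : ℝ => -t ^ 2 / 2) (-t) t := by
    have := ((hasDerivAt_pow 2 t).neg).div_const 2
    refine this.congr_deriv ?_
    simp; ring
  have h2 := h1.exp.const_mul (√(2 * Real.pi))⁻¹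
  rw [gaussianPDFReal_std, e]
  refine h2.congr_deriv ?_
  ring

theorem continuous_gaussianPDFReal_std : Continuous (gaussianPDFReal 0 1) :=
  continuous_iff_continuousAt.2 fun x => (hasDerivAt_gaussianPDFReal_std x).continuousAt

theorem gaussianPDFReal_std_le_one (t : ℝ) : gaussianPDFReal 0 1 t ≤ 1 := by
  rw [gaussianPDFReal_std]
  have h : Real.exp (-t ^ 2 / 2) ≤ 1 := Real.exp_le_one_iff.2 (by nlinarith [sq_nonneg t])
  exact mul_le_one₀ inv_sqrt_two_pi_le_one (Real.exp_pos _).le h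

theorem gaussianPDFReal_std_pos (t : ℝ) : 0 < gaussianPDFReal 0 1 t :=
  gaussianPDFReal_pos _ _ _ one_ne_zero

theorem abs_mul_gaussianPDFReal_std_le_one (t : ℝ) : |-t * gaussianPDFReal 0 1 t| ≤ 1 := by
  have h2 : |t| ≤ Real.exp (t ^ 2 / 2) := by
    have := Real.add_one_le_exp (t ^ 2 / 2)
    nlinarith [sq_nonneg (|t| - 1), sq_abs t]
  have h1 : |t| * Real.exp (-t ^ 2 / 2) ≤ 1 := by
    rw [neg_div, Real.exp_neg, ← div_eq_mul_inv]
    exact div_le_one_of_le₀ h2 (Real.exp_pos _).le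
  rw [abs_mul, abs_neg, abs_of_pos (gaussianPDFReal_std_pos t), gaussianPDFReal_std]
  calc |t| * ((√(2 * Real.pi))⁻¹ * Real.exp (-t ^ 2 / 2))
      = (√(2 * Real.pi))⁻¹ * (|t| * Real.exp (-t ^ 2 / 2)) := by ring
    _ ≤ 1 := mul_le_one₀ inv_sqrt_two_pi_le_one (by positivity) h1

theorem gaussianPDFReal_std_le {x y : ℝ} (h : |y| ≤ |x|) :
    gaussianPDFReal 0 1 x ≤ gaussianPDFReal 0 1 y := by
  rw [gaussianPDFReal_std, gaussianPDFReal_std]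
  have := sq_le_sq.2 h
  have := inv_sqrt_two_pi_pos
  gcongr

/-- The average of the values of the density at `u + t` and `u - t`. -/
theorem two_mul_gaussianPDFReal_std_le (u t : ℝ) :
    2 * (Real.exp (-t ^ 2 / 2) * gaussianPDFReal 0 1 u) ≤
      gaussianPDFReal 0 1 (u + t) + gaussianPDFReal 0 1 (u - t) := by
  simp only [gaussianPDFReal_std]
  have e : ∀ s : ℝ, Real.exp (-(u + s) ^ 2 / 2) =
      Real.exp (-s ^ 2 / 2) * Real.exp (-u ^ 2 / 2) * Real.exp (-(u * s)) := by
    intro s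
    rw [← Real.exp_add, ← Real.exp_add]
    ring_nf
  have e1 := e t
  have e2 := e (-t)
  rw [← sub_eq_add_neg] at e2
  rw [e1, e2]
  -- The two shifted densities add up to `exp (-t ^ 2 / 2)` times the density at `u` times `2 cosh
  -- (u t)`.
  have h1 := Real.one_le_cosh (u * t)
  rw [Real.cosh_eq] at h1
  have h2 : 2 ≤ Real.exp (-(u * t)) + Real.exp (-(u * -t)) := by
    rw [mul_neg, neg_neg]; linarith
  have h3 := inv_sqrt_two_pi_pos
  have h4 := Real.exp_pos (-t ^ 2 / 2)
  have h5 := Real.exp_pos (-u ^ 2 / 2)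
  rw [neg_sq]
  calc _ = (√(2 * Real.pi))⁻¹ * (Real.exp (-t ^ 2 / 2) * Real.exp (-u ^ 2 / 2)) * 2 := by ring
    _ ≤ (√(2 * Real.pi))⁻¹ * (Real.exp (-t ^ 2 / 2) * Real.exp (-u ^ 2 / 2)) *
        (Real.exp (-(u * t)) + Real.exp (-(u * -t))) := by gcongr
    _ = _ := by ring

/-! ### Tilted averages -/

/-- Against a weight that decreases with the distance to `z`, the mean of `1 + |x|` is of order
`1 + |z|`, uniformly in the weight. -/
theorem exists_integral_one_add_abs_mul_le (ν : Measure ℝ) [IsProbabilityMeasure ν]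
    (hν : Integrable (fun x => |x|) ν) :
    ∃ C, 0 ≤ C ∧ ∀ w : ℝ → ℝ, Measurable w → (∀ x, 0 ≤ w x) → (∀ x y, |y| ≤ |x| → w x ≤ w y) →
      ∀ z, Integrable (fun x => (1 + |x|) * w (x - z)) ν ∧
        ∫ x, (1 + |x|) * w (x - z) ∂ν ≤ C * (1 + |z|) * ∫ x, w (x - z) ∂ν := by
  obtain ⟨A, hA0, hA⟩ : ∃ A : ℝ, 0 ≤ A ∧ 1 / 2 ≤ ν.real {x | |x| ≤ A} := by
    have h1 : Tendsto (fun k : ℕ => ν {x | |x| ≤ (k : ℝ)}) atTop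
        (nhds (ν (⋃ k : ℕ, {x | |x| ≤ (k : ℝ)}))) := by
      refine tendsto_measure_iUnion_atTop ?_
      intro a b hab x hx
      exact le_trans (show |x| ≤ (a : ℝ) from hx) (by exact_mod_cast hab)
    have h2 : (⋃ k : ℕ, {x : ℝ | |x| ≤ (k : ℝ)}) = Set.univ := by
      refine Set.eq_univ_of_forall fun x => Set.mem_iUnion.2 ?_
      exact exists_nat_ge |x|
    rw [h2, measure_univ] at h1
    have h3 : Tendsto (fun k : ℕ => ν.real {x | |x| ≤ (k : ℝ)}) atTop (nhds 1) := by
      simpa [Measure.real, Function.comp_def] using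
        (ENNReal.tendsto_toReal ENNReal.one_ne_top).comp h1
    obtain ⟨k, hk⟩ := (h3.eventually (lt_mem_nhds (by norm_num : (1 / 2 : ℝ) < 1))).exists
    exact ⟨k, by positivity, hk.le⟩
  have hI : Integrable (fun x => 1 + |x|) ν := (integrable_const 1).add hν
  set M := ∫ x, (1 + |x|) ∂ν with hM
  have hM0 : 0 ≤ M := integral_nonneg fun x => by positivity
  refine ⟨2 + A + 2 * M, by positivity, fun w hwm hw0 hw z => ?_⟩
  have hwI : Integrable (fun x => w (x - z)) ν := by
    refine Integrable.mono' (integrable_const (w 0)) (hwm.comp (by fun_prop)).aestronglyMeasurable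
      (ae_of_all _ fun x => ?_)
    rw [Real.norm_eq_abs, abs_of_nonneg (hw0 _)]
    exact hw _ _ (by simp)
  have hint : Integrable (fun x => (1 + |x|) * w (x - z)) ν := by
    refine (hI.mul_const (w 0)).mono' ?_ (ae_of_all _ fun x => ?_)
    · exact ((by fun_prop : Measurable fun x : ℝ => 1 + |x|).mul
        (hwm.comp (by fun_prop))).aestronglyMeasurable
    · rw [Real.norm_eq_abs, abs_of_nonneg (mul_nonneg (by positivity) (hw0 _))]
      exact mul_le_mul_of_nonneg_left (hw _ _ (by simp)) (by positivity)
  refine ⟨hint, ?_⟩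
  -- At least half of the mass lies within `A` of 0, where the weight is at least `b`; beyond `2 |z|
  -- + A` the weight is at most `b`. The far part of the integral is thus controlled by the total
  -- weight.
  set b := w (|z| + A)
  have hb : b / 2 ≤ ∫ x, w (x - z) ∂ν := by
    have hms : MeasurableSet {x : ℝ | |x| ≤ A} := measurableSet_le (by fun_prop) (by fun_prop)
    calc b / 2 ≤ ν.real {x | |x| ≤ A} * b := by have := hw0 (|z| + A); nlinarith
      _ = ∫ x in {x | |x| ≤ A}, b ∂ν := by simp
      _ ≤ ∫ x in {x | |x| ≤ A}, w (x - z) ∂ν := by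
        refine setIntegral_mono_on (integrable_const _) hwI.integrableOn hms fun x hx => ?_
        refine hw _ _ ?_
        rw [abs_of_nonneg (by positivity : 0 ≤ |z| + A)]
        have := abs_sub x z
        have : |x| ≤ A := hx
        linarith
      _ ≤ ∫ x, w (x - z) ∂ν := setIntegral_le_integral hwI (ae_of_all _ fun x => hw0 _)
  have hpt : ∀ x, (1 + |x|) * w (x - z) ≤
      (1 + 2 * |z| + A) * w (x - z) + (1 + |x|) * b := by
    intro x
    have h0 := hw0 (x - z)
    have hb0 := hw0 (|z| + A)
    have := abs_nonneg z
    by_cases hx : |x| ≤ 2 * |z| + A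
    · have : 0 ≤ (1 + |x|) * b := mul_nonneg (by positivity) hb0
      nlinarith
    · push Not at hx
      have h1 : w (x - z) ≤ b := by
        refine hw _ _ ?_
        rw [abs_of_nonneg (by positivity : 0 ≤ |z| + A)]
        have := abs_sub_abs_le_abs_sub x z
        linarith
      have h2 : (1 + |x|) * w (x - z) ≤ (1 + |x|) * b := by gcongr
      have : 0 ≤ (1 + 2 * |z| + A) * w (x - z) := by positivity
      linarith
  calc ∫ x, (1 + |x|) * w (x - z) ∂ν
      ≤ ∫ x, ((1 + 2 * |z| + A) * w (x - z) + (1 + |x|) * b) ∂ν :=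
        integral_mono hint ((hwI.const_mul _).add (hI.mul_const _)) hpt
    _ = (1 + 2 * |z| + A) * ∫ x, w (x - z) ∂ν + M * b := by
        rw [integral_add (hwI.const_mul _) (hI.mul_const _), integral_const_mul, integral_mul_const]
    _ ≤ (1 + 2 * |z| + A) * ∫ x, w (x - z) ∂ν + M * (2 * ∫ x, w (x - z) ∂ν) := by
        gcongr; linarith
    _ ≤ _ := by
        have hJ : 0 ≤ ∫ x, w (x - z) ∂ν := integral_nonneg fun x => hw0 _
        have h1 : 1 + 2 * |z| + A + 2 * M ≤ (2 + A + 2 * M) * (1 + |z|) := by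
          have := abs_nonneg z
          nlinarith [mul_nonneg hA0 this, mul_nonneg hM0 this]
        calc _ = (1 + 2 * |z| + A + 2 * M) * ∫ x, w (x - z) ∂ν := by ring
          _ ≤ _ := by gcongr

end EBKalman

/-! ### Normal location mixtures -/

namespace EBKalman

/-- The joint law of a variable with law `G` and of an independent standard normal error. -/
noncomputable def signalNoise (G : Measure ℝ) : Measure (ℝ × ℝ) := G.prod (gaussianReal 0 1)

/-- The density of the convolution of `G` and the standard normal law. -/
noncomputable def mixDensity (G : Measure ℝ) (z : ℝ) : ℝ := ∫ x, gaussianPDFReal 0 1 (z - x) ∂G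

/-- The derivative of `mixDensity`. -/
noncomputable def mixDensityDeriv (G : Measure ℝ) (z : ℝ) : ℝ :=
  ∫ x, -(z - x) * gaussianPDFReal 0 1 (z - x) ∂G

section Mixture

variable {G : Measure ℝ} [IsProbabilityMeasure G]

instance : IsProbabilityMeasure (signalNoise G) := by
  rw [signalNoise]; infer_instance

theorem integrable_gaussianPDFReal_sub (z : ℝ) :
    Integrable (fun x => gaussianPDFReal 0 1 (z - x)) G := by
  refine (integrable_const (1 : ℝ)).mono'
    (continuous_gaussianPDFReal_std.comp (by fun_prop)).aestronglyMeasurable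
    (ae_of_all _ fun x => ?_)
  rw [Real.norm_eq_abs, abs_of_pos (gaussianPDFReal_std_pos _)]
  exact gaussianPDFReal_std_le_one _

theorem continuous_gaussianPDFReal_deriv :
    Continuous fun t : ℝ => -t * gaussianPDFReal 0 1 t :=
  (by fun_prop : Continuous fun t : ℝ => -t).mul continuous_gaussianPDFReal_std

theorem integrable_gaussianPDFReal_deriv_sub (z : ℝ) :
    Integrable (fun x => -(z - x) * gaussianPDFReal 0 1 (z - x)) G :=
  (integrable_const (1 : ℝ)).mono'
    (continuous_gaussianPDFReal_deriv.comp (by fun_prop :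
      Continuous fun x : ℝ => z - x)).aestronglyMeasurable
    (ae_of_all _ fun _ => abs_mul_gaussianPDFReal_std_le_one _)

theorem mixDensity_pos (z : ℝ) : 0 < mixDensity G z := by
  rw [mixDensity, integral_pos_iff_support_of_nonneg (fun x => (gaussianPDFReal_std_pos _).le)
    (integrable_gaussianPDFReal_sub z)]
  have : (Function.support fun x => gaussianPDFReal 0 1 (z - x)) = Set.univ :=
    Set.eq_univ_of_forall fun x => (gaussianPDFReal_std_pos _).ne'
  rw [this, measure_univ]
  exact one_pos

theorem mixDensity_le_one (z : ℝ) : mixDensity G z ≤ 1 := by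
  have := integral_mono (integrable_gaussianPDFReal_sub (G := G) z) (integrable_const (1 : ℝ))
    (fun x => gaussianPDFReal_std_le_one _)
  simpa [mixDensity] using this

theorem abs_mixDensityDeriv_le_one (z : ℝ) : |mixDensityDeriv G z| ≤ 1 := by
  have := norm_integral_le_of_norm_le (integrable_const (1 : ℝ)) (μ := G)
    (f := fun x => -(z - x) * gaussianPDFReal 0 1 (z - x))
    (ae_of_all _ fun x => (abs_mul_gaussianPDFReal_std_le_one (z - x)))
  simpa [mixDensityDeriv] using this

theorem hasDerivAt_mixDensity (z : ℝ) : HasDerivAt (mixDensity G) (mixDensityDeriv G z) z := by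
  refine (hasDerivAt_integral_of_dominated_loc_of_deriv_le (μ := G) (s := Set.univ)
    (F := fun z x => gaussianPDFReal 0 1 (z - x))
    (F' := fun z x => -(z - x) * gaussianPDFReal 0 1 (z - x)) (bound := fun _ => 1)
    univ_mem (Eventually.of_forall fun z => (integrable_gaussianPDFReal_sub z).1)
    (integrable_gaussianPDFReal_sub z) (integrable_gaussianPDFReal_deriv_sub z).1
    (ae_of_all _ fun x z _ => abs_mul_gaussianPDFReal_std_le_one (z - x)) (integrable_const _)
    (ae_of_all _ fun x z _ => ?_)).2
  have := (hasDerivAt_gaussianPDFReal_std (z - x)).comp z ((hasDerivAt_id z).sub_const x)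
  refine this.congr_deriv ?_
  simp

theorem continuous_mixDensity : Continuous (mixDensity G) :=
  continuous_iff_continuousAt.2 fun x => (hasDerivAt_mixDensity x).continuousAt

theorem continuous_mixDensityDeriv : Continuous (mixDensityDeriv G) := by
  refine continuous_of_dominated (bound := fun _ => 1)
    (fun z => (integrable_gaussianPDFReal_deriv_sub z).1)
    (fun z => ae_of_all _ fun x => abs_mul_gaussianPDFReal_std_le_one (z - x))
    (integrable_const _) (ae_of_all _ fun x => ?_)
  exact continuous_gaussianPDFReal_deriv.comp (by fun_prop : Continuous fun z : ℝ => z - x)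

/-- Integrals of functions of the signal and of the observation. -/
theorem integral_signalNoise {Ψ : ℝ → ℝ → ℝ}
    (hΨ : Integrable (fun q : ℝ × ℝ => Ψ q.1 (q.1 + q.2)) (signalNoise G)) :
    Integrable (fun z => ∫ x, gaussianPDFReal 0 1 (z - x) * Ψ x z ∂G) ∧
    ∫ q, Ψ q.1 (q.1 + q.2) ∂(signalNoise G) =
      ∫ z, ∫ x, gaussianPDFReal 0 1 (z - x) * Ψ x z ∂G := by
  have hQ : signalNoise G =
      (G.prod volume).withDensity (fun q : ℝ × ℝ => gaussianPDF 0 1 q.2) := by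
    rw [signalNoise, gaussianReal_of_var_ne_zero 0 one_ne_zero,
      prod_withDensity_right (measurable_gaussianPDF 0 1)]
  have hmeas : Measurable fun q : ℝ × ℝ => gaussianPDF 0 1 q.2 :=
    (measurable_gaussianPDF 0 1).comp measurable_snd
  have hlt : ∀ᵐ q : ℝ × ℝ ∂(G.prod volume), gaussianPDF 0 1 q.2 < ⊤ :=
    ae_of_all _ fun _ => gaussianPDF_lt_top
  -- The change of variables from signal and noise to signal and observation is a shear, which
  -- preserves the product with Lebesgue measure.
  have hmp : MeasurePreserving (MeasurableEquiv.shearAddRight ℝ) (G.prod volume)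
      (G.prod volume) := measurePreserving_prod_add G volume
  set F : ℝ × ℝ → ℝ := fun p => gaussianPDFReal 0 1 (p.2 - p.1) * Ψ p.1 p.2 with hF
  have hcomp : (fun q : ℝ × ℝ => gaussianPDFReal 0 1 q.2 * Ψ q.1 (q.1 + q.2)) =
      F ∘ MeasurableEquiv.shearAddRight ℝ := by
    funext q
    have : MeasurableEquiv.shearAddRight ℝ q = (q.1, q.1 + q.2) := rfl
    simp [hF, this]
  have hFint : Integrable F (G.prod volume) := by
    rw [hQ, integrable_withDensity_iff_integrable_smul' hmeas hlt] at hΨ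
    simp only [toReal_gaussianPDF, smul_eq_mul] at hΨ
    rw [hcomp] at hΨ
    exact (hmp.integrable_comp_emb (MeasurableEquiv.measurableEmbedding _)).1 hΨ
  refine ⟨hFint.integral_prod_right, ?_⟩
  rw [hQ, integral_withDensity_eq_integral_toReal_smul hmeas hlt]
  simp only [toReal_gaussianPDF, smul_eq_mul]
  rw [hcomp]
  have h3 := hmp.integral_comp (MeasurableEquiv.measurableEmbedding _) F
  simp only [Function.comp_def]
  rw [h3, integral_prod_symm _ hFint]

theorem integral_observation {g : ℝ → ℝ}
    (hg : Integrable (fun q : ℝ × ℝ => g (q.1 + q.2)) (signalNoise G)) :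
    Integrable (fun z => g z * mixDensity G z) ∧
    ∫ q, g (q.1 + q.2) ∂(signalNoise G) = ∫ z, g z * mixDensity G z := by
  have h := integral_signalNoise (Ψ := fun _ z => g z) hg
  have e : ∀ z, ∫ x, gaussianPDFReal 0 1 (z - x) * g z ∂G = g z * mixDensity G z := by
    intro z
    rw [integral_mul_const, mixDensity, mul_comm]
  simpa only [e] using h

/-- Tweedie's formula in weak form: given the observation, the noise has mean `-f' / f`. -/
theorem integral_noise_mul_observation {g : ℝ → ℝ}
    (hg : Integrable (fun q : ℝ × ℝ => q.2 * g (q.1 + q.2)) (signalNoise G)) :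
    Integrable (fun z => -(g z * mixDensityDeriv G z)) ∧
    ∫ q, q.2 * g (q.1 + q.2) ∂(signalNoise G) = ∫ z, -(g z * mixDensityDeriv G z) := by
  have h := integral_signalNoise (G := G) (Ψ := fun x z => (z - x) * g z) (by simpa using hg)
  have e : ∀ z, ∫ x, gaussianPDFReal 0 1 (z - x) * ((z - x) * g z) ∂G =
      -(g z * mixDensityDeriv G z) := by
    intro z
    rw [mixDensityDeriv, ← integral_const_mul, ← integral_neg]
    congr 1; funext x; ring
  simp only [e, add_sub_cancel_left] at h
  exact h

theorem memLp_noise : MemLp (fun q : ℝ × ℝ => q.2) 2 (signalNoise G) := by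
  have : MemLp id 2 (gaussianReal 0 1) := memLp_id_gaussianReal 2
  exact this.comp_snd G

theorem integral_noise_sq : ∫ q, q.2 ^ 2 ∂(signalNoise G) = 1 := by
  rw [signalNoise, integral_fun_snd (fun e : ℝ => e ^ 2)]
  have h := variance_id_gaussianReal (μ := 0) (v := 1)
  rw [variance_eq_integral (by fun_prop)] at h
  simpa using h

theorem memLp_signal (hG : MemLp id 2 G) : MemLp (fun q : ℝ × ℝ => q.1) 2 (signalNoise G) := by
  exact hG.comp_fst (gaussianReal 0 1)

theorem memLp_observation (hG : MemLp id 2 G) :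
    MemLp (fun q : ℝ × ℝ => q.1 + q.2) 2 (signalNoise G) :=
  (memLp_signal hG).add memLp_noise

theorem integral_signal_mul_noise : ∫ q, q.1 * q.2 ∂(signalNoise G) = 0 := by
  rw [signalNoise, integral_prod_mul (fun x : ℝ => x) (fun e : ℝ => e)]
  simp

end Mixture

end EBKalman

/-! ### Scores of mixtures and of their smoothed densities -/

namespace EBKalman

/-- The score of the mixture. -/
noncomputable def mixScore (G : Measure ℝ) (z : ℝ) : ℝ := mixDensityDeriv G z / mixDensity G z

/-- The mean of the kernel density estimate. -/
noncomputable def smoothDensity (G : Measure ℝ) (σ z : ℝ) : ℝ :=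
  ∫ q, scaledKernel σ (q.1 + q.2 - z) ∂(signalNoise G)

/-- The mean of the derivative of the kernel density estimate. -/
noncomputable def smoothDensityDeriv (G : Measure ℝ) (σ z : ℝ) : ℝ :=
  ∫ q, -scaledKernelDeriv σ (q.1 + q.2 - z) ∂(signalNoise G)

/-- The score of the smoothed density. -/
noncomputable def smoothScore (G : Measure ℝ) (σ z : ℝ) : ℝ :=
  smoothDensityDeriv G σ z / smoothDensity G σ z

section Smooth

variable {G : Measure ℝ} [IsProbabilityMeasure G] {σ : ℝ}

theorem abs_integral_le_of_abs_le {α : Type*} [MeasurableSpace α] {μ : Measure α} {f g : α → ℝ}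
    (hg : Integrable g μ) (h : ∀ x, |f x| ≤ g x) : |∫ x, f x ∂μ| ≤ ∫ x, g x ∂μ :=
  norm_integral_le_of_norm_le (f := f) hg (ae_of_all _ h)

theorem continuous_mixScore : Continuous (mixScore G) :=
  continuous_mixDensityDeriv.div continuous_mixDensity fun z => (mixDensity_pos z).ne'

/-- The ratio `|f'| / f` is at most a posterior mean of `|z - x|`. The posterior weight decreases
with the distance to `z`, so the tilted average bound gives linear growth. -/
theorem exists_abs_mixDensityDeriv_le (hG : MemLp id 2 G) :
    ∃ C, 0 ≤ C ∧ ∀ z, |mixDensityDeriv G z| ≤ C * (1 + |z|) * mixDensity G z := by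
  obtain ⟨C, hC0, hC⟩ := exists_integral_one_add_abs_mul_le G
    ((hG.integrable (by norm_num)).abs)
  refine ⟨C + 1, by positivity, fun z => ?_⟩
  obtain ⟨h1, h2⟩ := hC (gaussianPDFReal 0 1) (measurable_gaussianPDFReal 0 1)
    (gaussianPDFReal_nonneg 0 1) (fun x y h => gaussianPDFReal_std_le h) z
  have hsymm : ∀ x, gaussianPDFReal 0 1 (x - z) = gaussianPDFReal 0 1 (z - x) := fun x =>
    le_antisymm (gaussianPDFReal_std_le (abs_sub_comm _ _).le)
      (gaussianPDFReal_std_le (abs_sub_comm _ _).le)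
  simp only [hsymm] at h1 h2
  have h3 : |mixDensityDeriv G z| ≤
      ∫ x, (|z| * gaussianPDFReal 0 1 (z - x) + (1 + |x|) * gaussianPDFReal 0 1 (z - x)) ∂G := by
    refine abs_integral_le_of_abs_le
      (((integrable_gaussianPDFReal_sub z).const_mul _).add h1) fun x => ?_
    rw [abs_mul, abs_neg, abs_of_pos (gaussianPDFReal_std_pos _), ← add_mul]
    have := abs_sub z x
    have := gaussianPDFReal_std_pos (z - x)
    gcongr
    linarith
  rw [integral_add ((integrable_gaussianPDFReal_sub z).const_mul _) h1, integral_const_mul] at h3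
  have h4 := mixDensity_pos (G := G) z
  change _ ≤ C * (1 + |z|) * mixDensity G z at h2
  change _ ≤ |z| * mixDensity G z + _ at h3
  nlinarith

theorem integrable_scaledKernel_observation (hσ : 0 < σ) (z : ℝ) :
    Integrable (fun q : ℝ × ℝ => scaledKernel σ (q.1 + q.2 - z)) (signalNoise G) := by
  refine (integrable_const σ⁻¹).mono'
    ((continuous_scaledKernel σ).comp (by fun_prop)).aestronglyMeasurable
    (ae_of_all _ fun x => ?_)
  rw [Real.norm_eq_abs, abs_of_pos (scaledKernel_pos hσ _)]
  exact scaledKernel_le hσ _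

theorem integrable_scaledKernelDeriv_observation (hσ : 0 < σ) (z : ℝ) :
    Integrable (fun q : ℝ × ℝ => -scaledKernelDeriv σ (q.1 + q.2 - z)) (signalNoise G) := by
  refine (integrable_const (2 * σ⁻¹ ^ 2)).mono'
    ((continuous_scaledKernelDeriv σ).neg.comp (by fun_prop :
      Continuous fun q : ℝ × ℝ => q.1 + q.2 - z)).aestronglyMeasurable
    (ae_of_all _ fun x => ?_)
  rw [Real.norm_eq_abs, abs_neg]
  exact abs_scaledKernelDeriv_le' hσ _

theorem smoothDensity_pos (hσ : 0 < σ) (z : ℝ) : 0 < smoothDensity G σ z := by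
  rw [smoothDensity, integral_pos_iff_support_of_nonneg (fun x => (scaledKernel_pos hσ _).le)
    (integrable_scaledKernel_observation hσ z)]
  have : (Function.support fun q : ℝ × ℝ => scaledKernel σ (q.1 + q.2 - z)) = Set.univ :=
    Set.eq_univ_of_forall fun x => (scaledKernel_pos hσ _).ne'
  rw [this, measure_univ]
  exact one_pos

theorem abs_smoothDensityDeriv_le (hσ : 0 < σ) (z : ℝ) :
    |smoothDensityDeriv G σ z| ≤ 2 * σ⁻¹ * smoothDensity G σ z := by
  rw [smoothDensityDeriv, smoothDensity, ← integral_const_mul]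
  refine abs_integral_le_of_abs_le
    ((integrable_scaledKernel_observation hσ z).const_mul _) fun q => ?_
  rw [abs_neg]
  exact abs_scaledKernelDeriv_le hσ _

theorem abs_smoothScore_le (hσ : 0 < σ) (z : ℝ) : |smoothScore G σ z| ≤ 2 * σ⁻¹ := by
  rw [smoothScore, abs_div, abs_of_pos (smoothDensity_pos hσ z)]
  exact div_le_of_le_mul₀ (smoothDensity_pos hσ z).le (by positivity)
    (abs_smoothDensityDeriv_le hσ z)

theorem smoothDensity_eq_integral (hσ : 0 < σ) (z : ℝ) :
    smoothDensity G σ z = ∫ w, kernel w * mixDensity G (z + σ * w) := by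
  rw [← integral_mul_scaledKernel hσ (mixDensity G) z, smoothDensity,
    (integral_observation (g := fun y => scaledKernel σ (y - z))
      (integrable_scaledKernel_observation hσ z)).2]
  congr 1; funext y; ring

/-- Integration by parts moves the derivative from the kernel, where it costs `1 / σ`, to the
mixture density, where it costs nothing. -/
theorem smoothDensityDeriv_eq_integral_mul (hσ : 0 < σ) (z : ℝ) :
    smoothDensityDeriv G σ z = ∫ y, mixDensityDeriv G y * scaledKernel σ (y - z) := by
  have h1 := (integral_observation (G := G) (g := fun y => -scaledKernelDeriv σ (y - z))
    (integrable_scaledKernelDeriv_observation hσ z)).2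
  have hd : ∀ y, HasDerivAt (fun y => scaledKernel σ (y - z)) (scaledKernelDeriv σ (y - z)) y :=
    fun y => (hasDerivAt_scaledKernel σ (y - z)).comp_sub_const y z
  have hb : ∀ (u : ℝ → ℝ) (w : ℝ → ℝ), Continuous u → (∀ y, |u y| ≤ 1) → Integrable w →
      Integrable (u * w) := fun u w hu hu1 hw =>
    (hw.bdd_mul (c := 1) hu.aestronglyMeasurable (ae_of_all _ hu1))
  have hf1 : ∀ y, |mixDensity G y| ≤ 1 := fun y => by
    rw [abs_of_pos (mixDensity_pos y)]; exact mixDensity_le_one y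
  have h2 := integral_mul_deriv_eq_deriv_mul_of_integrable
    (u := mixDensity G) (u' := mixDensityDeriv G) (v := fun y => scaledKernel σ (y - z))
    (v' := fun y => scaledKernelDeriv σ (y - z)) (fun y _ => hasDerivAt_mixDensity y)
    (fun y _ => hd y) (hb _ _ continuous_mixDensity hf1 (integrable_scaledKernelDeriv hσ z))
    (hb _ _ continuous_mixDensityDeriv abs_mixDensityDeriv_le_one (integrable_scaledKernel hσ z))
    (hb _ _ continuous_mixDensity hf1 (integrable_scaledKernel hσ z))
  rw [smoothDensityDeriv, h1, ← neg_inj, ← h2, ← integral_neg]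
  congr 1; funext y; ring

theorem smoothDensityDeriv_eq_integral (hσ : 0 < σ) (z : ℝ) :
    smoothDensityDeriv G σ z = ∫ w, kernel w * mixDensityDeriv G (z + σ * w) := by
  rw [smoothDensityDeriv_eq_integral_mul hσ, integral_mul_scaledKernel hσ]

/-- The score of the smoothed density grows at most linearly, uniformly in the bandwidth. -/
theorem exists_abs_smoothScore_le (hG : MemLp id 2 G) :
    ∃ C, 0 ≤ C ∧ ∀ σ, 0 < σ → ∀ z, |smoothScore G σ z| ≤ C * (1 + |z|) := by
  obtain ⟨C₁, hC₁, h1⟩ := exists_abs_mixDensityDeriv_le hG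
  have hZ : Measurable fun q : ℝ × ℝ => q.1 + q.2 := by fun_prop
  have : IsProbabilityMeasure ((signalNoise G).map fun q => q.1 + q.2) :=
    Measure.isProbabilityMeasure_map hZ.aemeasurable
  -- The tilted average bound is used again, now under the law of the observation and with the
  -- kernel as weight. Its constant does not depend on the weight, hence not on the bandwidth.
  obtain ⟨C₂, hC₂, h2⟩ := exists_integral_one_add_abs_mul_le
    ((signalNoise G).map fun q => q.1 + q.2) (by
      rw [integrable_map_measure (by fun_prop) hZ.aemeasurable]
      exact ((memLp_observation hG).integrable (by norm_num)).abs)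
  refine ⟨C₁ * C₂, by positivity, fun σ hσ z => ?_⟩
  obtain ⟨h3, h4⟩ := h2 (scaledKernel σ) (continuous_scaledKernel σ).measurable
    (fun x => (scaledKernel_pos hσ x).le) (fun x y h => scaledKernel_le_scaledKernel hσ h) z
  have hm : Measurable fun x => scaledKernel σ (x - z) :=
    (continuous_scaledKernel σ).measurable.comp (by fun_prop)
  have hm2 : Measurable fun x : ℝ => (1 + |x|) * scaledKernel σ (x - z) :=
    (by fun_prop : Measurable fun x : ℝ => 1 + |x|).mul hm
  rw [integral_map hZ.aemeasurable hm2.aestronglyMeasurable,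
    integral_map hZ.aemeasurable hm.aestronglyMeasurable] at h4
  rw [integrable_map_measure hm2.aestronglyMeasurable hZ.aemeasurable] at h3
  obtain ⟨h5, h6⟩ := integral_observation (G := G)
    (g := fun y => (1 + |y|) * scaledKernel σ (y - z)) h3
  rw [h6] at h4
  have h7 : |smoothDensityDeriv G σ z| ≤
      ∫ y, C₁ * ((1 + |y|) * scaledKernel σ (y - z) * mixDensity G y) := by
    rw [smoothDensityDeriv_eq_integral_mul hσ]
    refine abs_integral_le_of_abs_le (h5.const_mul C₁) fun y => ?_
    rw [abs_mul, abs_of_pos (scaledKernel_pos hσ _)]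
    calc _ ≤ C₁ * (1 + |y|) * mixDensity G y * scaledKernel σ (y - z) := by
          have := scaledKernel_pos hσ (y - z)
          gcongr
          exact h1 y
      _ = _ := by ring
  rw [integral_const_mul] at h7
  rw [smoothScore, abs_div, abs_of_pos (smoothDensity_pos hσ z),
    div_le_iff₀ (smoothDensity_pos hσ z)]
  calc _ ≤ _ := h7
    _ ≤ C₁ * (C₂ * (1 + |z|) * smoothDensity G σ z) := by
        gcongr
        exact h4
    _ = _ := by ring

theorem two_mul_mixDensity_le (z t : ℝ) :
    2 * (Real.exp (-t ^ 2 / 2) * mixDensity G z) ≤ mixDensity G (z + t) + mixDensity G (z - t) := by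
  rw [mixDensity, mixDensity, mixDensity, ← integral_const_mul, ← integral_const_mul,
    ← integral_add (integrable_gaussianPDFReal_sub _) (integrable_gaussianPDFReal_sub _)]
  refine integral_mono (((integrable_gaussianPDFReal_sub _).const_mul _).const_mul _)
    ((integrable_gaussianPDFReal_sub _).add (integrable_gaussianPDFReal_sub _)) fun x => ?_
  have := two_mul_gaussianPDFReal_std_le (z - x) t
  simp only
  rwa [show z + t - x = z - x + t by ring, show z - t - x = z - x - t by ring]

theorem integrable_kernel_mul_comp {g : ℝ → ℝ} (hg : Continuous g) (h1 : ∀ y, |g y| ≤ 1)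
    (z σ : ℝ) : Integrable fun w => kernel w * g (z + σ * w) := by
  have := integrable_kernel.bdd_mul (c := 1) (f := fun w => g (z + σ * w))
    (hg.comp (by fun_prop)).aestronglyMeasurable (ae_of_all _ fun w => h1 _)
  exact this.congr (ae_of_all _ fun w => mul_comm _ _)

theorem abs_mixDensity_le_one (y : ℝ) : |mixDensity G y| ≤ 1 := by
  rw [abs_of_pos (mixDensity_pos y)]; exact mixDensity_le_one y

/-- The smoothed density dominates a fixed multiple of the density. -/
theorem exists_mixDensity_le_smoothDensity (G : Measure ℝ) [IsProbabilityMeasure G] :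
    ∃ c, 0 < c ∧ ∀ σ, 0 < σ → σ ≤ 1 → ∀ z, c * mixDensity G z ≤ smoothDensity G σ z := by
  have hI : Integrable fun w => kernel w * Real.exp (-w ^ 2 / 2) := by
    have h1 : ∀ y : ℝ, |Real.exp (-y ^ 2 / 2)| ≤ 1 := fun y => by
      rw [Real.abs_exp, Real.exp_le_one_iff]; nlinarith [sq_nonneg y]
    simpa using integrable_kernel_mul_comp (by fun_prop) h1 0 1
  refine ⟨∫ w, kernel w * Real.exp (-w ^ 2 / 2), ?_, fun σ hσ hσ1 z => ?_⟩
  · have hp : ∀ w, 0 < kernel w * Real.exp (-w ^ 2 / 2) := fun w =>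
      mul_pos (kernel_pos w) (Real.exp_pos _)
    rw [integral_pos_iff_support_of_nonneg (fun w => (hp w).le) hI]
    have : (Function.support fun w => kernel w * Real.exp (-w ^ 2 / 2)) = Set.univ :=
      Set.eq_univ_of_forall fun x => (hp x).ne'
    rw [this]
    simp
  · have ha := integrable_kernel_mul_comp (continuous_mixDensity (G := G)) abs_mixDensity_le_one z σ
    have hb := integrable_kernel_mul_comp (continuous_mixDensity (G := G)) abs_mixDensity_le_one z
      (-σ)
    -- The kernel is even, so the smoothed density averages `f (z + σ w)` and `f (z - σ w)`, whose
    -- sum is bounded below by a multiple of `f z`. The restriction `σ ≤ 1` makes the constant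
    -- uniform.
    have e : ∫ w, kernel w * mixDensity G (z + -σ * w) = smoothDensity G σ z := by
      rw [smoothDensity_eq_integral hσ, ← integral_neg_eq_self]
      congr 1; funext w
      rw [kernel_neg]
      ring_nf
    have h2 : 2 * smoothDensity G σ z =
        ∫ w, (kernel w * mixDensity G (z + σ * w) + kernel w * mixDensity G (z + -σ * w)) := by
      rw [integral_add ha hb, e, smoothDensity_eq_integral hσ]; ring
    have h3 : 2 * ((∫ w, kernel w * Real.exp (-w ^ 2 / 2)) * mixDensity G z) ≤
        2 * smoothDensity G σ z := by
      rw [h2, ← integral_mul_const, ← integral_const_mul]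
      refine integral_mono ((hI.mul_const _).const_mul 2) (ha.add hb) fun w => ?_
      have h4 := two_mul_mixDensity_le (G := G) z (σ * w)
      have h5 : Real.exp (-w ^ 2 / 2) ≤ Real.exp (-(σ * w) ^ 2 / 2) := by
        rw [mul_pow]
        gcongr
        have : σ ^ 2 ≤ 1 := pow_le_one₀ hσ.le hσ1
        nlinarith [sq_nonneg w]
      have h6 := mixDensity_pos (G := G) z
      have h7 := kernel_pos w
      simp only
      calc 2 * (kernel w * Real.exp (-w ^ 2 / 2) * mixDensity G z)
          ≤ kernel w * (2 * (Real.exp (-(σ * w) ^ 2 / 2) * mixDensity G z)) := by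
            have : kernel w * (Real.exp (-w ^ 2 / 2) * mixDensity G z) ≤
              kernel w * (Real.exp (-(σ * w) ^ 2 / 2) * mixDensity G z) := by gcongr
            linarith
        _ ≤ kernel w * (mixDensity G (z + σ * w) + mixDensity G (z - σ * w)) := by gcongr
        _ = _ := by rw [neg_mul, ← sub_eq_add_neg]; ring
    linarith

theorem tendsto_integral_kernel_mul {g : ℝ → ℝ} (hg : Continuous g) (h1 : ∀ y, |g y| ≤ 1)
    (z : ℝ) : Tendsto (fun σ => ∫ w, kernel w * g (z + σ * w)) (nhdsWithin 0 (Set.Ioi 0))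
      (nhds ((∫ w, kernel w) * g z)) := by
  have h : Tendsto (fun σ => ∫ w, kernel w * g (z + σ * w)) (nhds 0)
      (nhds (∫ w, kernel w * g (z + 0 * w))) := by
    refine tendsto_integral_filter_of_dominated_convergence kernel
      (Eventually.of_forall fun σ => (integrable_kernel_mul_comp hg h1 z σ).1)
      (Eventually.of_forall fun σ => ae_of_all _ fun w => ?_) integrable_kernel
      (ae_of_all _ fun w => ?_)
    · rw [Real.norm_eq_abs, abs_mul, abs_of_pos (kernel_pos w)]
      exact mul_le_of_le_one_right (kernel_pos w).le (h1 _)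
    · exact ((by fun_prop : Continuous fun σ : ℝ => kernel w * g (z + σ * w)).tendsto 0)
  simp only [zero_mul, add_zero] at h
  rw [integral_mul_const] at h
  exact h.mono_left nhdsWithin_le_nhds

theorem integral_kernel_pos : 0 < ∫ w, kernel w := by
  rw [integral_pos_iff_support_of_nonneg (fun w => (kernel_pos w).le) integrable_kernel]
  have : Function.support kernel = Set.univ :=
    Set.eq_univ_of_forall fun x => (kernel_pos x).ne'
  rw [this]
  simp

/-- Numerator and denominator converge to `f'` and `f` times the total mass of the kernel. The mass
cancels in the ratio, so only its positivity matters. -/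
theorem tendsto_smoothScore (z : ℝ) :
    Tendsto (fun σ => smoothScore G σ z) (nhdsWithin 0 (Set.Ioi 0)) (nhds (mixScore G z)) := by
  have h1 := tendsto_integral_kernel_mul (continuous_mixDensity (G := G)) abs_mixDensity_le_one z
  have h2 := tendsto_integral_kernel_mul (continuous_mixDensityDeriv (G := G))
    abs_mixDensityDeriv_le_one z
  have hκ := integral_kernel_pos
  have h3 := h2.div h1 (mul_pos hκ (mixDensity_pos z)).ne'
  rw [mul_div_mul_left _ _ hκ.ne'] at h3
  refine h3.congr' ?_
  filter_upwards [self_mem_nhdsWithin] with σ hσ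
  rw [Pi.div_apply, smoothScore, smoothDensityDeriv_eq_integral hσ, smoothDensity_eq_integral hσ]

theorem measurable_smoothDensity (σ : ℝ) : Measurable (smoothDensity G σ) := by
  refine (StronglyMeasurable.integral_prod_right (ν := signalNoise G)
    (f := fun z (q : ℝ × ℝ) => scaledKernel σ (q.1 + q.2 - z)) ?_).measurable
  exact ((continuous_scaledKernel σ).comp (by fun_prop :
    Continuous fun p : ℝ × (ℝ × ℝ) => p.2.1 + p.2.2 - p.1)).stronglyMeasurable

theorem measurable_smoothScore (σ : ℝ) : Measurable (smoothScore G σ) := by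
  have h2 : Measurable (smoothDensityDeriv G σ) := by
    refine (StronglyMeasurable.integral_prod_right (ν := signalNoise G)
      (f := fun z (q : ℝ × ℝ) => -scaledKernelDeriv σ (q.1 + q.2 - z)) ?_).measurable
    exact ((continuous_scaledKernelDeriv σ).neg.comp (by fun_prop :
      Continuous fun p : ℝ × (ℝ × ℝ) => p.2.1 + p.2.2 - p.1)).stronglyMeasurable
  exact h2.div (measurable_smoothDensity σ)

theorem exists_abs_mixScore_le (hG : MemLp id 2 G) :
    ∃ C, 0 ≤ C ∧ (∀ σ, 0 < σ → ∀ z, |smoothScore G σ z| ≤ C * (1 + |z|)) ∧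
      ∀ z, |mixScore G z| ≤ C * (1 + |z|) := by
  obtain ⟨C, hC, h⟩ := exists_abs_smoothScore_le hG
  refine ⟨C, hC, h, fun z => le_of_tendsto (tendsto_smoothScore z).abs ?_⟩
  filter_upwards [self_mem_nhdsWithin] with σ hσ
  exact h σ hσ z

theorem memLp_linear_growth (hG : MemLp id 2 G) (C : ℝ) :
    MemLp (fun q : ℝ × ℝ => C * (1 + |q.1 + q.2|)) 2 (signalNoise G) :=
  ((memLp_const (1 : ℝ)).add (memLp_observation hG).abs).const_mul C

theorem memLp_mixScore (hG : MemLp id 2 G) :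
    MemLp (fun q : ℝ × ℝ => mixScore G (q.1 + q.2)) 2 (signalNoise G) := by
  obtain ⟨C, hC, -, h⟩ := exists_abs_mixScore_le hG
  have hadd : Measurable fun q : ℝ × ℝ => q.1 + q.2 := by fun_prop
  exact (memLp_linear_growth hG C).mono'
    (continuous_mixScore.measurable.comp hadd).aestronglyMeasurable
    (ae_of_all _ fun q => h _)

/-- The risk of the smoothed score tends to that of the score. -/
theorem tendsto_integral_smoothScore (hG : MemLp id 2 G) :
    Tendsto (fun σ => ∫ q, (smoothScore G σ (q.1 + q.2) + q.2) ^ 2 ∂(signalNoise G))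
      (nhdsWithin 0 (Set.Ioi 0))
      (nhds (∫ q, (mixScore G (q.1 + q.2) + q.2) ^ 2 ∂(signalNoise G))) := by
  obtain ⟨C, hC, h, -⟩ := exists_abs_mixScore_le hG
  have hadd : Measurable fun q : ℝ × ℝ => q.1 + q.2 := by fun_prop
  have hm : ∀ σ, AEStronglyMeasurable
      (fun q : ℝ × ℝ => (smoothScore G σ (q.1 + q.2) + q.2) ^ 2) (signalNoise G) := fun σ =>
    ((((measurable_smoothScore σ).comp hadd).add measurable_snd).pow_const 2).aestronglyMeasurable
  -- Linear growth uniform in the bandwidth provides one square-integrable majorant for all `σ`.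
  have hb : MemLp (fun q : ℝ × ℝ => C * (1 + |q.1 + q.2|) + |q.2|) 2 (signalNoise G) :=
    (memLp_linear_growth hG C).add (memLp_noise (G := G)).abs
  have hlim : ∀ q : ℝ × ℝ, Tendsto (fun σ => (smoothScore G σ (q.1 + q.2) + q.2) ^ 2)
      (nhdsWithin 0 (Set.Ioi 0)) (nhds ((mixScore G (q.1 + q.2) + q.2) ^ 2)) := fun q =>
    ((tendsto_smoothScore _).add_const _).pow 2
  refine tendsto_integral_filter_of_dominated_convergence
    (fun q : ℝ × ℝ => (C * (1 + |q.1 + q.2|) + |q.2|) ^ 2) (Eventually.of_forall hm)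
    ?_ hb.integrable_sq (ae_of_all _ hlim)
  filter_upwards [self_mem_nhdsWithin] with σ hσ
  refine ae_of_all _ fun q => ?_
  rw [Real.norm_eq_abs, abs_pow]
  refine pow_le_pow_left₀ (abs_nonneg _) ?_ 2
  refine (abs_add_le _ _).trans ?_
  gcongr
  exact h σ hσ _

/-- Observations where the smoothed density is small, or that are large, are rare. -/
theorem exists_measureReal_smoothDensity_lt_le (hG : MemLp id 2 G) :
    ∃ C, 0 ≤ C ∧ ∀ σ, 0 < σ → σ ≤ 1 → ∀ η R, 0 < η → 0 < R →
      (signalNoise G).real {q | smoothDensity G σ (q.1 + q.2) < η ∨ R < |q.1 + q.2|} ≤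
        C * (R * η + (R ^ 2)⁻¹) := by
  obtain ⟨c, hc, h⟩ := exists_mixDensity_le_smoothDensity G
  have hZ := memLp_observation hG
  set M := ∫ q, (q.1 + q.2) ^ 2 ∂(signalNoise G) with hM
  have hM0 : 0 ≤ M := integral_nonneg fun q => by positivity
  refine ⟨2 / c + M, by positivity, fun σ hσ hσ1 η R hη hR => ?_⟩
  -- On `B` the mixture density is at most `η / c`, and `B` has length at most `2 R`. Observations
  -- beyond `R` are handled by Chebyshev's inequality.
  set B : Set ℝ := {z | smoothDensity G σ z < η ∧ |z| ≤ R} with hB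
  have hBm : MeasurableSet B :=
    (measurableSet_lt (measurable_smoothDensity σ) measurable_const).inter
      (measurableSet_le continuous_abs.measurable measurable_const)
  have hadd : Measurable fun q : ℝ × ℝ => q.1 + q.2 := by fun_prop
  set E : Set (ℝ × ℝ) := {q | smoothDensity G σ (q.1 + q.2) < η ∨ R < |q.1 + q.2|} with hE
  have hEm : MeasurableSet E :=
    (measurableSet_lt ((measurable_smoothDensity σ).comp hadd) measurable_const).union
      (measurableSet_lt measurable_const (continuous_abs.measurable.comp hadd))
  have hI : Integrable (fun q : ℝ × ℝ => B.indicator (fun _ => (1 : ℝ)) (q.1 + q.2))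
      (signalNoise G) := by
    refine (integrable_const (1 : ℝ)).mono'
      ((measurable_const.indicator hBm).comp hadd).aestronglyMeasurable (ae_of_all _ fun q => ?_)
    exact (norm_indicator_le_norm_self _ _).trans (by simp)
  have h1 : (signalNoise G).real E ≤
      ∫ q, (B.indicator (fun _ => (1 : ℝ)) (q.1 + q.2) + (R ^ 2)⁻¹ * (q.1 + q.2) ^ 2)
        ∂(signalNoise G) := by
    rw [← integral_indicator_one hEm]
    refine integral_mono ((integrable_const (1 : ℝ)).indicator hEm)
      (hI.add (hZ.integrable_sq.const_mul _)) fun q => ?_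
    have h0 : 0 ≤ B.indicator (fun _ => (1 : ℝ)) (q.1 + q.2) :=
      Set.indicator_nonneg (fun _ _ => zero_le_one) _
    by_cases hq : q ∈ E
    · rw [Set.indicator_of_mem hq]
      by_cases hqR : R < |q.1 + q.2|
      · have h2 : R ^ 2 ≤ (q.1 + q.2) ^ 2 := by
          rw [sq_le_sq, abs_of_pos hR]; exact hqR.le
        have h3 : 1 ≤ (R ^ 2)⁻¹ * (q.1 + q.2) ^ 2 := by
          rw [inv_mul_eq_div, one_le_div (by positivity)]; exact h2
        simp only [Pi.one_apply]
        linarith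
      · have h2 : q.1 + q.2 ∈ B := ⟨hq.resolve_right hqR, not_lt.1 hqR⟩
        simp only [Set.indicator_of_mem h2, Pi.one_apply]
        have : 0 ≤ (R ^ 2)⁻¹ * (q.1 + q.2) ^ 2 := by positivity
        linarith
    · rw [Set.indicator_of_notMem hq]
      have : 0 ≤ (R ^ 2)⁻¹ * (q.1 + q.2) ^ 2 := by positivity
      simp only
      linarith
  have h2 : ∫ q, B.indicator (fun _ => (1 : ℝ)) (q.1 + q.2) ∂(signalNoise G) ≤ 2 / c * (R * η) := by
    obtain ⟨h3, h4⟩ := integral_observation (g := B.indicator (fun _ => (1 : ℝ))) hI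
    rw [h4]
    calc ∫ z, B.indicator (fun _ => (1 : ℝ)) z * mixDensity G z
        ≤ ∫ z, (Set.Icc (-R) R).indicator (fun _ => η / c) z := by
          refine integral_mono h3 ((integrable_indicator_iff measurableSet_Icc).2
            (integrableOn_const (by simp))) fun z => ?_
          by_cases hz : z ∈ B
          · have h5 : z ∈ Set.Icc (-R) R := abs_le.1 hz.2
            simp only [Set.indicator_of_mem hz, Set.indicator_of_mem h5, one_mul]
            rw [le_div_iff₀ hc, mul_comm]
            exact (h σ hσ hσ1 z).trans hz.1.le
          · simp only [Set.indicator_of_notMem hz, zero_mul]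
            exact Set.indicator_nonneg (fun _ _ => by positivity) _
      _ = 2 / c * (R * η) := by
          rw [integral_indicator measurableSet_Icc]
          simp [Measure.real, hR.le]
          ring
  rw [integral_add hI (hZ.integrable_sq.const_mul _), integral_const_mul, ← hM] at h1
  have h5 : 0 ≤ M * (R * η) := by positivity
  have h6 : 0 ≤ 2 / c * (R ^ 2)⁻¹ := by positivity
  nlinarith

end Smooth

end EBKalman

/-! ### The best decision function beats the best linear one -/

namespace EBKalman

theorem integral_add_add_const_mul {α : Type*} [MeasurableSpace α] {μ : Measure α}
    {f g h : α → ℝ} (hf : Integrable f μ) (hg : Integrable g μ) (hh : Integrable h μ) (b c : ℝ) :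
    ∫ x, (f x + b * g x + c * h x) ∂μ = ∫ x, f x ∂μ + b * ∫ x, g x ∂μ + c * ∫ x, h x ∂μ := by
  have h1 : Integrable (fun x => f x + b * g x) μ := hf.add (hg.const_mul b)
  rw [integral_add h1 (hh.const_mul c), integral_add hf (hg.const_mul b), integral_const_mul,
    integral_const_mul]

section Gap

variable {G : Measure ℝ} [IsProbabilityMeasure G]

/-- Tweedie's formula tested on the score itself; the right side is minus the Fisher information of
the mixture. -/
theorem integral_noise_mul_mixScore (hG : MemLp id 2 G) :
    ∫ q, q.2 * mixScore G (q.1 + q.2) ∂(signalNoise G) =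
      -∫ q, mixScore G (q.1 + q.2) ^ 2 ∂(signalNoise G) := by
  have hs := memLp_mixScore hG
  rw [(integral_noise_mul_observation (memLp_noise.integrable_mul hs)).2,
    (integral_observation (g := fun z => mixScore G z ^ 2) hs.integrable_sq).2, ← integral_neg]
  congr 1; funext z
  have := (mixDensity_pos (G := G) z).ne'
  rw [mixScore]
  field_simp

theorem integral_noise_mul_sum (hG : MemLp id 2 G) :
    ∫ q, q.2 * (q.1 + q.2) ∂(signalNoise G) = 1 := by
  have h1 : Integrable (fun q : ℝ × ℝ => q.1 * q.2) (signalNoise G) :=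
    (memLp_signal hG).integrable_mul memLp_noise
  have h2 : Integrable (fun q : ℝ × ℝ => q.2 ^ 2) (signalNoise G) := memLp_noise.integrable_sq
  calc _ = ∫ q, (q.1 * q.2 + q.2 ^ 2) ∂(signalNoise G) := by congr 1; funext q; ring
    _ = 1 := by rw [integral_add h1 h2, integral_signal_mul_noise, integral_noise_sq, zero_add]

theorem integral_observation_sq (hG : MemLp id 2 G) :
    ∫ q, (q.1 + q.2) ^ 2 ∂(signalNoise G) = (∫ x, x ^ 2 ∂G) + 1 := by
  have h1 : Integrable (fun q : ℝ × ℝ => q.1 * q.2) (signalNoise G) :=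
    (memLp_signal hG).integrable_mul memLp_noise
  have h2 : Integrable (fun q : ℝ × ℝ => q.2 ^ 2) (signalNoise G) := memLp_noise.integrable_sq
  have h3 : Integrable (fun q : ℝ × ℝ => q.1 ^ 2) (signalNoise G) :=
    (memLp_signal hG).integrable_sq
  have h4 : ∫ q, q.1 ^ 2 ∂(signalNoise G) = ∫ x, x ^ 2 ∂G := by
    rw [signalNoise, integral_fun_fst (fun x : ℝ => x ^ 2)]
    simp
  calc _ = ∫ q, (q.1 ^ 2 + 2 * (q.1 * q.2) + 1 * q.2 ^ 2) ∂(signalNoise G) := by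
        congr 1; funext q; ring
    _ = _ := by
        rw [integral_add_add_const_mul h3 h1 h2, integral_signal_mul_noise, integral_noise_sq, h4]
        ring

/-- By Tweedie's formula the left side is `-E (ε Z) = -1`, which avoids boundary terms in an
integration by parts. -/
theorem integral_observation_mul_mixScore (hG : MemLp id 2 G) :
    ∫ q, (q.1 + q.2) * mixScore G (q.1 + q.2) ∂(signalNoise G) = -1 := by
  have hs := memLp_mixScore hG
  have hZ := memLp_observation hG
  rw [(integral_observation (g := fun z => z * mixScore G z) (hZ.integrable_mul hs)).2,
    ← integral_noise_mul_sum hG,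
    (integral_noise_mul_observation (g := fun z => z) (memLp_noise.integrable_mul hZ)).2,
    ← integral_neg]
  congr 1; funext z
  have := (mixDensity_pos (G := G) z).ne'
  rw [mixScore]
  field_simp

/-- The risk of the score, compared with that of the best linear rule. -/
theorem integral_mixScore_add_noise_sq (hG : MemLp id 2 G) {v : ℝ} (hv : v = ∫ x, x ^ 2 ∂G) :
    ∫ q, (mixScore G (q.1 + q.2) + q.2) ^ 2 ∂(signalNoise G) = v / (1 + v) -
      ∫ q, (mixScore G (q.1 + q.2) + (1 + v)⁻¹ * (q.1 + q.2)) ^ 2 ∂(signalNoise G) := by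
  have hs := memLp_mixScore hG
  have hZ := memLp_observation hG
  have hv0 : 0 ≤ v := by rw [hv]; exact integral_nonneg fun x => by positivity
  set S := ∫ q, mixScore G (q.1 + q.2) ^ 2 ∂(signalNoise G) with hS
  -- Both integrals are affine in the Fisher information `S`: the risk is `1 - S` and the distance
  -- to the linear score is `S - 1 / (1 + v)`.
  have h1 : ∫ q, (mixScore G (q.1 + q.2) + q.2) ^ 2 ∂(signalNoise G) = 1 - S := by
    have i1 : Integrable (fun q : ℝ × ℝ => q.2 * mixScore G (q.1 + q.2)) (signalNoise G) :=
      memLp_noise.integrable_mul hs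
    calc _ = ∫ q, (mixScore G (q.1 + q.2) ^ 2 + 2 * (q.2 * mixScore G (q.1 + q.2)) + 1 * q.2 ^ 2)
          ∂(signalNoise G) := by congr 1; funext q; ring
      _ = _ := by
        rw [integral_add_add_const_mul hs.integrable_sq i1 memLp_noise.integrable_sq,
          integral_noise_mul_mixScore hG, integral_noise_sq]
        ring
  have h2 : ∫ q, (mixScore G (q.1 + q.2) + (1 + v)⁻¹ * (q.1 + q.2)) ^ 2 ∂(signalNoise G) =
      S - (1 + v)⁻¹ := by
    have i1 : Integrable (fun q : ℝ × ℝ => (q.1 + q.2) * mixScore G (q.1 + q.2))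
      (signalNoise G) := hZ.integrable_mul hs
    have i2 : Integrable (fun q : ℝ × ℝ => (q.1 + q.2) ^ 2) (signalNoise G) := hZ.integrable_sq
    calc _ = ∫ q, (mixScore G (q.1 + q.2) ^ 2 +
            (2 * (1 + v)⁻¹) * ((q.1 + q.2) * mixScore G (q.1 + q.2)) +
            ((1 + v)⁻¹) ^ 2 * (q.1 + q.2) ^ 2) ∂(signalNoise G) := by congr 1; funext q; ring
      _ = _ := by
        rw [integral_add_add_const_mul hs.integrable_sq i1 i2,
          integral_observation_mul_mixScore hG, integral_observation_sq hG, ← hv]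
        field_simp
        ring
  rw [h1, h2]
  field_simp
  ring

/-- A mixture with a linear score is normal. -/
theorem map_eq_gaussianReal_of_mixScore {w : ℝ≥0} (hw : 0 < w)
    (h : ∀ z, mixDensityDeriv G z = -((w : ℝ)⁻¹ * z) * mixDensity G z) :
    (signalNoise G).map (fun q => q.1 + q.2) = gaussianReal 0 w := by
  have hw' : (0 : ℝ) < w := by exact_mod_cast hw
  -- The linear score is a first-order differential equation for the density, solved with an
  -- integrating factor; total mass 1 fixes the remaining constant.
  have hconst : ∀ z, mixDensity G z * Real.exp (z ^ 2 / (2 * w)) = mixDensity G 0 := by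
    intro z
    have hd : ∀ z, HasDerivAt (fun z => mixDensity G z * Real.exp (z ^ 2 / (2 * w))) 0 z := by
      intro z
      have h2 : HasDerivAt (fun z : ℝ => z ^ 2 / (2 * w)) ((w : ℝ)⁻¹ * z) z := by
        refine ((hasDerivAt_pow 2 z).div_const _).congr_deriv ?_
        field_simp
        simp
      refine ((hasDerivAt_mixDensity z).mul h2.exp).congr_deriv ?_
      rw [h z]; ring
    have := is_const_of_deriv_eq_zero (fun z => (hd z).differentiableAt) (fun z => (hd z).deriv) z 0
    simpa using this
  set κ := mixDensity G 0 * √(2 * Real.pi * w) with hκ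
  have hpi := Real.pi_pos
  have hpdf : ∀ z, mixDensity G z = κ * gaussianPDFReal 0 w z := by
    intro z
    have h1 : 0 < √(2 * Real.pi * w) := Real.sqrt_pos.2 (by positivity)
    rw [hκ, gaussianPDFReal, sub_zero, neg_div, Real.exp_neg, ← hconst z]
    have := Real.exp_pos (z ^ 2 / (2 * w))
    field_simp
  have hadd : Measurable fun q : ℝ × ℝ => q.1 + q.2 := by fun_prop
  have hreal : ∀ B, MeasurableSet B →
      ((signalNoise G).map fun q => q.1 + q.2).real B = κ * ∫ z in B, gaussianPDFReal 0 w z := by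
    intro B hB
    have hI : Integrable (fun q : ℝ × ℝ => B.indicator (fun _ => (1 : ℝ)) (q.1 + q.2))
        (signalNoise G) := by
      refine (integrable_const (1 : ℝ)).mono'
        ((measurable_const.indicator hB).comp hadd).aestronglyMeasurable (ae_of_all _ fun q => ?_)
      exact (norm_indicator_le_norm_self _ _).trans (by simp)
    have h1 := (integral_observation (g := B.indicator fun _ => (1 : ℝ)) hI).2
    have h2 : ∫ q, B.indicator (fun _ => (1 : ℝ)) (q.1 + q.2) ∂(signalNoise G) =
        ((signalNoise G).map fun q => q.1 + q.2).real B := by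
      rw [← integral_indicator_one hB, integral_map hadd.aemeasurable
        (measurable_one.indicator hB).aestronglyMeasurable]
      rfl
    rw [← h2, h1, ← integral_const_mul, ← integral_indicator hB]
    congr 1; funext z
    by_cases hz : z ∈ B
    · simp [hz, hpdf]
    · simp [hz]
  have hp : IsProbabilityMeasure ((signalNoise G).map fun q => q.1 + q.2) :=
    Measure.isProbabilityMeasure_map hadd.aemeasurable
  have hκ1 : κ = 1 := by
    have h1 := hreal Set.univ MeasurableSet.univ
    rw [setIntegral_univ, integral_gaussianPDFReal_eq_one 0 hw.ne'] at h1
    simpa using h1.symm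
  ext B hB
  rw [gaussianReal_apply_eq_integral 0 hw.ne', ← ofReal_measureReal, hreal B hB, hκ1, one_mul]

/-- If the mixture is not normal then the risk of the score is less than the best linear one. -/
theorem integral_mixScore_add_noise_sq_lt (hG : MemLp id 2 G)
    (hnn : ∀ w : ℝ≥0, (signalNoise G).map (fun q => q.1 + q.2) ≠ gaussianReal 0 w)
    {v : ℝ} (hv : v = ∫ x, x ^ 2 ∂G) :
    ∫ q, (mixScore G (q.1 + q.2) + q.2) ^ 2 ∂(signalNoise G) < v / (1 + v) := by
  rw [integral_mixScore_add_noise_sq hG hv]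
  have hv0 : 0 ≤ v := by rw [hv]; exact integral_nonneg fun x => by positivity
  set g : ℝ → ℝ := fun z => (mixScore G z + (1 + v)⁻¹ * z) ^ 2 with hg
  have hgI : Integrable (fun q : ℝ × ℝ => g (q.1 + q.2)) (signalNoise G) :=
    ((memLp_mixScore hG).add ((memLp_observation hG).const_mul _)).integrable_sq
  have hg0 : 0 ≤ ∫ q, g (q.1 + q.2) ∂(signalNoise G) := integral_nonneg fun q => sq_nonneg _
  rcases hg0.lt_or_eq with hlt | heq
  · exact sub_lt_self _ hlt
  exfalso
  obtain ⟨h1, h2⟩ := integral_observation hgI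
  rw [h2] at heq
  have h3 := (integral_eq_zero_iff_of_nonneg
    (fun z => mul_nonneg (sq_nonneg _) (mixDensity_pos z).le) h1).1 heq.symm
  have hc : Continuous fun z => g z * mixDensity G z :=
    (((continuous_mixScore).add (by fun_prop)).pow 2).mul continuous_mixDensity
  -- Continuity upgrades vanishing almost everywhere to vanishing everywhere, and the density is
  -- positive, so equality of the risks would make the score linear at every point.
  have h4 := (hc.ae_eq_iff_eq volume continuous_zero).1 h3
  refine hnn (NNReal.mk (1 + v) (by positivity)) (map_eq_gaussianReal_of_mixScore ?_ fun z => ?_)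
  · rw [← NNReal.coe_pos]; exact (by positivity : (0 : ℝ) < 1 + v)
  · have h5 := congrFun h4 z
    have hf := mixDensity_pos (G := G) z
    have h6 : mixScore G z + (1 + v)⁻¹ * z = 0 := by
      rcases mul_eq_zero.1 h5 with h6 | h6
      · exact pow_eq_zero_iff two_ne_zero |>.1 h6
      · exact absurd h6 hf.ne'
    rw [mixScore] at h6
    have h7 : mixDensityDeriv G z / mixDensity G z = -((1 + v)⁻¹ * z) := by linarith
    rw [div_eq_iff hf.ne'] at h7
    exact h7

end Gap

end EBKalman

/-! ### Empirical means of weakly dependent approximations -/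

namespace EBKalman

section LpNormBounds

variable {Ω : Type*} [MeasurableSpace Ω] {P : Measure Ω} [IsProbabilityMeasure P]

theorem lpNorm_le_const_mul {F D : Ω → ℝ} {L : ℝ} (hD : MemLp D 2 P) (hL : 0 ≤ L)
    (h : ∀ ω, |F ω| ≤ L * |D ω|) : lpNorm F 2 P ≤ L * lpNorm D 2 P := by
  have h1 := lpNorm_mono_real (f := F) (hD.abs.const_mul L) h
  rw [lpNorm_const_mul_eq, abs_of_nonneg hL, lpNorm_abs hD.1] at h1
  exact h1

theorem lpNorm_le_of_abs_le {F : Ω → ℝ} {c : ℝ} (hc : 0 ≤ c) (h : ∀ ω, |F ω| ≤ c) :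
    lpNorm F 2 P ≤ c := by
  have h1 := lpNorm_le_const_mul (P := P) (F := F) (D := fun _ => (1 : ℝ)) (memLp_const 1) hc
    (by simpa using h)
  have h2 : lpNorm (fun _ : Ω => (1 : ℝ)) 2 P = 1 := by
    rw [lpNorm_const (by norm_num) (IsProbabilityMeasure.ne_zero P)]; simp
  rwa [h2, mul_one] at h1

theorem memLp_of_abs_le {F : Ω → ℝ} {c : ℝ} (hm : Measurable F) (h : ∀ ω, |F ω| ≤ c) :
    MemLp F 2 P :=
  MemLp.of_bound hm.aestronglyMeasurable c (ae_of_all _ h)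

theorem lpNorm_fun_add_le {F D : Ω → ℝ} (hF : MemLp F 2 P) :
    lpNorm (fun ω => F ω + D ω) 2 P ≤ lpNorm F 2 P + lpNorm D 2 P :=
  lpNorm_add_le hF (by norm_num)

theorem abs_integral_mul_le_of_abs_le {F D : Ω → ℝ} {c : ℝ} (hc : 0 ≤ c) (hF : ∀ ω, |F ω| ≤ c)
    (hD : ∀ ω, |D ω| ≤ c) : ∫ ω, F ω * D ω ∂P ≤ c ^ 2 := by
  have h := abs_integral_le_of_abs_le (μ := P) (f := fun ω => F ω * D ω)
    (integrable_const (c ^ 2)) fun ω => by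
      rw [abs_mul, sq]
      exact mul_le_mul (hF ω) (hD ω) (abs_nonneg _) hc
  simp only [integral_const, probReal_univ, one_smul] at h
  exact (le_abs_self _).trans h

/-- The `L²` norm of a sum of bounded centred variables each of which depends on few others. -/
theorem lpNorm_sum_le_of_indepFun {ι : Type*} [DecidableEq ι] (B : Finset ι) {V : ι → Ω → ℝ}
    {c : ℝ} {d : ℕ} (hc : 0 ≤ c) (hm : ∀ i, Measurable (V i)) (hV : ∀ i ω, |V i ω| ≤ c)
    (h0 : ∀ i, ∫ ω, V i ω ∂P = 0)
    (hind : ∀ i ∈ B, ∃ S : Finset ι, S.card ≤ d ∧ ∀ j ∈ B, j ∉ S → IndepFun (V i) (V j) P) :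
    lpNorm (fun ω => ∑ i ∈ B, V i ω) 2 P ≤ c * √(B.card * d) := by
  have hmem : ∀ i, MemLp (V i) 2 P := fun i => memLp_of_abs_le (hm i) (hV i)
  have hS : MemLp (fun ω => ∑ i ∈ B, V i ω) 2 P := memLp_finsetSum _ fun i _ => hmem i
  have hI : ∀ i j, Integrable (fun ω => V i ω * V j ω) P := fun i j =>
    (hmem i).integrable_mul (hmem j)
  refine abs_le_of_sq_le_sq' ?_ (by positivity) |>.2
  rw [lpNorm_two_sq hS, mul_pow, Real.sq_sqrt (by positivity)]
  have e : ∀ ω, (∑ i ∈ B, V i ω) ^ 2 = ∑ i ∈ B, ∑ j ∈ B, V i ω * V j ω := fun ω => by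
    rw [sq, Finset.sum_mul_sum]
  simp only [e]
  rw [integral_finsetSum _ fun i _ => integrable_finsetSum _ fun j _ => hI i j]
  -- Only the at most `d` neighbours of `i` contribute; the other covariances vanish by independence
  -- and centring.
  have key : ∀ i ∈ B, ∫ ω, ∑ j ∈ B, V i ω * V j ω ∂P ≤ d * c ^ 2 := by
    intro i hi
    obtain ⟨S, hSd, hSi⟩ := hind i hi
    rw [integral_finsetSum _ fun j _ => hI i j]
    calc ∑ j ∈ B, ∫ ω, V i ω * V j ω ∂P ≤ ∑ j ∈ B, if j ∈ S then c ^ 2 else 0 := by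
          refine Finset.sum_le_sum fun j hj => ?_
          split_ifs with hjS
          · exact abs_integral_mul_le_of_abs_le hc (hV i) (hV j)
          · have := (hSi j hj hjS).integral_mul_eq_mul_integral (hm i).aestronglyMeasurable
              (hm j).aestronglyMeasurable
            rw [h0, zero_mul] at this
            exact this.le
      _ = ((B.filter (· ∈ S)).card : ℝ) * c ^ 2 := by
          rw [← Finset.sum_filter, Finset.sum_const, nsmul_eq_mul]
      _ ≤ d * c ^ 2 := by
          gcongr
          refine le_trans (Finset.card_le_card fun j hj => ?_) hSd
          exact (Finset.mem_filter.1 hj).2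
  calc _ ≤ ∑ i ∈ B, (d : ℝ) * c ^ 2 := Finset.sum_le_sum key
    _ = _ := by rw [Finset.sum_const, nsmul_eq_mul]; ring

end LpNormBounds

/-- The points `Z i` with `i` in `B` are close to points `X i + e i` distributed as a signal plus
noise, and to points `W i` each of which depends on few of the others. -/
structure BulkCoupling {Ω : Type*} [MeasurableSpace Ω] (P : Measure Ω) (G : Measure ℝ) {n : ℕ}
    (Z e X W : Fin n → Ω → ℝ) (B : Finset (Fin n)) (α : ℝ) (b d : ℕ) : Prop where
  meas_Z : ∀ i, Measurable (Z i)
  meas_e : ∀ i, Measurable (e i)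
  meas_X : ∀ i, Measurable (X i)
  meas_W : ∀ i, Measurable (W i)
  memLp_Z : ∀ i, MemLp (Z i) 2 P
  memLp_e : ∀ i, MemLp (e i) 2 P
  memLp_X : ∀ i ∈ B, MemLp (X i) 2 P
  memLp_W : ∀ i, MemLp (W i) 2 P
  law : ∀ i ∈ B, P.map (fun ω => (X i ω, e i ω)) = signalNoise G
  close_Z : ∀ i ∈ B, lpNorm (fun ω => Z i ω - (X i ω + e i ω)) 2 P ≤ α
  close_W : ∀ i ∈ B, lpNorm (fun ω => W i ω - (X i ω + e i ω)) 2 P ≤ α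
  indep : ∀ i ∈ B, ∃ S : Finset (Fin n), S.card ≤ d ∧ ∀ j ∈ B, j ∉ S → IndepFun (W i) (W j) P
  card_compl : Bᶜ.card ≤ b
  noise_sq : ∀ i, ∫ ω, e i ω ^ 2 ∂P = 1
  nonneg : 0 ≤ α

namespace BulkCoupling

variable {Ω : Type*} [MeasurableSpace Ω] {P : Measure Ω} [IsProbabilityMeasure P] {G : Measure ℝ}
  [IsProbabilityMeasure G] {n : ℕ} {Z e X W : Fin n → Ω → ℝ} {B : Finset (Fin n)} {α : ℝ}
  {b d : ℕ}

theorem integral_eq (h : BulkCoupling P G Z e X W B α b d) {i : Fin n} (hi : i ∈ B)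
    {F : ℝ × ℝ → ℝ} (hF : Measurable F) :
    ∫ ω, F (X i ω, e i ω) ∂P = ∫ q, F q ∂(signalNoise G) := by
  rw [← h.law i hi, integral_map ((h.meas_X i).prodMk (h.meas_e i)).aemeasurable
    hF.aestronglyMeasurable]

theorem memLp_sum (h : BulkCoupling P G Z e X W B α b d) {i : Fin n} (hi : i ∈ B) :
    MemLp (fun ω => X i ω + e i ω) 2 P := (h.memLp_X i hi).add (h.memLp_e i)

/-- Empirical means of bounded Lipschitz functions are close to the expectations. -/
theorem lpNorm_empirical_sub_le (h : BulkCoupling P G Z e X W B α b d) (hn : 0 < n) {κ : ℝ → ℝ}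
    {M L : ℝ} (hκ : Measurable κ) (hM : ∀ x, |κ x| ≤ M) (hL : 0 ≤ L)
    (hLip : ∀ x y, |κ x - κ y| ≤ L * |x - y|) :
    lpNorm (fun ω => (n : ℝ)⁻¹ * ∑ i, κ (Z i ω) - ∫ q, κ (q.1 + q.2) ∂(signalNoise G)) 2 P ≤
      3 * L * α + 2 * M * √(d / n) + 2 * M * b / n := by
  have hn' : (0 : ℝ) < n := by exact_mod_cast hn
  have hM0 : 0 ≤ M := (abs_nonneg _).trans (hM 0)
  set m := ∫ q, κ (q.1 + q.2) ∂(signalNoise G) with hm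
  have hκZ : ∀ i, Measurable fun ω => κ (Z i ω) := fun i => hκ.comp (h.meas_Z i)
  have hκW : ∀ i, Measurable fun ω => κ (W i ω) := fun i => hκ.comp (h.meas_W i)
  have hκX : ∀ i, Measurable fun ω => κ (X i ω + e i ω) := fun i =>
    hκ.comp ((h.meas_X i).add (h.meas_e i))
  have hmM : |m| ≤ M := by
    have := abs_integral_le_of_abs_le (μ := signalNoise G) (f := fun q => κ (q.1 + q.2))
      (integrable_const M) fun q => hM _
    simpa using this
  have hEM : ∀ i, |∫ ω, κ (W i ω) ∂P| ≤ M := fun i => by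
    have := abs_integral_le_of_abs_le (μ := P) (f := fun ω => κ (W i ω))
      (integrable_const M) fun q => hM _
    simpa using this
  have mem1 : ∀ i, MemLp (fun ω => κ (Z i ω) - κ (W i ω)) 2 P := fun i =>
    (memLp_of_abs_le (hκZ i) fun ω => hM _).sub (memLp_of_abs_le (hκW i) fun ω => hM _)
  have mem2 : ∀ i, MemLp (fun ω => κ (W i ω) - ∫ ω, κ (W i ω) ∂P) 2 P := fun i =>
    (memLp_of_abs_le (hκW i) fun ω => hM _).sub (memLp_const _)
  have mem4 : ∀ i, MemLp (fun ω => κ (Z i ω) - m) 2 P := fun i =>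
    (memLp_of_abs_le (hκZ i) fun ω => hM _).sub (memLp_const _)
  have dWX : ∀ i ∈ B, MemLp (fun ω => W i ω - (X i ω + e i ω)) 2 P := fun i hi =>
    (h.memLp_W i).sub (h.memLp_sum hi)
  have dZX : ∀ i ∈ B, MemLp (fun ω => Z i ω - (X i ω + e i ω)) 2 P := fun i hi =>
    (h.memLp_Z i).sub (h.memLp_sum hi)
  have hB : (B.card : ℝ) ≤ n := by
    have := Finset.card_le_univ B
    rw [Fintype.card_fin] at this
    exact_mod_cast this
  have t1 : lpNorm (fun ω => ∑ i ∈ B, (κ (Z i ω) - κ (W i ω))) 2 P ≤ n * (2 * L * α) := by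
    refine (lpNorm_fun_sum_le B fun i _ => mem1 i).trans ?_
    calc _ ≤ ∑ i ∈ B, 2 * L * α := by
          refine Finset.sum_le_sum fun i hi => ?_
          calc _ ≤ L * lpNorm (fun ω => (Z i ω - (X i ω + e i ω)) -
                (W i ω - (X i ω + e i ω))) 2 P := by
                refine lpNorm_le_const_mul ((dZX i hi).sub (dWX i hi)) hL fun ω => ?_
                rw [sub_sub_sub_cancel_right]
                exact hLip _ _
            _ ≤ L * (α + α) := by
                gcongr
                exact (lpNorm_sub_le (dZX i hi) (by norm_num)).trans
                  (add_le_add (h.close_Z i hi) (h.close_W i hi))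
            _ = _ := by ring
      _ = B.card * (2 * L * α) := by rw [Finset.sum_const, nsmul_eq_mul]
      _ ≤ _ := by have := h.nonneg; gcongr
  have t2 : lpNorm (fun ω => ∑ i ∈ B, (κ (W i ω) - ∫ ω, κ (W i ω) ∂P)) 2 P ≤
      2 * M * √(n * d) := by
    refine (lpNorm_sum_le_of_indepFun B (c := 2 * M) (d := d) (by positivity)
      (fun i => (hκW i).sub_const _) (fun i ω => ?_) (fun i => ?_) fun i hi => ?_).trans ?_
    · have := abs_sub (κ (W i ω)) (∫ ω, κ (W i ω) ∂P)
      linarith [hM (W i ω), hEM i]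
    · rw [integral_sub ((memLp_of_abs_le (hκW i) fun ω => hM _).integrable (by norm_num))
        (integrable_const _)]
      simp
    · obtain ⟨S, hS, hi'⟩ := h.indep i hi
      refine ⟨S, hS, fun j hj hjS => ?_⟩
      exact (hi' j hj hjS).comp (φ := fun x => κ x - ∫ ω, κ (W i ω) ∂P)
        (ψ := fun x => κ x - ∫ ω, κ (W j ω) ∂P) (hκ.sub_const _) (hκ.sub_const _)
    · gcongr
  have t3 : lpNorm (fun _ : Ω => ∑ i ∈ B, ((∫ ω, κ (W i ω) ∂P) - m)) 2 P ≤ n * (L * α) := by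
    have hLα : 0 ≤ L * α := mul_nonneg hL h.nonneg
    refine lpNorm_le_of_abs_le (by positivity) fun _ => ?_
    refine (Finset.abs_sum_le_sum_abs _ _).trans ?_
    calc _ ≤ ∑ i ∈ B, L * α := by
          refine Finset.sum_le_sum fun i hi => ?_
          have e1 : m = ∫ ω, κ (X i ω + e i ω) ∂P :=
            (h.integral_eq hi (F := fun q => κ (q.1 + q.2)) (hκ.comp (by fun_prop))).symm
          have m1 := memLp_of_abs_le (P := P) (hκW i) fun ω => hM _
          have m2 := memLp_of_abs_le (P := P) (hκX i) fun ω => hM _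
          rw [e1, ← integral_sub (m1.integrable (by norm_num)) (m2.integrable (by norm_num))]
          refine (abs_integral_le_lpNorm (m1.sub m2)).trans ?_
          refine (lpNorm_le_const_mul (dWX i hi) hL fun ω => hLip _ _).trans ?_
          gcongr
          exact h.close_W i hi
      _ = B.card * (L * α) := by rw [Finset.sum_const, nsmul_eq_mul]
      _ ≤ _ := by gcongr
  have t4 : lpNorm (fun ω => ∑ i ∈ Bᶜ, (κ (Z i ω) - m)) 2 P ≤ b * (2 * M) := by
    refine lpNorm_le_of_abs_le (by positivity) fun ω => ?_
    refine (Finset.abs_sum_le_sum_abs _ _).trans ?_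
    calc _ ≤ ∑ i ∈ Bᶜ, 2 * M := by
          refine Finset.sum_le_sum fun i hi => ?_
          have := abs_sub (κ (Z i ω)) m
          linarith [hM (Z i ω)]
      _ = Bᶜ.card * (2 * M) := by rw [Finset.sum_const, nsmul_eq_mul]
      _ ≤ _ := by have := h.card_compl; gcongr
  -- The four sums are the passage from `Z` to the finite-window variables `W`, the fluctuation of
  -- `W`, the bias of `W` against the stationary law, and the coordinates outside `B`.
  have edec : ∀ ω, (n : ℝ)⁻¹ * ∑ i, κ (Z i ω) - m = (n : ℝ)⁻¹ *
      ((∑ i ∈ B, (κ (Z i ω) - κ (W i ω)) + ∑ i ∈ B, (κ (W i ω) - ∫ ω, κ (W i ω) ∂P)) +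
        (∑ i ∈ B, ((∫ ω, κ (W i ω) ∂P) - m) + ∑ i ∈ Bᶜ, (κ (Z i ω) - m))) := by
    intro ω
    have h1 : (n : ℝ)⁻¹ * ∑ i, κ (Z i ω) - m = (n : ℝ)⁻¹ * ∑ i, (κ (Z i ω) - m) := by
      rw [Finset.sum_sub_distrib, Finset.sum_const, Finset.card_univ, Fintype.card_fin,
        nsmul_eq_mul]
      field_simp
    rw [h1, ← Finset.sum_add_sum_compl B, ← add_assoc, ← Finset.sum_add_distrib,
      ← Finset.sum_add_distrib]
    congr 2
    refine Finset.sum_congr rfl fun i _ => ?_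
    ring
  simp only [edec]
  rw [lpNorm_const_mul_eq, abs_of_pos (inv_pos.2 hn')]
  have hs : lpNorm (fun ω =>
      (∑ i ∈ B, (κ (Z i ω) - κ (W i ω)) + ∑ i ∈ B, (κ (W i ω) - ∫ ω, κ (W i ω) ∂P)) +
        (∑ i ∈ B, ((∫ ω, κ (W i ω) ∂P) - m) + ∑ i ∈ Bᶜ, (κ (Z i ω) - m))) 2 P ≤
      (n * (2 * L * α) + 2 * M * √(n * d)) + (n * (L * α) + b * (2 * M)) := by
    have q1 : MemLp (fun ω => ∑ i ∈ B, (κ (Z i ω) - κ (W i ω))) 2 P :=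
      memLp_finsetSum _ fun i _ => mem1 i
    have q2 : MemLp (fun ω => ∑ i ∈ B, (κ (W i ω) - ∫ ω, κ (W i ω) ∂P)) 2 P :=
      memLp_finsetSum _ fun i _ => mem2 i
    refine (lpNorm_fun_add_le (q1.add q2)).trans (add_le_add ?_ ?_)
    · exact (lpNorm_fun_add_le q1).trans (add_le_add t1 t2)
    · exact (lpNorm_fun_add_le (memLp_const _)).trans (add_le_add t3 t4)
  have hsq : √(n * d) = n * √(d / n) := by
    rw [show (n : ℝ) * d = n ^ 2 * (d / n) by field_simp, Real.sqrt_mul (by positivity),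
      Real.sqrt_sq hn'.le]
  calc _ ≤ (n : ℝ)⁻¹ *
        ((n * (2 * L * α) + 2 * M * √(n * d)) + (n * (L * α) + b * (2 * M))) := by gcongr
    _ = _ := by
      rw [hsq]
      field_simp
      ring

end BulkCoupling

end EBKalman

/-! ### The risk of the estimated score -/

namespace EBKalman

/-- A Lipschitz function is controlled by its values on a grid. -/
theorem sq_le_sum_grid {H : ℝ → ℝ} {Λ R δ y : ℝ} (hH : ∀ x y, |H x - H y| ≤ Λ * |x - y|)
    (hΛ : 0 ≤ Λ) (hδ : 0 < δ) (hy : |y| ≤ R) :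
    H y ^ 2 ≤ 2 * ∑ k ∈ Finset.range (⌊2 * R / δ⌋₊ + 1), H (-R + k * δ) ^ 2 +
      2 * (Λ * δ) ^ 2 := by
  obtain ⟨hy1, hy2⟩ := abs_le.1 hy
  set k := ⌊(y + R) / δ⌋₊ with hk
  have h0 : 0 ≤ (y + R) / δ := div_nonneg (by linarith) hδ.le
  have hkm : k ∈ Finset.range (⌊2 * R / δ⌋₊ + 1) := by
    rw [Finset.mem_range, Nat.lt_succ_iff]
    refine Nat.floor_le_floor ?_
    gcongr
    linarith
  have h1 : (k : ℝ) * δ ≤ y + R := by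
    have := Nat.floor_le h0
    rwa [le_div_iff₀ hδ] at this
  have h2 : y + R < (k + 1) * δ := by
    have := Nat.lt_floor_add_one ((y + R) / δ)
    rwa [div_lt_iff₀ hδ] at this
  have h3 : |H y - H (-R + k * δ)| ≤ Λ * δ := by
    refine (hH _ _).trans ?_
    gcongr
    rw [abs_le]
    constructor <;> linarith
  have h4 : H y ^ 2 ≤ 2 * H (-R + k * δ) ^ 2 + 2 * (Λ * δ) ^ 2 := by
    have h5 : (H y - H (-R + k * δ)) ^ 2 ≤ (Λ * δ) ^ 2 := by
      rw [sq_le_sq, abs_of_nonneg (by positivity : 0 ≤ Λ * δ)]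
      exact h3
    nlinarith [sq_nonneg (H y - 2 * H (-R + k * δ))]
  have h6 : H (-R + k * δ) ^ 2 ≤
      ∑ k ∈ Finset.range (⌊2 * R / δ⌋₊ + 1), H (-R + k * δ) ^ 2 :=
    Finset.single_le_sum (f := fun k : ℕ => H (-R + k * δ) ^ 2) (fun _ _ => sq_nonneg _) hkm
  linarith

/-- Ratios of nearby numerators and denominators. -/
theorem div_sub_div_sq_le {f f' p p' η K : ℝ} (hf : 0 < f) (hf' : |f'| ≤ K * f) (hK : 0 ≤ K)
    (hη : 0 < η) (hp : η ≤ p) :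
    (f' / f - p' / p) ^ 2 ≤ η⁻¹ ^ 2 * (2 * ((f' - p') ^ 2 + K ^ 2 * (f - p) ^ 2)) := by
  have hp0 : 0 < p := hη.trans_le hp
  -- In this form the random denominator `f` enters only through the bounded ratio `f' / f`, so a
  -- lower bound is needed for `p` alone.
  have e : f' / f - p' / p = p⁻¹ * ((f' - p') - f' / f * (f - p)) := by
    field_simp
    ring
  have h1 : |f' / f| ≤ K := by
    rw [abs_div, abs_of_pos hf, div_le_iff₀ hf]; exact hf'
  have h2 : (f' / f) ^ 2 ≤ K ^ 2 := by rw [sq_le_sq, abs_of_nonneg hK]; exact h1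
  have h3 : p⁻¹ ^ 2 ≤ η⁻¹ ^ 2 := by gcongr
  rw [e, mul_pow]
  have h4 : ((f' - p') - f' / f * (f - p)) ^ 2 ≤ 2 * ((f' - p') ^ 2 + K ^ 2 * (f - p) ^ 2) := by
    have h5 : (f' / f * (f - p)) ^ 2 ≤ K ^ 2 * (f - p) ^ 2 := by rw [mul_pow]; gcongr
    nlinarith [sq_nonneg ((f' - p') + f' / f * (f - p))]
  gcongr

/-- The difference of the empirical mean and the expectation of `κ (· - z)`. -/
noncomputable def empiricalGap {Ω : Type*} (G : Measure ℝ) {n : ℕ} (Z : Fin n → Ω → ℝ)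
    (κ : ℝ → ℝ) (z : ℝ) (ω : Ω) : ℝ :=
  (n : ℝ)⁻¹ * ∑ i, κ (Z i ω - z) - ∫ q, κ (q.1 + q.2 - z) ∂(signalNoise G)

namespace BulkCoupling

variable {Ω : Type*} [MeasurableSpace Ω] {P : Measure Ω} [IsProbabilityMeasure P] {G : Measure ℝ}
  [IsProbabilityMeasure G] {n : ℕ} {Z e X W : Fin n → Ω → ℝ} {B : Finset (Fin n)} {α : ℝ}
  {b d : ℕ} {κ : ℝ → ℝ} {M L : ℝ}

theorem memLp_empiricalGap (h : BulkCoupling P G Z e X W B α b d) (hκ : Continuous κ)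
    (hM : ∀ x, |κ x| ≤ M) (z : ℝ) : MemLp (empiricalGap G Z κ z) 2 P := by
  have h1 : ∀ i, MemLp (fun ω => κ (Z i ω - z)) 2 P := fun i =>
    memLp_of_abs_le (hκ.measurable.comp ((h.meas_Z i).sub_const z)) fun ω => hM _
  exact ((memLp_finsetSum _ fun i _ => h1 i).const_mul _).sub (memLp_const _)

theorem lpNorm_empiricalGap_le (h : BulkCoupling P G Z e X W B α b d) (hn : 0 < n)
    (hκ : Continuous κ) (hM : ∀ x, |κ x| ≤ M) (hL : 0 ≤ L)
    (hLip : ∀ x y, |κ x - κ y| ≤ L * |x - y|) (z : ℝ) :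
    lpNorm (empiricalGap G Z κ z) 2 P ≤ 3 * L * α + 2 * M * √(d / n) + 2 * M * b / n := by
  refine h.lpNorm_empirical_sub_le hn (κ := fun x => κ (x - z))
    (hκ.measurable.comp (by fun_prop)) (fun x => hM _) hL fun x y => ?_
  simpa using hLip (x - z) (y - z)

theorem abs_empiricalGap_sub_le (hn : 0 < n) (hκ : Continuous κ)
    (hM : ∀ x, |κ x| ≤ M) (hLip : ∀ x y, |κ x - κ y| ≤ L * |x - y|) (ω : Ω) (z z' : ℝ) :
    |empiricalGap G Z κ z ω - empiricalGap G Z κ z' ω| ≤ 2 * L * |z - z'| := by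
  have hn' : (0 : ℝ) < n := by exact_mod_cast hn
  have hI : ∀ z, Integrable (fun q : ℝ × ℝ => κ (q.1 + q.2 - z)) (signalNoise G) := fun z =>
    (integrable_const M).mono' (hκ.comp (by fun_prop)).aestronglyMeasurable
      (ae_of_all _ fun q => hM _)
  have hs : ∀ x, |κ (x - z) - κ (x - z')| ≤ L * |z - z'| := fun x => by
    have := hLip (x - z) (x - z')
    rwa [sub_sub_sub_cancel_left, abs_sub_comm z'] at this
  have h1 : |(n : ℝ)⁻¹ * ∑ i, (κ (Z i ω - z) - κ (Z i ω - z'))| ≤ L * |z - z'| := by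
    rw [abs_mul, abs_of_pos (inv_pos.2 hn'), inv_mul_le_iff₀ hn']
    refine (Finset.abs_sum_le_sum_abs _ _).trans ?_
    refine (Finset.sum_le_sum fun i _ => hs (Z i ω)).trans ?_
    simp
  have h2 : |∫ q, (κ (q.1 + q.2 - z) - κ (q.1 + q.2 - z')) ∂(signalNoise G)| ≤ L * |z - z'| := by
    have := abs_integral_le_of_abs_le (μ := signalNoise G)
      (f := fun q => κ (q.1 + q.2 - z) - κ (q.1 + q.2 - z'))
      (integrable_const (L * |z - z'|)) fun q => hs _
    simpa using this
  rw [integral_sub (hI z) (hI z')] at h2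
  rw [Finset.sum_sub_distrib, mul_sub] at h1
  have e : empiricalGap G Z κ z ω - empiricalGap G Z κ z' ω =
      ((n : ℝ)⁻¹ * ∑ i, κ (Z i ω - z) - (n : ℝ)⁻¹ * ∑ i, κ (Z i ω - z')) -
      (∫ q, κ (q.1 + q.2 - z) ∂(signalNoise G) - ∫ q, κ (q.1 + q.2 - z') ∂(signalNoise G)) := by
    rw [empiricalGap, empiricalGap]; ring
  rw [e]
  refine (abs_sub _ _).trans ?_
  linarith

/-- The bound for the squared gap over `[-R, R]`: a function of `ω` and its expectation. -/
theorem exists_envelope (h : BulkCoupling P G Z e X W B α b d) (hn : 0 < n)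
    (hκ : Continuous κ) (hM : ∀ x, |κ x| ≤ M) (hL : 0 ≤ L)
    (hLip : ∀ x y, |κ x - κ y| ≤ L * |x - y|) {R δ : ℝ} (hR : 0 < R) (hδ : 0 < δ) :
    ∃ F : Ω → ℝ, Integrable F P ∧ (∀ ω, 0 ≤ F ω) ∧
      (∀ ω y, |y| ≤ R → empiricalGap G Z κ y ω ^ 2 ≤ F ω) ∧
      ∫ ω, F ω ∂P ≤ 2 * (2 * R / δ + 1) * (3 * L * α + 2 * M * √(d / n) + 2 * M * b / n) ^ 2 +
        2 * (2 * L * δ) ^ 2 := by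
  set r := 3 * L * α + 2 * M * √(d / n) + 2 * M * b / n
  have hI : ∀ z, Integrable (fun ω => empiricalGap G Z κ z ω ^ 2) P := fun z =>
    (h.memLp_empiricalGap hκ hM z).integrable_sq
  have hsum : Integrable (fun ω => ∑ k ∈ Finset.range (⌊2 * R / δ⌋₊ + 1),
      empiricalGap G Z κ (-R + k * δ) ω ^ 2) P := integrable_finsetSum _ fun k _ => hI _
  -- The gap will be evaluated at a random point that depends on the same sample, so a bound uniform
  -- on `[-R, R]` is needed. The sum over a grid of mesh `δ` is a measurable substitute for the
  -- supremum.
  refine ⟨fun ω => 2 * ∑ k ∈ Finset.range (⌊2 * R / δ⌋₊ + 1),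
    empiricalGap G Z κ (-R + k * δ) ω ^ 2 + 2 * (2 * L * δ) ^ 2,
    (hsum.const_mul 2).add (integrable_const _), fun ω => ?_, fun ω y hy => ?_, ?_⟩
  · have : 0 ≤ ∑ k ∈ Finset.range (⌊2 * R / δ⌋₊ + 1), empiricalGap G Z κ (-R + k * δ) ω ^ 2 :=
      Finset.sum_nonneg fun _ _ => sq_nonneg _
    positivity
  · exact sq_le_sum_grid (H := fun y => empiricalGap G Z κ y ω)
      (fun x y => abs_empiricalGap_sub_le hn hκ hM hLip ω x y) (by positivity) hδ hy
  · rw [integral_add (hsum.const_mul 2) (integrable_const _), integral_const_mul,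
      integral_finsetSum _ fun k _ => hI _]
    have h1 : ∀ z, ∫ ω, empiricalGap G Z κ z ω ^ 2 ∂P ≤ r ^ 2 := fun z => by
      rw [← lpNorm_two_sq (h.memLp_empiricalGap hκ hM z)]
      exact pow_le_pow_left₀ lpNorm_nonneg (h.lpNorm_empiricalGap_le hn hκ hM hL hLip z) 2
    have h2 : ∑ k ∈ Finset.range (⌊2 * R / δ⌋₊ + 1),
        ∫ ω, empiricalGap G Z κ (-R + k * δ) ω ^ 2 ∂P ≤ (2 * R / δ + 1) * r ^ 2 := by
      refine (Finset.sum_le_sum fun k _ => h1 _).trans ?_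
      rw [Finset.sum_const, Finset.card_range, nsmul_eq_mul]
      push_cast
      have := Nat.floor_le (by positivity : 0 ≤ 2 * R / δ)
      gcongr
    simp only [integral_const, probReal_univ, one_smul]
    linarith

end BulkCoupling

end EBKalman

namespace EBKalman

theorem measurable_scoreEst {Ω : Type*} [MeasurableSpace Ω] {n : ℕ} {Z : Fin n → Ω → ℝ}
    (hZ : ∀ i, Measurable (Z i)) {Y : Ω → ℝ} (hY : Measurable Y) (σ : ℝ) :
    Measurable fun ω => scoreEst σ (fun j => Z j ω) (Y ω) := by
  have h1 : Measurable fun ω => densityEst σ (fun j => Z j ω) (Y ω) := by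
    simp only [densityEst_eq]
    exact (Finset.measurable_fun_sum _ fun j _ =>
      (continuous_scaledKernel σ).measurable.comp ((hZ j).sub hY)).const_mul _
  have h2 : Measurable fun ω => densityEstDeriv σ (fun j => Z j ω) (Y ω) := by
    simp only [densityEstDeriv]
    exact (Finset.measurable_fun_sum _ fun j _ =>
      ((continuous_scaledKernelDeriv σ).measurable.comp ((hZ j).sub hY)).neg).const_mul _
  exact h2.div h1

/-- The error of the estimated score in terms of the bandwidth `ℓ⁻¹`. -/
noncomputable def scoreError (ℓ C η R δ r : ℝ) : ℝ :=
  16 * ℓ ^ 2 * (C * (R * η + (R ^ 2)⁻¹)) +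
    η⁻¹ ^ 2 * (2 * ((1 + (2 * ℓ) ^ 2) *
      (2 * (2 * R / δ + 1) * r ^ 2 + 2 * (2 * (4 * ℓ ^ 3) * δ) ^ 2)))

/-- The error of the empirical means. -/
noncomputable def empiricalError (ℓ α : ℝ) (b d n : ℕ) : ℝ :=
  3 * (4 * ℓ ^ 3) * α + 2 * (2 * ℓ ^ 2) * √(d / n) + 2 * (2 * ℓ ^ 2) * b / n

namespace BulkCoupling

variable {Ω : Type*} [MeasurableSpace Ω] {P : Measure Ω} [IsProbabilityMeasure P] {G : Measure ℝ}
  [IsProbabilityMeasure G] {n : ℕ} {Z e X W : Fin n → Ω → ℝ} {B : Finset (Fin n)} {α : ℝ}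
  {b d : ℕ} {σ C η R δ : ℝ}

/-- On the rare event that the point is far out or the smoothed density is below `η`, both scores
are at most `2 ℓ` in modulus, whence `16 ℓ ^ 2`. Elsewhere the quotient bound applies with the
envelopes of the errors of `f̂` and `f̂'`. -/
theorem integral_scoreEst_sub_smoothScore_sq_le (h : BulkCoupling P G Z e X W B α b d)
    (hσ : 0 < σ) (hσ1 : σ ≤ 1) (hn : 0 < n) (hη : 0 < η) (hR : 0 < R) (hδ : 0 < δ)
    (hC : (signalNoise G).real {q | smoothDensity G σ (q.1 + q.2) < η ∨ R < |q.1 + q.2|} ≤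
      C * (R * η + (R ^ 2)⁻¹)) {i : Fin n} (hi : i ∈ B) :
    ∫ ω, (scoreEst σ (fun j => Z j ω) (X i ω + e i ω) - smoothScore G σ (X i ω + e i ω)) ^ 2 ∂P ≤
      scoreError σ⁻¹ C η R δ (empiricalError σ⁻¹ α b d n) := by
  set ℓ := σ⁻¹ with hℓ
  have hℓ0 : 0 < ℓ := inv_pos.2 hσ
  have hℓ1 : 1 ≤ ℓ := (one_le_inv₀ hσ).2 hσ1
  have hℓ2 : ℓ ≤ ℓ ^ 2 := by nlinarith
  have hℓ3 : ℓ ^ 2 ≤ ℓ ^ 3 := by nlinarith [pow_pos hℓ0 2]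
  -- The constants are those of the kernel derivative; they are valid for the kernel too because `ℓ
  -- ≥ 1`, so one error term serves both.
  obtain ⟨F, hFI, hF0, hF, hFE⟩ := h.exists_envelope hn (κ := scaledKernel σ) (M := 2 * ℓ ^ 2)
    (L := 4 * ℓ ^ 3) (continuous_scaledKernel σ)
    (fun x => by
      rw [abs_of_pos (scaledKernel_pos hσ x)]
      have := scaledKernel_le hσ x
      nlinarith) (by positivity)
    (fun x y => (abs_scaledKernel_sub_le hσ x y).trans (by
      gcongr ?_ * _
      rw [← hℓ]; nlinarith [pow_pos hℓ0 2])) hR hδ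
  obtain ⟨F', hFI', hF0', hF', hFE'⟩ := h.exists_envelope hn (κ := fun x => -scaledKernelDeriv σ x)
    (M := 2 * ℓ ^ 2) (L := 4 * ℓ ^ 3) (continuous_scaledKernelDeriv σ).neg
    (fun x => by rw [abs_neg]; exact abs_scaledKernelDeriv_le' hσ x) (by positivity)
    (fun x y => by
      rw [← neg_sub', abs_neg]; exact abs_scaledKernelDeriv_sub_le hσ x y) hR hδ
  set E : Set (ℝ × ℝ) := {q | smoothDensity G σ (q.1 + q.2) < η ∨ R < |q.1 + q.2|} with hE
  have hadd : Measurable fun q : ℝ × ℝ => q.1 + q.2 := by fun_prop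
  have hEm : MeasurableSet E :=
    (measurableSet_lt ((measurable_smoothDensity σ).comp hadd) measurable_const).union
      (measurableSet_lt measurable_const (continuous_abs.measurable.comp hadd))
  have hXe : Measurable fun ω => (X i ω, e i ω) := (h.meas_X i).prodMk (h.meas_e i)
  have hIE : Integrable (fun ω => E.indicator (fun _ => (1 : ℝ)) (X i ω, e i ω)) P := by
    refine (integrable_const (1 : ℝ)).mono'
      ((measurable_const.indicator hEm).comp hXe).aestronglyMeasurable (ae_of_all _ fun q => ?_)
    exact (norm_indicator_le_norm_self _ _).trans (by simp)
  have hEE : ∫ ω, E.indicator (fun _ => (1 : ℝ)) (X i ω, e i ω) ∂P ≤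
      C * (R * η + (R ^ 2)⁻¹) := by
    rw [h.integral_eq hi (F := E.indicator fun _ => (1 : ℝ)) (measurable_const.indicator hEm)]
    refine le_trans (le_of_eq ?_) hC
    exact integral_indicator_one hEm
  have hFs : Integrable (fun ω => F' ω + (2 * ℓ) ^ 2 * F ω) P := hFI'.add (hFI.const_mul _)
  have hpt : ∀ ω, (scoreEst σ (fun j => Z j ω) (X i ω + e i ω) -
      smoothScore G σ (X i ω + e i ω)) ^ 2 ≤
      16 * ℓ ^ 2 * E.indicator (fun _ => (1 : ℝ)) (X i ω, e i ω) +
        η⁻¹ ^ 2 * 2 * (F' ω + (2 * ℓ) ^ 2 * F ω) := by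
    intro ω
    have hFn : 0 ≤ η⁻¹ ^ 2 * 2 * (F' ω + (2 * ℓ) ^ 2 * F ω) := by
      have := hF0 ω
      have := hF0' ω
      positivity
    by_cases hq : (X i ω, e i ω) ∈ E
    · rw [Set.indicator_of_mem hq]
      have h1 := abs_scoreEst_le hσ (fun j => Z j ω) (X i ω + e i ω)
      have h2 := abs_smoothScore_le (G := G) hσ (X i ω + e i ω)
      have h3 : |scoreEst σ (fun j => Z j ω) (X i ω + e i ω) - smoothScore G σ (X i ω + e i ω)| ≤
          |4 * ℓ| := by
        rw [abs_of_pos (by positivity : 0 < 4 * ℓ)]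
        refine (abs_sub _ _).trans ?_
        linarith
      have := sq_le_sq.2 h3
      nlinarith
    · rw [Set.indicator_of_notMem hq, mul_zero, zero_add]
      simp only [hE, Set.mem_ofPred_eq, not_or, not_lt] at hq
      have h1 := div_sub_div_sq_le (densityEst_pos hσ hn (fun j => Z j ω) (X i ω + e i ω))
        (abs_densityEstDeriv_le hσ (fun j => Z j ω) (X i ω + e i ω))
        (p' := smoothDensityDeriv G σ (X i ω + e i ω)) (by positivity) hη hq.1
      have h2 := hF ω _ hq.2
      have h3 := hF' ω _ hq.2
      have e2 : empiricalGap G Z (scaledKernel σ) (X i ω + e i ω) ω =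
          densityEst σ (fun j => Z j ω) (X i ω + e i ω) - smoothDensity G σ (X i ω + e i ω) := by
        rw [densityEst_eq]; rfl
      rw [e2] at h2
      change (densityEstDeriv σ (fun j => Z j ω) (X i ω + e i ω) -
        smoothDensityDeriv G σ (X i ω + e i ω)) ^ 2 ≤ _ at h3
      refine h1.trans ?_
      rw [mul_assoc]
      gcongr
  have hJ : ∫ ω, (F' ω + (2 * ℓ) ^ 2 * F ω) ∂P ≤ (1 + (2 * ℓ) ^ 2) *
      (2 * (2 * R / δ + 1) * empiricalError ℓ α b d n ^ 2 + 2 * (2 * (4 * ℓ ^ 3) * δ) ^ 2) := by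
    rw [integral_add hFI' (hFI.const_mul _), integral_const_mul, add_mul, one_mul]
    exact add_le_add hFE' (mul_le_mul_of_nonneg_left hFE (by positivity))
  calc _ ≤ ∫ ω, (16 * ℓ ^ 2 * E.indicator (fun _ => (1 : ℝ)) (X i ω, e i ω) +
        η⁻¹ ^ 2 * 2 * (F' ω + (2 * ℓ) ^ 2 * F ω)) ∂P :=
        integral_mono_of_nonneg (ae_of_all _ fun ω => sq_nonneg _)
          ((hIE.const_mul _).add (hFs.const_mul _)) (ae_of_all _ hpt)
    _ = 16 * ℓ ^ 2 * ∫ ω, E.indicator (fun _ => (1 : ℝ)) (X i ω, e i ω) ∂P +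
        η⁻¹ ^ 2 * 2 * ∫ ω, (F' ω + (2 * ℓ) ^ 2 * F ω) ∂P := by
        rw [integral_add (hIE.const_mul _) (hFs.const_mul _), integral_const_mul,
          integral_const_mul]
    _ ≤ _ := by
        rw [scoreError, mul_assoc (η⁻¹ ^ 2)]
        gcongr

theorem memLp_scoreEst (h : BulkCoupling P G Z e X W B α b d) (hσ : 0 < σ) {Y : Ω → ℝ}
    (hY : Measurable Y) : MemLp (fun ω => scoreEst σ (fun j => Z j ω) (Y ω)) 2 P :=
  memLp_of_abs_le (measurable_scoreEst h.meas_Z hY σ) fun _ => abs_scoreEst_le hσ _ _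

/-- The risk of the estimated score at a point of the bulk. -/
theorem integral_scoreEst_add_sq_le_of_mem (h : BulkCoupling P G Z e X W B α b d)
    (hσ : 0 < σ) (hσ1 : σ ≤ 1) (hn : 0 < n) (hη : 0 < η) (hR : 0 < R) (hδ : 0 < δ)
    (hC : (signalNoise G).real {q | smoothDensity G σ (q.1 + q.2) < η ∨ R < |q.1 + q.2|} ≤
      C * (R * η + (R ^ 2)⁻¹)) {i : Fin n} (hi : i ∈ B) :
    ∫ ω, (scoreEst σ (fun j => Z j ω) (Z i ω) + e i ω) ^ 2 ∂P ≤
      (√(∫ q, (smoothScore G σ (q.1 + q.2) + q.2) ^ 2 ∂(signalNoise G)) +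
        √(scoreError σ⁻¹ C η R δ (empiricalError σ⁻¹ α b d n)) + 8 * σ⁻¹ ^ 2 * α) ^ 2 := by
  have hσi := inv_pos.2 hσ
  have hXe : Measurable fun ω => X i ω + e i ω := (h.meas_X i).add (h.meas_e i)
  have m1 := h.memLp_scoreEst hσ (h.meas_Z i)
  have m2 := h.memLp_scoreEst hσ hXe
  have m3 : MemLp (fun ω => smoothScore G σ (X i ω + e i ω)) 2 P :=
    memLp_of_abs_le ((measurable_smoothScore σ).comp hXe) fun ω => abs_smoothScore_le hσ _
  have me := h.memLp_e i
  have p0 : MemLp (fun ω => scoreEst σ (fun j => Z j ω) (Z i ω) + e i ω) 2 P := m1.add me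
  rw [← lpNorm_two_sq p0]
  refine pow_le_pow_left₀ lpNorm_nonneg ?_ 2
  have p1 : MemLp (fun ω => smoothScore G σ (X i ω + e i ω) + e i ω) 2 P := m3.add me
  have p2 : MemLp (fun ω => scoreEst σ (fun j => Z j ω) (X i ω + e i ω) -
      smoothScore G σ (X i ω + e i ω)) 2 P := m2.sub m3
  -- The three parts are the oracle error with the smoothed score, the estimation error at the
  -- coupled point, and the change of argument, which the Lipschitz bound controls.
  have ed : (fun ω => scoreEst σ (fun j => Z j ω) (Z i ω) + e i ω) = fun ω =>
      ((smoothScore G σ (X i ω + e i ω) + e i ω) +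
        (scoreEst σ (fun j => Z j ω) (X i ω + e i ω) - smoothScore G σ (X i ω + e i ω))) +
      (scoreEst σ (fun j => Z j ω) (Z i ω) - scoreEst σ (fun j => Z j ω) (X i ω + e i ω)) := by
    funext ω; ring
  rw [ed]
  refine (lpNorm_fun_add_le (p1.add p2)).trans (add_le_add
    ((lpNorm_fun_add_le p1).trans (add_le_add ?_ ?_)) ?_)
  · refine Real.le_sqrt_of_sq_le ?_
    rw [lpNorm_two_sq p1]
    refine (h.integral_eq hi (F := fun q => (smoothScore G σ (q.1 + q.2) + q.2) ^ 2) ?_).le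
    exact (((measurable_smoothScore σ).comp (by fun_prop)).add measurable_snd).pow_const 2
  · refine Real.le_sqrt_of_sq_le ?_
    rw [lpNorm_two_sq p2]
    exact h.integral_scoreEst_sub_smoothScore_sq_le hσ hσ1 hn hη hR hδ hC hi
  · refine (lpNorm_le_const_mul ((h.memLp_Z i).sub (h.memLp_sum hi)) (by positivity)
      fun ω => abs_scoreEst_sub_le hσ hn _ _ _).trans ?_
    gcongr
    exact h.close_Z i hi

/-- A crude bound, valid at every coordinate because the estimated score is bounded; it is applied
to the few coordinates outside `B`. -/
theorem integral_scoreEst_add_sq_le (h : BulkCoupling P G Z e X W B α b d) (hσ : 0 < σ)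
    (i : Fin n) :
    ∫ ω, (scoreEst σ (fun j => Z j ω) (Z i ω) + e i ω) ^ 2 ∂P ≤ 8 * σ⁻¹ ^ 2 + 2 := by
  have hσi := inv_pos.2 hσ
  have hI : Integrable (fun ω => e i ω ^ 2) P := (h.memLp_e i).integrable_sq
  calc _ ≤ ∫ ω, (8 * σ⁻¹ ^ 2 + 2 * e i ω ^ 2) ∂P := by
        refine integral_mono_of_nonneg (ae_of_all _ fun ω => sq_nonneg _)
          ((integrable_const _).add (hI.const_mul 2)) (ae_of_all _ fun ω => ?_)
        have h1 := abs_scoreEst_le hσ (fun j => Z j ω) (Z i ω)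
        have h2 : scoreEst σ (fun j => Z j ω) (Z i ω) ^ 2 ≤ (2 * σ⁻¹) ^ 2 := by
          rw [sq_le_sq, abs_of_pos (by positivity : 0 < 2 * σ⁻¹)]; exact h1
        simp only
        nlinarith [sq_nonneg (scoreEst σ (fun j => Z j ω) (Z i ω) - e i ω)]
    _ = _ := by
        rw [integral_add (integrable_const _) (hI.const_mul 2), integral_const_mul 2, h.noise_sq]
        simp

/-- The total risk of the estimated score. -/
theorem sum_integral_scoreEst_add_sq_le (h : BulkCoupling P G Z e X W B α b d)
    (hσ : 0 < σ) (hσ1 : σ ≤ 1) (hn : 0 < n) (hη : 0 < η) (hR : 0 < R) (hδ : 0 < δ)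
    (hC : (signalNoise G).real {q | smoothDensity G σ (q.1 + q.2) < η ∨ R < |q.1 + q.2|} ≤
      C * (R * η + (R ^ 2)⁻¹)) :
    ∑ i, ∫ ω, (scoreEst σ (fun j => Z j ω) (Z i ω) + e i ω) ^ 2 ∂P ≤
      n * (√(∫ q, (smoothScore G σ (q.1 + q.2) + q.2) ^ 2 ∂(signalNoise G)) +
        √(scoreError σ⁻¹ C η R δ (empiricalError σ⁻¹ α b d n)) + 8 * σ⁻¹ ^ 2 * α) ^ 2 +
      b * (8 * σ⁻¹ ^ 2 + 2) := by
  rw [← Finset.sum_add_sum_compl B]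
  have hB : (B.card : ℝ) ≤ n := by
    have := Finset.card_le_univ B
    rw [Fintype.card_fin] at this
    exact_mod_cast this
  have hb : (Bᶜ.card : ℝ) ≤ b := by exact_mod_cast h.card_compl
  refine add_le_add ?_ ?_
  · refine (Finset.sum_le_sum fun i hi =>
      h.integral_scoreEst_add_sq_le_of_mem hσ hσ1 hn hη hR hδ hC hi).trans ?_
    rw [Finset.sum_const, nsmul_eq_mul]
    gcongr
  · refine (Finset.sum_le_sum fun i _ => h.integral_scoreEst_add_sq_le hσ i).trans ?_
    rw [Finset.sum_const, nsmul_eq_mul]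
    gcongr

end BulkCoupling

end EBKalman

/-! ### Rates -/

namespace EBKalman

/-- With windows of length about `a = n ^ (1/16)`, the numbers of dependent neighbours and of edge
coordinates are of order `a`. The leading term `√(d / n)` is then of order `a ^ (-15/2)`. -/
theorem empiricalError_le {a ℓ α : ℝ} {b d n : ℕ} (ha : 1 ≤ a) (hℓ : 1 ≤ ℓ) (hn : (n : ℝ) = a ^ 16)
    (hα : α ≤ a⁻¹ ^ 20) (hb : (b : ℝ) ≤ 4 * a) (hd : (d : ℝ) ≤ 7 * a) :
    empiricalError ℓ α b d n ≤ 40 * ℓ ^ 3 * a⁻¹ ^ 7 := by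
  have ha0 : 0 < a := by linarith
  set u := a⁻¹ with hu
  have hu0 : 0 < u := inv_pos.2 ha0
  have hu1 : u ≤ 1 := inv_le_one_of_one_le₀ ha
  have hau : a * u = 1 := mul_inv_cancel₀ ha0.ne'
  have hni : (n : ℝ)⁻¹ = u ^ 16 := by rw [hn, hu, inv_pow]
  have h23 : ℓ ^ 2 ≤ ℓ ^ 3 := pow_le_pow_right₀ hℓ (by norm_num)
  have h1 : α ≤ u ^ 7 := hα.trans (pow_le_pow_of_le_one hu0.le hu1 (by norm_num))
  have h2 : √(d / n) ≤ 3 * u ^ 7 := by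
    refine Real.sqrt_le_iff.2 ⟨by positivity, ?_⟩
    rw [div_eq_mul_inv, hni]
    calc (d : ℝ) * u ^ 16 ≤ 7 * a * u ^ 16 := by gcongr
      _ = 7 * (a * u) * u ^ 15 := by ring
      _ ≤ 9 * u ^ 14 := by
          rw [hau]
          have : u ^ 15 ≤ u ^ 14 := pow_le_pow_of_le_one hu0.le hu1 (by norm_num)
          have := pow_pos hu0 14
          linarith
      _ = _ := by ring
  have h3 : (b : ℝ) / n ≤ 4 * u ^ 7 := by
    rw [div_eq_mul_inv, hni]
    calc (b : ℝ) * u ^ 16 ≤ 4 * a * u ^ 16 := by gcongr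
      _ = 4 * (a * u) * u ^ 15 := by ring
      _ ≤ _ := by
          rw [hau]
          have : u ^ 15 ≤ u ^ 7 := pow_le_pow_of_le_one hu0.le hu1 (by norm_num)
          linarith
  rw [empiricalError, mul_div_assoc]
  calc _ ≤ 3 * (4 * ℓ ^ 3) * u ^ 7 + 2 * (2 * ℓ ^ 3) * (3 * u ^ 7) +
        2 * (2 * ℓ ^ 3) * (4 * u ^ 7) := by gcongr
    _ = _ := by ring

/-- The choices `η = a⁻²`, `R = a`, `δ = a⁻⁴` balance three terms, up to powers of `ℓ`. The rare
event has probability of order `R η + R⁻² ≤ 2 a⁻¹`; about `a ^ 5` grid points with squared error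
`a⁻¹⁴`, amplified by `η⁻²`, give `a⁻⁵`; the mesh gives `η⁻² δ ^ 2 = a⁻⁴`. -/
theorem scoreError_le {a ℓ C r : ℝ} (ha : 1 ≤ a) (hℓ : 1 ≤ ℓ) (hC : 0 ≤ C) (hr0 : 0 ≤ r)
    (hr : r ≤ 40 * ℓ ^ 3 * a⁻¹ ^ 7) :
    scoreError ℓ C (a⁻¹ ^ 2) a (a⁻¹ ^ 4) r ≤ (32 * C + 97280) * (ℓ ^ 8 * a⁻¹) := by
  have ha0 : 0 < a := by linarith
  set u := a⁻¹ with hu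
  have hu0 : 0 < u := inv_pos.2 ha0
  have hu1 : u ≤ 1 := inv_le_one_of_one_le₀ ha
  have ea : a = u⁻¹ := by rw [hu, inv_inv]
  have hu41 : u ^ 4 ≤ u := by simpa using pow_le_pow_of_le_one hu0.le hu1 (show 1 ≤ 4 by norm_num)
  have hu51 : u ^ 5 ≤ u := by simpa using pow_le_pow_of_le_one hu0.le hu1 (show 1 ≤ 5 by norm_num)
  have h28 : ℓ ^ 2 ≤ ℓ ^ 8 := pow_le_pow_right₀ hℓ (by norm_num)
  have h1 : a * u ^ 2 + (a ^ 2)⁻¹ ≤ 2 * u := by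
    have e1 : a * u ^ 2 = u := by rw [ea]; field_simp
    have e2 : (a ^ 2)⁻¹ = u ^ 2 := by rw [hu, inv_pow]
    rw [e1, e2]
    nlinarith
  have h2 : (1 + (2 * ℓ) ^ 2) ≤ 5 * ℓ ^ 2 := by nlinarith
  have h3 : 2 * (2 * a / u ^ 4 + 1) * r ^ 2 ≤ 9600 * ℓ ^ 6 * u ^ 9 := by
    have e1 : 2 * a / u ^ 4 + 1 ≤ 3 * (u ^ 5)⁻¹ := by
      have e2 : 2 * a / u ^ 4 = 2 * (u ^ 5)⁻¹ := by rw [ea]; field_simp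
      have e3 : 1 ≤ (u ^ 5)⁻¹ := (one_le_inv₀ (by positivity)).2 (pow_le_one₀ hu0.le hu1)
      rw [e2]; linarith
    calc _ ≤ 2 * (3 * (u ^ 5)⁻¹) * (40 * ℓ ^ 3 * u ^ 7) ^ 2 := by gcongr
      _ = _ := by field_simp; ring
  have e4 : (u ^ 2)⁻¹ ^ 2 = (u ^ 4)⁻¹ := by rw [inv_pow, ← pow_mul]
  rw [scoreError, e4]
  calc _ ≤ 16 * ℓ ^ 2 * (C * (2 * u)) + (u ^ 4)⁻¹ * (2 * (5 * ℓ ^ 2 *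
        (9600 * ℓ ^ 6 * u ^ 9 + 2 * (2 * (4 * ℓ ^ 3) * u ^ 4) ^ 2))) := by gcongr
    _ = 32 * C * (ℓ ^ 2 * u) + 96000 * ℓ ^ 8 * u ^ 5 + 1280 * ℓ ^ 8 * u ^ 4 := by
        field_simp; ring
    _ ≤ 32 * C * (ℓ ^ 8 * u) + 96000 * ℓ ^ 8 * u + 1280 * ℓ ^ 8 * u := by gcongr
    _ = _ := by ring

/-- The slowly growing scale `n ^ (1 / 16)`. -/
noncomputable def slowScale (n : ℕ) : ℝ := (n : ℝ) ^ (1 / 16 : ℝ)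

theorem slowScale_pow (n : ℕ) : slowScale n ^ 16 = n := by
  rw [slowScale, ← Real.rpow_natCast, ← Real.rpow_mul (by positivity)]
  norm_num

theorem one_le_slowScale {n : ℕ} (hn : 1 ≤ n) : 1 ≤ slowScale n :=
  Real.one_le_rpow (by exact_mod_cast hn) (by norm_num)

theorem tendsto_slowScale : Tendsto slowScale atTop atTop :=
  (tendsto_rpow_atTop (by norm_num)).comp tendsto_natCast_atTop_atTop

theorem tendsto_floor_slowScale : Tendsto (fun n => ⌊slowScale n⌋₊) atTop atTop :=
  tendsto_nat_floor_atTop.comp tendsto_slowScale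

theorem tendsto_log_pow_mul_slowScale_inv (k : ℕ) :
    Tendsto (fun n : ℕ => Real.log n ^ k * (slowScale n)⁻¹) atTop (nhds 0) := by
  have h := (isLittleO_log_rpow_rpow_atTop (k : ℝ)
    (by norm_num : (0 : ℝ) < 1 / 16)).tendsto_div_nhds_zero.comp tendsto_natCast_atTop_atTop
  refine h.congr fun n => ?_
  simp [slowScale, div_eq_mul_inv]

/-- Writing `n = a ^ 16`, the claim is that `a ^ 36` is beaten by a geometric factor. The shift by
one in the proof reflects `a ≤ ⌊a⌋ + 1`. -/
theorem eventually_geometric_le {D ρ : ℝ} (hD : 0 ≤ D) (hρ : 0 < ρ) (hρ1 : ρ < 1) :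
    ∀ᶠ n : ℕ in atTop, D * n * ρ ^ ⌊slowScale n⌋₊ ≤ (slowScale n)⁻¹ ^ 20 := by
  have h1 : Tendsto (fun m : ℕ => D * ρ⁻¹ * (((m + 1 : ℕ) : ℝ) ^ 36 * ρ ^ (m + 1))) atTop
      (nhds 0) := by
    have := (tendsto_pow_const_mul_const_pow_of_abs_lt_one 36
      (by rwa [abs_of_pos hρ] : |ρ| < 1)).comp (tendsto_add_atTop_nat 1)
    simpa using this.const_mul (D * ρ⁻¹)
  filter_upwards [(h1.comp tendsto_floor_slowScale).eventually (gt_mem_nhds one_pos),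
    eventually_ge_atTop 1] with n hn hn1
  have ha := one_le_slowScale hn1
  set a := slowScale n
  have ha0 : 0 < a := by linarith
  have h2 : a ≤ ((⌊a⌋₊ + 1 : ℕ) : ℝ) := by
    have := Nat.lt_floor_add_one a
    push_cast
    exact this.le
  have e : (n : ℝ) = a ^ 16 := (slowScale_pow n).symm
  have h3 : D * n * ρ ^ ⌊a⌋₊ * a ^ 20 ≤ 1 := by
    calc _ = D * ρ⁻¹ * (a ^ 36 * ρ ^ (⌊a⌋₊ + 1)) := by
          rw [e]
          field_simp
          ring
      _ ≤ D * ρ⁻¹ * (((⌊a⌋₊ + 1 : ℕ) : ℝ) ^ 36 * ρ ^ (⌊a⌋₊ + 1)) := by gcongr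
      _ ≤ 1 := hn.le
  rwa [inv_pow, ← one_div, le_div_iff₀ (by positivity)]

/-- The errors of the empirical means and of the estimated score, with the bandwidth `1 / log n`
and windows of length `slowScale n`. -/
theorem tendsto_scoreError {D ρ C : ℝ} (hD : 0 ≤ D) (hρ : 0 < ρ) (hρ1 : ρ < 1) (hC : 0 ≤ C) :
    Tendsto (fun n : ℕ => scoreError (Real.log n) C ((slowScale n)⁻¹ ^ 2) (slowScale n)
      ((slowScale n)⁻¹ ^ 4) (empiricalError (Real.log n) (D * n * ρ ^ ⌊slowScale n⌋₊)
        (2 * ⌊slowScale n⌋₊ + 2) (4 * ⌊slowScale n⌋₊ + 3) n)) atTop (nhds 0) := by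
  have h1 := (tendsto_log_pow_mul_slowScale_inv 8).const_mul (32 * C + 97280)
  rw [mul_zero] at h1
  have hlog : ∀ᶠ n : ℕ in atTop, 1 ≤ Real.log n :=
    (Real.tendsto_log_atTop.comp tendsto_natCast_atTop_atTop).eventually_ge_atTop 1
  refine squeeze_zero' ?_ ?_ h1
  · filter_upwards [eventually_ge_atTop 1] with n hn
    have := one_le_slowScale hn
    rw [scoreError]
    positivity
  · filter_upwards [hlog, eventually_geometric_le hD hρ hρ1, eventually_ge_atTop 1] with n hl hα hn
    have ha := one_le_slowScale hn
    have hfl := Nat.floor_le (by linarith : 0 ≤ slowScale n)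
    refine scoreError_le ha hl hC ?_ (empiricalError_le ha hl (slowScale_pow n).symm hα ?_ ?_)
    · rw [empiricalError]; positivity
    · push_cast; linarith
    · push_cast; linarith

theorem tendsto_log_sq_mul_geometric {D ρ : ℝ} (hD : 0 ≤ D) (hρ : 0 < ρ) (hρ1 : ρ < 1) :
    Tendsto (fun n : ℕ => 8 * Real.log n ^ 2 * (D * n * ρ ^ ⌊slowScale n⌋₊)) atTop (nhds 0) := by
  have h1 := (tendsto_log_pow_mul_slowScale_inv 2).const_mul 8
  rw [mul_zero] at h1
  refine squeeze_zero' (Eventually.of_forall fun n => by positivity) ?_ h1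
  filter_upwards [eventually_geometric_le hD hρ hρ1, eventually_ge_atTop 1] with n hα hn
  have ha := one_le_slowScale hn
  have h2 : (slowScale n)⁻¹ ^ 20 ≤ (slowScale n)⁻¹ := by
    simpa using pow_le_pow_of_le_one (by positivity) (inv_le_one_of_one_le₀ ha)
      (show 1 ≤ 20 by norm_num)
  rw [← mul_assoc 8]
  gcongr
  exact hα.trans h2

theorem tendsto_edge :
    Tendsto (fun n : ℕ => ((2 * ⌊slowScale n⌋₊ + 2 : ℕ) : ℝ) * (8 * Real.log n ^ 2 + 2) / n) atTop
      (nhds 0) := by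
  have h1 := (tendsto_log_pow_mul_slowScale_inv 2).const_mul 40
  rw [mul_zero] at h1
  have hlog : ∀ᶠ n : ℕ in atTop, 1 ≤ Real.log n :=
    (Real.tendsto_log_atTop.comp tendsto_natCast_atTop_atTop).eventually_ge_atTop 1
  refine squeeze_zero' (Eventually.of_forall fun n => by positivity) ?_ h1
  filter_upwards [hlog, eventually_ge_atTop 1] with n hl hn
  have ha := one_le_slowScale hn
  have hfl := Nat.floor_le (by linarith : 0 ≤ slowScale n)
  have hn' : (n : ℝ) = slowScale n ^ 16 := (slowScale_pow n).symm
  set a := slowScale n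
  have ha0 : 0 < a := by linarith
  have h2 : ((2 * ⌊a⌋₊ + 2 : ℕ) : ℝ) ≤ 4 * a := by push_cast; linarith
  have h3 : 8 * Real.log n ^ 2 + 2 ≤ 10 * Real.log n ^ 2 := by nlinarith
  have h4 : a ^ 2 ≤ n := by rw [hn']; exact pow_le_pow_right₀ ha (by norm_num)
  calc _ ≤ 4 * a * (10 * Real.log n ^ 2) / a ^ 2 := by gcongr
    _ = _ := by field_simp; ring

/-- The bound for the average risk of the estimated score tends to the risk of the score. -/
theorem tendsto_riskBound {D ρ C R₀ : ℝ} (hD : 0 ≤ D) (hρ : 0 < ρ) (hρ1 : ρ < 1) (hC : 0 ≤ C)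
    (hR₀ : 0 ≤ R₀) {g : ℝ → ℝ} (hg : Tendsto g (nhdsWithin 0 (Set.Ioi 0)) (nhds R₀)) :
    Tendsto (fun n : ℕ => (√(g (1 / Real.log n)) +
      √(scoreError (Real.log n) C ((slowScale n)⁻¹ ^ 2) (slowScale n)
        ((slowScale n)⁻¹ ^ 4) (empiricalError (Real.log n) (D * n * ρ ^ ⌊slowScale n⌋₊)
          (2 * ⌊slowScale n⌋₊ + 2) (4 * ⌊slowScale n⌋₊ + 3) n)) +
      8 * Real.log n ^ 2 * (D * n * ρ ^ ⌊slowScale n⌋₊)) ^ 2 +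
      ((2 * ⌊slowScale n⌋₊ + 2 : ℕ) : ℝ) * (8 * Real.log n ^ 2 + 2) / n) atTop (nhds R₀) := by
  have hl : Tendsto (fun n : ℕ => 1 / Real.log n) atTop (nhdsWithin 0 (Set.Ioi 0)) := by
    simp only [one_div]
    exact tendsto_inv_atTop_nhdsGT_zero.comp
      (Real.tendsto_log_atTop.comp tendsto_natCast_atTop_atTop)
  have h1 := (hg.comp hl).sqrt
  have h2 := (tendsto_scoreError hD hρ hρ1 hC).sqrt
  have h3 := (((h1.add h2).add (tendsto_log_sq_mul_geometric hD hρ hρ1)).pow 2).add tendsto_edge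
  simpa [Real.sq_sqrt hR₀] using h3

end EBKalman

/-! ### The state-space model -/

namespace EBKalman

theorem card_compl_bulk_le (n m : ℕ) :
    (Finset.univ.filter fun i : Fin n => m < i ∧ i + m < n)ᶜ.card ≤ 2 * m + 2 := by
  calc _ ≤ (Finset.range (m + 1) ∪ Finset.Ico (n - m) n).card := by
        refine Finset.card_le_card_of_injOn Fin.val (fun i hi => ?_) Fin.val_injective.injOn
        simp only [Finset.coe_compl, Set.mem_compl_iff, Finset.mem_coe, Finset.mem_filter,
          Finset.mem_univ, true_and, not_and, not_lt] at hi
        simp only [Finset.mem_coe, Finset.mem_union, Finset.mem_range, Finset.mem_Ico]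
        have := i.2
        omega
    _ ≤ (m + 1) + (n - (n - m)) := by
        refine (Finset.card_union_le _ _).trans ?_
        simp
    _ ≤ _ := by omega

theorem card_window_le (n m : ℕ) (i : Fin n) :
    (Finset.univ.filter fun j : Fin n => ¬(i + 2 * m < j) ∧ ¬(j + 2 * m < (i : ℕ))).card ≤
      4 * m + 3 := by
  calc _ ≤ (Finset.Icc ((i : ℕ) - 2 * m) (i + 2 * m)).card := by
        refine Finset.card_le_card_of_injOn Fin.val (fun j hj => ?_) Fin.val_injective.injOn
        simp only [Finset.mem_coe, Finset.mem_filter, Finset.mem_univ, true_and, not_lt] at hj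
        simp only [Finset.mem_coe, Finset.mem_Icc]
        omega
    _ ≤ _ := by rw [Nat.card_Icc]; omega

end EBKalman

namespace ARNoise

open EBKalman

variable {Ω : Type*} [MeasurableSpace Ω] {P : Measure Ω} [IsProbabilityMeasure P]
  {μ₀ : Ω → ℝ} {U ε : ℕ → Ω → ℝ}

theorem map_prodMk_eq_signalNoise (h : ARNoise P μ₀ U ε) {X : Ω → ℝ} {G : Measure ℝ} {i : ℕ}
    (hX : Measurable X) (hG : P.map X = G) (hind : IndepFun X (ε i) P) :
    P.map (fun ω => (X ω, ε i ω)) = signalNoise G := by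
  rw [(indepFun_iff_map_prod_eq_prod_map_map hX.aemeasurable (h.meas_ε i).aemeasurable).1 hind,
    hG, h.law_ε, signalNoise]

/-- The differences `Z i = Y i - μ̃ᴷ i` of a long series are coupled with independent sums of
non-normal signals and noise. -/
theorem exists_bulkCoupling (h : ARNoise P μ₀ U ε) (φ : ℝ)
    (hU : ∀ (m : ℝ) (v : ℝ≥0), P.map (U 0) ≠ gaussianReal m v) :
    ∃ G : Measure ℝ, IsProbabilityMeasure G ∧ MemLp id 2 G ∧
      (∀ w : ℝ≥0, (signalNoise G).map (fun q => q.1 + q.2) ≠ gaussianReal 0 w) ∧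
      ∃ D ρ : ℝ, 0 ≤ D ∧ 0 < ρ ∧ ρ < 1 ∧ ∀ᶠ n : ℕ in atTop,
        ∃ (X W : Fin n → Ω → ℝ) (B : Finset (Fin n)),
          BulkCoupling P G (fun i ω => obsVec φ μ₀ U ε n i ω -
            kalmanLeaveOut P (stateVec φ μ₀ U n) (obsVec φ μ₀ U ε n) i ω) (fun i => ε i) X W B
            (D * n * ρ ^ ⌊slowScale n⌋₊) (2 * ⌊slowScale n⌋₊ + 2) (4 * ⌊slowScale n⌋₊ + 3) := by
  classical
  obtain ⟨G, a, b, D, ρ, m₀, hD, hρ, hρ1, hc⟩ := h.exists_bulk_coupling φ hU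
  -- `G` does not depend on `n`, so a single coordinate of one sufficiently long series reveals that
  -- it is a probability law with finite second moment and non-normal convolution.
  obtain ⟨X₀, hX₀m, hX₀2, hX₀G, hX₀i, hX₀n, -⟩ := hc (2 * m₀ + 3) ⟨m₀ + 1, by omega⟩ m₀ le_rfl
    (by simp) (by simp only; omega)
  have hG : IsProbabilityMeasure G := hX₀G ▸ Measure.isProbabilityMeasure_map hX₀m.aemeasurable
  refine ⟨G, hG, ?_, fun w => ?_, D, ρ, hD, hρ, hρ1, ?_⟩
  · rw [← hX₀G]
    exact (memLp_map_measure_iff aestronglyMeasurable_id hX₀m.aemeasurable).2 hX₀2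
  · rw [← h.map_prodMk_eq_signalNoise hX₀m hX₀G hX₀i, Measure.map_map (by fun_prop)
      (hX₀m.prodMk (h.meas_ε _))]
    exact hX₀n w
  filter_upwards [tendsto_floor_slowScale.eventually_ge_atTop m₀, eventually_ge_atTop 1]
    with n hm hn
  set m := ⌊slowScale n⌋₊
  set B : Finset (Fin n) := Finset.univ.filter fun i : Fin n => m < i ∧ i + m < n with hB
  have hBi : ∀ i ∈ B, m < (i : ℕ) ∧ (i : ℕ) + m < n := fun i hi => (Finset.mem_filter.1 hi).2
  have hex : ∀ i : Fin n, ∃ X : Ω → ℝ, Measurable X ∧ (i ∈ B → MemLp X 2 P ∧ P.map X = G ∧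
      IndepFun X (ε i) P ∧
      lpNorm (fun ω => obs φ μ₀ U ε i ω -
        kalmanLeaveOut P (stateVec φ μ₀ U n) (obsVec φ μ₀ U ε n) i ω - (X ω + ε i ω)) 2 P ≤
          D * n * ρ ^ m ∧
      lpNorm (fun ω => movingAvg a b U ε (fun k => ((i : ℤ) + k).toNat) m ω + ε i ω -
        (X ω + ε i ω)) 2 P ≤ D * ρ ^ m) := by
    intro i
    by_cases hi : i ∈ B
    · obtain ⟨X, h1, h2, h3, h4, -, h5, h6⟩ := hc n i m hm (hBi i hi).1 (hBi i hi).2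
      exact ⟨X, h1, fun _ => ⟨h2, h3, h4, h5, h6⟩⟩
    -- Outside the bulk only measurability of the coupled signal is needed.
    · exact ⟨0, measurable_zero, fun hi' => absurd hi' hi⟩
  choose X hXm hX using hex
  have hn1 : (1 : ℝ) ≤ n := by exact_mod_cast hn
  refine ⟨X, fun i ω => movingAvg a b U ε (fun k => ((i : ℤ) + k).toNat) m ω + ε i ω, B, ?_⟩
  exact
    { meas_Z := fun i => (h.measurable_obs φ i).sub (h.measurable_leaveOut φ i)
      meas_e := fun i => h.meas_ε i
      meas_X := hXm
      meas_W := fun i => (h.measurable_movingAvg a b _ m).add (h.meas_ε i)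
      memLp_Z := fun i => (h.memLp_obs φ i).sub (h.memLp_leaveOut φ i)
      memLp_e := fun i => h.memLp_ε i
      memLp_X := fun i hi => (hX i hi).1
      memLp_W := fun i => (h.memLp_movingAvg a b _ m).add (h.memLp_ε i)
      law := fun i hi => h.map_prodMk_eq_signalNoise (hXm i) (hX i hi).2.1 (hX i hi).2.2.1
      close_Z := fun i hi => (hX i hi).2.2.2.1
      close_W := fun i hi => (hX i hi).2.2.2.2.trans (by
        have : D * ρ ^ m ≤ D * ρ ^ m * n := le_mul_of_one_le_right (by positivity) hn1
        calc _ ≤ _ := this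
          _ = _ := by ring)
      indep := fun i hi => ⟨_, card_window_le n m i, fun j hj hjS => by
        simp only [Finset.mem_filter, Finset.mem_univ, true_and, not_and_or, not_not] at hjS
        rcases hjS with hij | hij
        · exact h.indepFun_window a b (hBi i hi).1.le hij
        · exact (h.indepFun_window a b (hBi j hj).1.le hij).symm⟩
      card_compl := card_compl_bulk_le n m
      noise_sq := fun i => h.integral_ε_sq i
      nonneg := by positivity }

/-- The Kalman risk in terms of the law of the signal. -/
theorem le_sum_integral_sq_kalman_sub (h : ARNoise P μ₀ U ε) (φ : ℝ) {n : ℕ} {G : Measure ℝ}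
    [IsProbabilityMeasure G] {X W : Fin n → Ω → ℝ} {B : Finset (Fin n)} {α v : ℝ} {b d : ℕ}
    (hc : BulkCoupling P G (fun i ω => obsVec φ μ₀ U ε n i ω -
      kalmanLeaveOut P (stateVec φ μ₀ U n) (obsVec φ μ₀ U ε n) i ω) (fun i => ε i) X W B α b d)
    (hv : v = ∫ x, x ^ 2 ∂G) :
    (n - b) * (max 0 (√v - α) ^ 2 / (1 + max 0 (√v - α) ^ 2)) ≤
      ∑ i, ∫ ω, (kalman P (stateVec φ μ₀ U n) (obsVec φ μ₀ U ε n) i ω -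
        stateVec φ μ₀ U n i ω) ^ 2 ∂P := by
  set t := max 0 (√v - α) with ht
  have ht0 : 0 ≤ t := le_max_left _ _
  have key : ∀ i ∈ B, t ^ 2 / (1 + t ^ 2) ≤
      ∫ ω, (kalman P (stateVec φ μ₀ U n) (obsVec φ μ₀ U ε n) i ω -
        stateVec φ μ₀ U n i ω) ^ 2 ∂P := by
    intro i hi
    refine le_trans ?_ (h.le_integral_sq_kalman_sub φ i rfl)
    have hV : MemLp (fun ω => state φ μ₀ U i ω -
        kalmanLeaveOut P (stateVec φ μ₀ U n) (obsVec φ μ₀ U ε n) i ω) 2 P :=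
      (h.memLp_state φ i).sub (h.memLp_leaveOut φ i)
    rw [← lpNorm_two_sq hV]
    set s := lpNorm (fun ω => state φ μ₀ U i ω -
      kalmanLeaveOut P (stateVec φ μ₀ U n) (obsVec φ μ₀ U ε n) i ω) 2 P with hs
    have hXn : lpNorm (X i) 2 P = √v := by
      rw [← Real.sqrt_sq (lpNorm_nonneg (f := X i) (p := 2) (μ := P)),
        lpNorm_two_sq (hc.memLp_X i hi), hv]
      have h1 := hc.integral_eq hi (F := fun q => q.1 ^ 2) (by fun_prop)
      simp only at h1
      rw [h1, signalNoise, integral_fun_fst (fun x : ℝ => x ^ 2)]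
      simp
    -- The leave-one-out error differs from `X i` exactly by the coupling error of `Z i`, because `ε
    -- i` cancels. Its norm is therefore at least `√v - α`, and `t ↦ t ^ 2 / (1 + t ^ 2)` is
    -- increasing for `t ≥ 0`.
    have h2 : √v ≤ s + α := by
      have e : X i = fun ω => (state φ μ₀ U i ω -
          kalmanLeaveOut P (stateVec φ μ₀ U n) (obsVec φ μ₀ U ε n) i ω) +
          (-1) * (obsVec φ μ₀ U ε n i ω -
            kalmanLeaveOut P (stateVec φ μ₀ U n) (obsVec φ μ₀ U ε n) i ω -
              (X i ω + ε i ω)) := by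
        funext ω
        simp only [obsVec, obs]
        ring
      have h3 := lpNorm_fun_add_le (P := P) (D := fun ω => (-1) * (obsVec φ μ₀ U ε n i ω -
            kalmanLeaveOut P (stateVec φ μ₀ U n) (obsVec φ μ₀ U ε n) i ω -
              (X i ω + ε i ω))) hV
      rw [← e, hXn, lpNorm_const_mul_eq, abs_neg, abs_one, one_mul] at h3
      exact h3.trans (add_le_add le_rfl (hc.close_Z i hi))
    have hts : t ≤ s := max_le lpNorm_nonneg (by linarith)
    have h4 : t ^ 2 ≤ s ^ 2 := pow_le_pow_left₀ ht0 hts 2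
    rw [div_le_div_iff₀ (by positivity) (by positivity)]
    nlinarith
  have hcard : (n : ℝ) - b ≤ B.card := by
    have h1 := Finset.card_add_card_compl B
    rw [Fintype.card_fin] at h1
    have h2 := hc.card_compl
    have h3 : n ≤ B.card + b := by omega
    have h4 : (n : ℝ) ≤ B.card + b := by exact_mod_cast h3
    linarith
  calc _ ≤ (B.card : ℝ) * (t ^ 2 / (1 + t ^ 2)) := by gcongr
    _ = ∑ i ∈ B, t ^ 2 / (1 + t ^ 2) := by rw [Finset.sum_const, nsmul_eq_mul]
    _ ≤ ∑ i ∈ B, _ := Finset.sum_le_sum key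
    _ ≤ _ := Finset.sum_le_sum_of_subset_of_nonneg (Finset.subset_univ B)
        fun i _ _ => integral_nonneg fun ω => sq_nonneg _

/-- Adding `Z i` to the leave-one-out estimator restores `Y i = μ i + ε i`, so the state cancels. -/
theorem improved_sub_state (φ : ℝ) {n : ℕ} (i : Fin n) (ω : Ω) :
    improved P (stateVec φ μ₀ U n) (obsVec φ μ₀ U ε n) i ω - stateVec φ μ₀ U n i ω =
      scoreEst (1 / Real.log n) (fun j => obsVec φ μ₀ U ε n j ω -
        kalmanLeaveOut P (stateVec φ μ₀ U n) (obsVec φ μ₀ U ε n) j ω)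
        (obsVec φ μ₀ U ε n i ω -
          kalmanLeaveOut P (stateVec φ μ₀ U n) (obsVec φ μ₀ U ε n) i ω) + ε i ω := by
  rw [improved, deltaHat_eq]
  simp only [obsVec, obs, stateVec]
  ring

theorem memLp_improved_sub_state (h : ARNoise P μ₀ U ε) (φ : ℝ) {n : ℕ} (hn : 0 < Real.log n)
    (i : Fin n) : MemLp (fun ω => improved P (stateVec φ μ₀ U n) (obsVec φ μ₀ U ε n) i ω -
      stateVec φ μ₀ U n i ω) 2 P := by
  simp only [improved_sub_state]
  have hZ : ∀ i : Fin n, Measurable fun ω => obsVec φ μ₀ U ε n i ω -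
      kalmanLeaveOut P (stateVec φ μ₀ U n) (obsVec φ μ₀ U ε n) i ω := fun i =>
    (h.measurable_obs φ i).sub (h.measurable_leaveOut φ i)
  exact (memLp_of_abs_le (measurable_scoreEst hZ (hZ i) _)
    fun ω => abs_scoreEst_le (by positivity) _ _).add (h.memLp_ε i)

theorem memLp_kalman_sub_state (h : ARNoise P μ₀ U ε) (φ : ℝ) {n : ℕ} (i : Fin n) :
    MemLp (fun ω => kalman P (stateVec φ μ₀ U n) (obsVec φ μ₀ U ε n) i ω -
      stateVec φ μ₀ U n i ω) 2 P :=
  (h.memLp_kalman φ i).sub (h.memLp_state φ i)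

end ARNoise

/-! ### Comparison of the two total risks -/

theorem EBKalman.integrable_sqLoss {Ω : Type*} [MeasurableSpace Ω] {P : Measure Ω} {n : ℕ}
    {f g : Fin n → Ω → ℝ} (hf : ∀ i, MemLp (fun ω => f i ω - g i ω) 2 P) :
    Integrable (sqLoss f g) P ∧
      ∫ ω, sqLoss f g ω ∂P = ∑ i, ∫ ω, (f i ω - g i ω) ^ 2 ∂P :=
  ⟨integrable_finsetSum _ fun i _ => (hf i).integrable_sq,
    integral_finsetSum _ fun i _ => (hf i).integrable_sq⟩

/-- The lower bound for the Kalman risk per coordinate: the proportion of edge coordinates and the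
coupling error both vanish in the limit. -/
theorem EBKalman.tendsto_kalmanBound {D ρ v : ℝ} (hD : 0 ≤ D) (hρ : 0 < ρ) (hρ1 : ρ < 1)
    (hv : 0 ≤ v) :
    Tendsto (fun n : ℕ => (1 - ((2 * ⌊slowScale n⌋₊ + 2 : ℕ) : ℝ) / n) *
      (max 0 (√v - D * n * ρ ^ ⌊slowScale n⌋₊) ^ 2 /
        (1 + max 0 (√v - D * n * ρ ^ ⌊slowScale n⌋₊) ^ 2))) atTop (nhds (v / (1 + v))) := by
  have hlog : ∀ᶠ n : ℕ in atTop, 1 ≤ Real.log n :=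
    (Real.tendsto_log_atTop.comp tendsto_natCast_atTop_atTop).eventually_ge_atTop 1
  have h1 : Tendsto (fun n : ℕ => D * n * ρ ^ ⌊slowScale n⌋₊) atTop (nhds 0) := by
    refine squeeze_zero' (Eventually.of_forall fun n => by positivity) ?_
      (tendsto_log_sq_mul_geometric hD hρ hρ1)
    filter_upwards [hlog] with n hn
    exact le_mul_of_one_le_left (by positivity) (by nlinarith)
  have h2 : Tendsto (fun n : ℕ => ((2 * ⌊slowScale n⌋₊ + 2 : ℕ) : ℝ) / n) atTop (nhds 0) := by
    refine squeeze_zero' (Eventually.of_forall fun n => by positivity) ?_ tendsto_edge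
    filter_upwards [hlog] with n hn
    gcongr
    exact le_mul_of_one_le_right (by positivity) (by nlinarith)
  have h3 : Tendsto (fun n : ℕ => max 0 (√v - D * n * ρ ^ ⌊slowScale n⌋₊) ^ 2) atTop
      (nhds v) := by
    have := ((tendsto_const_nhds (x := (0 : ℝ))).max (h1.const_sub √v)).pow 2
    simpa [Real.sq_sqrt hv] using this
  have h4 := (h2.const_sub 1).mul (h3.div (h3.const_add 1) (by positivity))
  simpa using h4

theorem proposition2 {Ω : Type*} [MeasurableSpace Ω] (P : Measure Ω) [IsProbabilityMeasure P]
    (φ : ℝ) (μ₀ : Ω → ℝ) (U ε : ℕ → Ω → ℝ)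
    (hμ₀_meas : Measurable μ₀) (hU_meas : ∀ i, Measurable (U i)) (hε_meas : ∀ i, Measurable (ε i))
    -- the initial state, the innovations and the observation errors are mutually independent
    (hindep : iIndepFun (Sum.elim (fun _ : Unit => μ₀) (Sum.elim U ε)) P)
    -- the initial state is centred with finite variance
    (hμ₀_L2 : MemLp μ₀ 2 P) (hμ₀_mean : ∫ ω, μ₀ ω ∂P = 0)
    -- the innovations are identically distributed, centred, with finite variance
    (hU_ident : ∀ i, IdentDistrib (U i) (U 0) P P)
    (hU_L2 : MemLp (U 0) 2 P) (hU_mean : ∫ ω, U 0 ω ∂P = 0)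
    -- the observation errors are standard normal
    (hε_law : ∀ i, P.map (ε i) = gaussianReal 0 1)
    -- the innovations are not normal (point masses count as normal laws of variance zero)
    (hU_not_normal : ∀ (m : ℝ) (v : ℝ≥0), P.map (U 0) ≠ gaussianReal m v) :
    ∃ c ∈ Set.Ioo (0 : ℝ) 1, ∀ᶠ n : ℕ in atTop,
      Integrable (EBKalman.sqLoss (EBKalman.improved P (EBKalman.stateVec φ μ₀ U n)
        (EBKalman.obsVec φ μ₀ U ε n)) (EBKalman.stateVec φ μ₀ U n)) P ∧
      Integrable (EBKalman.sqLoss (EBKalman.kalman P (EBKalman.stateVec φ μ₀ U n)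
        (EBKalman.obsVec φ μ₀ U ε n)) (EBKalman.stateVec φ μ₀ U n)) P ∧
      ∫ ω, EBKalman.sqLoss (EBKalman.improved P (EBKalman.stateVec φ μ₀ U n)
        (EBKalman.obsVec φ μ₀ U ε n)) (EBKalman.stateVec φ μ₀ U n) ω ∂P ≤
        c * ∫ ω, EBKalman.sqLoss (EBKalman.kalman P (EBKalman.stateVec φ μ₀ U n)
          (EBKalman.obsVec φ μ₀ U ε n)) (EBKalman.stateVec φ μ₀ U n) ω ∂P := by
  have h : ARNoise P μ₀ U ε := ⟨hμ₀_meas, hU_meas, hε_meas, hindep, hμ₀_L2, hμ₀_mean, hU_ident,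
    hU_L2, hU_mean, hε_law⟩
  obtain ⟨G, hGp, hG, hnn, D, ρ, hD, hρ, hρ1, hcoup⟩ := h.exists_bulkCoupling φ hU_not_normal
  set v := ∫ x, x ^ 2 ∂G with hv
  have hv0 : 0 ≤ v := integral_nonneg fun x => sq_nonneg x
  set R₀ := ∫ q, (EBKalman.mixScore G (q.1 + q.2) + q.2) ^ 2 ∂(EBKalman.signalNoise G)
  have hgap : R₀ < v / (1 + v) := EBKalman.integral_mixScore_add_noise_sq_lt hG hnn hv
  have hR₀ : 0 ≤ R₀ := integral_nonneg fun q => sq_nonneg _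
  have hκ : 0 < v / (1 + v) := hR₀.trans_lt hgap
  -- Any `c` strictly between the ratio of the two limiting risks per coordinate and 1 works; the
  -- strict inequality leaves room for all error terms.
  obtain ⟨c, hc1, hc2⟩ := exists_between ((div_lt_one hκ).2 hgap)
  have hc0 : 0 < c := (div_nonneg hR₀ hκ.le).trans_lt hc1
  refine ⟨c, ⟨hc0, hc2⟩, ?_⟩
  obtain ⟨C, hC0, hC⟩ := EBKalman.exists_measureReal_smoothDensity_lt_le hG
  have hlim1 := EBKalman.tendsto_riskBound hD hρ hρ1 hC0 hR₀
    (EBKalman.tendsto_integral_smoothScore hG)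
  have hlim2 := (EBKalman.tendsto_kalmanBound hD hρ hρ1 hv0).const_mul c
  have hlog : ∀ᶠ n : ℕ in atTop, 1 ≤ Real.log n :=
    (Real.tendsto_log_atTop.comp tendsto_natCast_atTop_atTop).eventually_ge_atTop 1
  filter_upwards [hcoup, hlim1.eventually_lt hlim2 ((div_lt_iff₀ hκ).1 hc1), hlog,
    eventually_ge_atTop 1] with n ⟨X, W, B, hB⟩ hlt hl hn
  have hl0 : 0 < Real.log n := by linarith
  have hn0 : (0 : ℝ) < n := by exact_mod_cast hn
  have ha : 0 < EBKalman.slowScale n := zero_lt_one.trans_le (EBKalman.one_le_slowScale hn)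
  obtain ⟨hI1, hE1⟩ := EBKalman.integrable_sqLoss (h.memLp_improved_sub_state φ hl0)
  obtain ⟨hI2, hE2⟩ := EBKalman.integrable_sqLoss (h.memLp_kalman_sub_state φ (n := n))
  refine ⟨hI1, hI2, ?_⟩
  rw [hE1, hE2]
  have hσ : 0 < 1 / Real.log n := by positivity
  have hσ1 : 1 / Real.log n ≤ 1 := (div_le_one hl0).2 hl
  have b1 := hB.sum_integral_scoreEst_add_sq_le hσ hσ1 hn (η := (EBKalman.slowScale n)⁻¹ ^ 2)
    (R := EBKalman.slowScale n) (δ := (EBKalman.slowScale n)⁻¹ ^ 4) (by positivity) ha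
    (by positivity) (hC _ hσ hσ1 _ _ (by positivity) ha)
  rw [show (1 / Real.log n)⁻¹ = Real.log n by rw [one_div, inv_inv]] at b1
  have b2 := h.le_sum_integral_sq_kalman_sub φ hB hv
  simp only [ARNoise.improved_sub_state]
  refine b1.trans (le_trans ?_ (mul_le_mul_of_nonneg_left b2 hc0.le))
  -- The limits concern risks per coordinate; multiplying by `n` returns to the total risks.
  have hlt' := mul_le_mul_of_nonneg_left hlt.le hn0.le
  refine le_trans (le_of_eq ?_) (hlt'.trans (le_of_eq ?_))
  · field_simp
  · field_simp
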